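/- Let $n\ge 2$ and let $f:\mathbb R^n\to[0,\infty)$ and $h:\mathbb R^n\times\mathbb S^{n-1}\to[0,\infty)$ be lower semicontinuous and locally summable. For a Borel set $E$ write $|E|_f=\int_E f\,dx$ and, if $E$ has finite perimeter, $P_h(E)=\int_{\partial^*E}h(x,\nu_E(x))\,d\mathcal H^{n-1}(x)$, where $\partial^*E$ is the reduced boundary and $\nu_E$ the outer normal. The $(f,h)$-mean density of a set $F$ of finite perimeter is the number $\rho\ge 0$ with $P_h(F)=n(\omega_n\rho)^{1/n}|F|_f^{(n-1)/n}$, where $\omega_n$ is the volume of the unit ball. Put $h^+(x)=\sup_{\nu}h(x,\nu)$, $\tilde f=|f-1|$, $\tilde h=|h^+-1|$, and $\tilde h_r(t)=\frac{1}{\mathcal H^{n-1}(\partial B_{|t|})}\int_{\partial B_{|t|}}\tilde h\,d\mathcal H^{n-1}$, where $B_t$ is the ball of radius $t$ centred at the origin. Say that a lower semicontinuous function $\sigma$ on $\mathbb R^n$ converges from above to $1$ if $\sigma(x)\to1$ as $|x|\to\infty$ and $\sigma(x)\ge 1$ for all $x$ with $|x|$ large enough. Suppose that $h(x,\nu)\to1$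 as $|x|\to\infty$ for every $\nu\in\mathbb S^{n-1}$, that $f$ and $h^+$ converge from above to $1$, that $$\sup\{C\ge 0:\ \tilde f(x)\ge C\,\tilde h(x)\ \text{for all } |x| \text{ large enough}\}>\frac{n}{n-1},$$ and that $\int_R^\infty\tilde h_r(t)\,dt=+\infty$ for every sufficiently large $R$. Then for every $m>0$ there are sets $F$ of finite perimeter, arbitrarily far from the origin, with $|F|_f=m$ and $(f,h)$-mean density strictly less than $1$; that is, for every $r$ there is such an $F$ contained in $\{|x|>r\}$. Moreover, for every $\varepsilon>0$, $F$ can be chosen as the intersection of two balls of radius $(m/\omega_n)^{1/n}$ (unit balls if $m=\omega_n$) whose centres are equally far from the origin and at distance less than $\varepsilon$ from each other. -/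

import Mathlib

open MeasureTheory Filter Topology Set
open scoped ENNReal NNReal

namespace DoubleDensity

/-- Euclidean `n`-space. -/
abbrev Space (n : ℕ) : Type := EuclideanSpace ℝ (Fin n)

/-- The unit sphere of directions in Euclidean `n`-space. -/
abbrev Dir (n : ℕ) : Type := Metric.sphere (0 : Space n) 1

noncomputable section

/-! ### Sets of finite perimeter, reduced boundary and outer normal -/

/-- The divergence of a vector field. -/
def divergence {n : ℕ} (φ : Space n → Space n) (x : Space n) : ℝ :=
  ∑ i, (fderiv ℝ φ x (EuclideanSpace.single i 1)) i

/-- A Borel set has finite perimeter if `∫_E div φ` is bounded over all compactly supported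
`C¹` vector fields `φ` with `|φ| ≤ 1`. -/
def HasFinitePerimeter {n : ℕ} (E : Set (Space n)) : Prop :=
  MeasurableSet E ∧ ∃ C : ℝ, ∀ φ : Space n → Space n,
    ContDiff ℝ 1 φ → HasCompactSupport φ → (∀ x, ‖φ x‖ ≤ 1) →
      ∫ x in E, divergence φ x ≤ C

/-- `IsPolarDecomposition E μ σ` says that `-σ μ` is the polar decomposition of the
distributional gradient of the characteristic function of `E`: `μ` is its total variation and
`σ` is a `μ`-a.e. unit vector field. -/
def IsPolarDecomposition {n : ℕ} (E : Set (Space n)) (μ : Measure (Space n))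
    (σ : Space n → Space n) : Prop :=
  IsLocallyFiniteMeasure μ ∧ Measurable σ ∧ (∀ᵐ x ∂μ, ‖σ x‖ = 1) ∧
    ∀ φ : Space n → Space n, ContDiff ℝ 1 φ → HasCompactSupport φ →
      ∫ x in E, divergence φ x = ∫ x, inner ℝ (φ x) (σ x) ∂μ

/-- `x` belongs to the reduced boundary of `E` and the unit vector `ν` is the (measure
theoretic) outer normal of `E` at `x`: `x` lies in the support of the total variation and the
averages of `σ` on small balls around `x` converge to the unit vector `ν`. -/
def IsOuterNormal {n : ℕ} (E : Set (Space n)) (x : Space n) (ν : Dir n) : Prop :=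
  ∃ (μ : Measure (Space n)) (σ : Space n → Space n), IsPolarDecomposition E μ σ ∧
    x ∈ μ.support ∧
    Tendsto (fun r : ℝ => ⨍ y in Metric.ball x r, σ y ∂μ) (𝓝[>] 0) (𝓝 (ν : Space n))

/-- The (De Giorgi) reduced boundary. -/
def reducedBoundary {n : ℕ} (E : Set (Space n)) : Set (Space n) :=
  {x | ∃ ν : Dir n, IsOuterNormal E x ν}

/-! ### Double densities -/

/-- A double density: `f` on `ℝⁿ` and `h` on `ℝⁿ × Sⁿ⁻¹`, both lower semicontinuous and
locally summable. -/
structure IsDoubleDensity {n : ℕ} (f : Space n → ℝ≥0) (h : Space n → Dir n → ℝ≥0) : Prop where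
  lsc_volume : LowerSemicontinuous f
  locallyIntegrable_volume : LocallyIntegrable (fun x => (f x : ℝ)) volume
  lsc_perimeter : LowerSemicontinuous (fun p : Space n × Dir n => h p.1 p.2)
  locallyIntegrable_perimeter :
    LocallyIntegrable (fun p : Space n × Dir n => (h p.1 p.2 : ℝ))
      ((volume : Measure (Space n)).prod (volume : Measure (Space n)).toSphere)

/-- The weighted volume `|E|_f`. -/
def weightedVolume {n : ℕ} (f : Space n → ℝ≥0) (E : Set (Space n)) : ℝ≥0∞ :=
  ∫⁻ x in E, (f x : ℝ≥0∞)

/-- The weighted perimeter `P_h(E)`, the integral of `h(x, ν(x))` over the reduced boundary with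
respect to the `(n-1)`-dimensional Hausdorff measure. The outer normal is unique where it exists,
so the suprema just evaluate `h x` at the outer normal. -/
def weightedPerimeter {n : ℕ} (h : Space n → Dir n → ℝ≥0) (E : Set (Space n)) : ℝ≥0∞ :=
  ∫⁻ x in reducedBoundary E,
    (⨆ (ν : Dir n) (_ : IsOuterNormal E x ν), (h x ν : ℝ≥0∞)) ∂μHE[n - 1]

/-- `ρ` is the `(f, h)`-mean density of the set of finite perimeter `F`:
`P_h(F) = n (ω_n ρ)^(1/n) |F|_f^((n-1)/n)`, where `ω_n` is the volume of the unit ball. -/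
def IsMeanDensity {n : ℕ} (f : Space n → ℝ≥0) (h : Space n → Dir n → ℝ≥0)
    (F : Set (Space n)) (ρ : ℝ≥0) : Prop :=
  HasFinitePerimeter F ∧
    weightedPerimeter h F =
      (n : ℝ≥0∞) * (volume (Metric.ball (0 : Space n) 1) * (ρ : ℝ≥0∞)) ^ (1 / (n : ℝ))
        * weightedVolume f F ^ (((n : ℝ) - 1) / (n : ℝ))

/-- `σ` is lower semicontinuous and converges to `l` from above at infinity. -/
def ConvergesFromAbove {n : ℕ} (σ : Space n → ℝ≥0∞) (l : ℝ≥0∞) : Prop :=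
  LowerSemicontinuous σ ∧ Tendsto σ (Bornology.cobounded (Space n)) (𝓝 l) ∧
    ∃ M : ℝ, ∀ x, M < ‖x‖ → l ≤ σ x

/-- `h⁺(x) = sup_ν h(x, ν)`. -/
def hPlus {n : ℕ} (h : Space n → Dir n → ℝ≥0) (x : Space n) : ℝ≥0∞ :=
  ⨆ ν : Dir n, (h x ν : ℝ≥0∞)

/-- `|a - 1|` for `a` in `[0, ∞]` (subtraction is truncated, so one of the two terms is `0`). -/
def absSubOne (a : ℝ≥0∞) : ℝ≥0∞ := (a - 1) + (1 - a)

/-- `f̃ = |f - 1|`. -/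
def fTilde {n : ℕ} (f : Space n → ℝ≥0) (x : Space n) : ℝ≥0∞ := absSubOne (f x)

/-- `h̃ = |h⁺ - 1|`. -/
def hTilde {n : ℕ} (h : Space n → Dir n → ℝ≥0) (x : Space n) : ℝ≥0∞ := absSubOne (hPlus h x)

/-- The radial average of `g`: its mean over the sphere of radius `|t|` about the origin. -/
def radialAverage {n : ℕ} (g : Space n → ℝ≥0∞) (t : ℝ) : ℝ≥0∞ :=
  ⨍⁻ x in Metric.sphere (0 : Space n) |t|, g x ∂μHE[n - 1]

/-- `sup {C ≥ 0 : f̃ ≥ C h̃ for |x| ≫ 1}`, an element of `[0, ∞]`. -/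
def optimalRatio {n : ℕ} (f : Space n → ℝ≥0) (h : Space n → Dir n → ℝ≥0) : ℝ≥0∞ :=
  sSup ((fun C : ℝ≥0 => (C : ℝ≥0∞)) ''
    {C : ℝ≥0 | ∃ M : ℝ, ∀ x : Space n, M < ‖x‖ → (C : ℝ≥0∞) * hTilde h x ≤ fTilde f x})

end

end DoubleDensity

namespace DoubleDensity

open scoped Pointwise

/-! ### Orthogonal splitting along a direction -/

/-! Write n = k + 1, let B be the ball of radius s with |B| = m, and put g = h̃. Far from the origin
h⁺ = 1 + g and f ≥ 1 + C g for some C > n/(n-1). Since m = ω_n sⁿ, a set F with |F|_f = m has mean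
density below 1 exactly when s P_h(F) < n m.

A lens is a ball of radius s with its central slab of width d removed and the two remaining pieces
pushed together. A comparison of the slab with the belt it cuts from the sphere gives s P(lens) ≤
|B| + (n-1)|lens| (`mul_lensBoundaryIntegral_one_add_le`). If d is tuned so that |lens|_f = m, then
|lens| ≤ m - C ∫_lens g, hence s P_h(lens) ≤ n m + s ∫_∂lens g - (n-1) C ∫_lens g. So it suffices to
find one lens with s ∫_∂lens g < (n-1) C ∫_lens g (`mul_weightedPerimeter_lens_lt`).

Such a lens exists by averaging over its midpoint c. For balls, Fubini turns s ∫_∂B(c) g into n|B| ∫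
g and ∫_B(c) g into |B| ∫ g, and n < (n-1) C. Lenses are nearly balls because f → 1 forces d to be
small, and their two centres c ± (d/2) u(c) are Lipschitz perturbations of c with small constant
(`exists_lens_field`); so the strict inequality of constants survives
(`mul_lintegral_le_lintegral_lens`, `lintegral_lensBoundaryIntegral_le`). The averages are taken
against a weight comparable to |x|^(1-n), which is almost constant at scale s; by polar coordinates
the divergence of ∫ h̃_r dt says that the weighted integral of g is infinite, so boundary effects of
the averaging domain, being finite, cannot rescue the opposite inequality
(`exists_lensBoundaryIntegral_lt_of_lt`).

The direction is u(c) = Jc/|Jc| with J a quarter turn in one coordinate plane. As u(c) ⟂ c, the two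
centres are equally far from the origin. The field degenerates where |Jc| is small, but the weight
is summable on such a tube (`lintegral_weight_tube_lt_top`), so the tube may be discarded. -/

theorem exists_splitting {k : ℕ} (e : Space (k + 1)) (he : ‖e‖ = 1) :
    ∃ (Ψ : Space k × ℝ ≃ᵐ Space (k + 1)) (L : Space k →ₗᵢ[ℝ] Space (k + 1)),
      MeasurePreserving Ψ (volume.prod volume) volume ∧ (∀ y, inner ℝ e (L y) = 0) ∧
        ∀ p, Ψ p = L p.1 + p.2 • e := by
  have hfin : Module.finrank ℝ (Space (k + 1)) = k + 1 := by simp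
  have : Fact (Module.finrank ℝ (Space (k + 1)) = k + 1) := ⟨hfin⟩
  have he0 : e ≠ 0 := by rintro rfl; simp at he
  have hk : Module.finrank ℝ (ℝ ∙ e)ᗮ = k := Submodule.finrank_orthogonal_span_singleton he0
  let b := (stdOrthonormalBasis ℝ (ℝ ∙ e)ᗮ).reindex (finCongr hk)
  let L : Space k →ₗᵢ[ℝ] Space (k + 1) := (ℝ ∙ e)ᗮ.subtypeₗᵢ.comp b.repr.symm.toLinearIsometry
  have hL : ∀ y, inner ℝ e (L y) = 0 := fun y =>
    (Submodule.mem_orthogonal_singleton_iff_inner_right).1 (b.repr.symm y).2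
  let T₀ : WithLp 2 (Space k × ℝ) →ₗ[ℝ] Space (k + 1) :=
    { toFun := fun p => L p.fst + p.snd • e
      map_add' := fun p q => by simp [add_smul]; abel
      map_smul' := fun c p => by simp [mul_smul] }
  have hT₀ : ∀ p, ‖T₀ p‖ = ‖p‖ := by
    intro p
    have h1 : ‖L p.fst + p.snd • e‖ ^ 2 = ‖p.fst‖ ^ 2 + ‖p.snd‖ ^ 2 := by
      rw [norm_add_sq_real, inner_smul_right, real_inner_comm, hL, L.norm_map, norm_smul, he]
      simp
    have h2 : ‖p‖ ^ 2 = ‖p.fst‖ ^ 2 + ‖p.snd‖ ^ 2 := WithLp.prod_norm_sq_eq_of_L2 p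
    have : ‖T₀ p‖ ^ 2 = ‖p‖ ^ 2 := h1.trans h2.symm
    exact (sq_eq_sq₀ (norm_nonneg _) (norm_nonneg _)).1 this
  let T : WithLp 2 (Space k × ℝ) →ₗᵢ[ℝ] Space (k + 1) := ⟨T₀, hT₀⟩
  have hdim : Module.finrank ℝ (WithLp 2 (Space k × ℝ)) = Module.finrank ℝ (Space (k + 1)) := by
    rw [(WithLp.linearEquiv 2 ℝ (Space k × ℝ)).finrank_eq]; simp
  let Te := T.toLinearIsometryEquiv hdim
  refine ⟨(MeasurableEquiv.toLp 2 (Space k × ℝ)).trans Te.toMeasurableEquiv, L, ?_, hL, ?_⟩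
  · exact Te.measurePreserving.comp (WithLp.volume_preserving_toLp (Space k) ℝ)
  · intro p; rfl

section Splitting

variable {k : ℕ} {e : Space (k + 1)} {L : Space k →ₗᵢ[ℝ] Space (k + 1)}

theorem norm_sq_split (he : ‖e‖ = 1) (hL : ∀ y, inner ℝ e (L y) = 0) (y : Space k) (t : ℝ) :
    ‖L y + t • e‖ ^ 2 = ‖y‖ ^ 2 + t ^ 2 := by
  rw [norm_add_sq_real, inner_smul_right, real_inner_comm, hL, L.norm_map, norm_smul, he]
  simp

theorem inner_split (he : ‖e‖ = 1) (hL : ∀ y, inner ℝ e (L y) = 0) (y : Space k) (t : ℝ) :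
    inner ℝ e (L y + t • e) = t := by
  rw [inner_add_right, hL, inner_smul_right, real_inner_self_eq_norm_sq, he]; simp

end Splitting

/-- The flat cone of height `r` over `Q`. -/
def flatCone {k : ℕ} (Q : Set (Space k)) (r : ℝ) : Set (Space k × ℝ) :=
  {p | p.2 ∈ Ioo 0 r ∧ p.2⁻¹ • p.1 ∈ Q}

theorem measurableSet_flatCone {k : ℕ} {Q : Set (Space k)} (hQ : MeasurableSet Q) (r : ℝ) :
    MeasurableSet (flatCone Q r) :=
  (measurable_snd measurableSet_Ioo).inter
    ((measurable_snd.inv.smul measurable_fst) hQ)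

theorem volume_flatCone {k : ℕ} {Q : Set (Space k)} (hQ : MeasurableSet Q) {r : ℝ} (hr : 0 ≤ r) :
    (k + 1 : ℝ≥0∞) * (volume.prod volume) (flatCone Q r) = ENNReal.ofReal (r ^ (k + 1)) * volume Q := by
  rw [Measure.prod_apply_symm (measurableSet_flatCone hQ r)]
  have h1 : ∀ t : ℝ, volume ((fun y : Space k => (y, t)) ⁻¹' flatCone Q r)
      = (Ioo 0 r).indicator (fun t => ENNReal.ofReal (t ^ k) * volume Q) t := by
    intro t
    by_cases ht : t ∈ Ioo 0 r
    · rw [indicator_of_mem ht]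
      have : (fun y : Space k => (y, t)) ⁻¹' flatCone Q r = t • Q := by
        ext y
        rw [mem_smul_set_iff_inv_smul_mem₀ ht.1.ne']
        simp only [mem_preimage, flatCone, mem_ofPred_eq]
        exact ⟨fun h => h.2, fun h => ⟨ht, h⟩⟩
      rw [this, Measure.addHaar_smul_of_nonneg _ ht.1.le]; simp
    · rw [indicator_of_notMem ht]
      have : (fun y : Space k => (y, t)) ⁻¹' flatCone Q r = ∅ := by
        ext y
        simp only [mem_preimage, flatCone, mem_ofPred_eq, mem_empty_iff_false, iff_false]
        exact fun h => ht h.1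
      rw [this, measure_empty]
  simp_rw [h1]
  rw [lintegral_indicator measurableSet_Ioo, lintegral_mul_const _ (by fun_prop),
    Measure.restrict_congr_set Ioo_ae_eq_Ioc,
    ← ofReal_integral_eq_lintegral_ofReal (intervalIntegral.intervalIntegrable_pow _).1,
    ← intervalIntegral.integral_of_le hr]
  · rw [← mul_assoc]
    congr 1
    rw [integral_pow, show (k + 1 : ℝ≥0∞) = ENNReal.ofReal (k + 1) by
      rw [ENNReal.ofReal_add (by positivity) zero_le_one]; simp,
      ← ENNReal.ofReal_mul (by positivity)]
    congr 1
    have : (k + 1 : ℝ) ≠ 0 := by positivity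
    field_simp
    simp
  · filter_upwards [ae_restrict_mem measurableSet_Ioc] with y hy
    exact pow_nonneg hy.1.le _

/-! ### The Hausdorff measure of a piece of the unit sphere -/

/-- The surface measure of the unit sphere. -/
noncomputable abbrev sphereMeasure (n : ℕ) : Measure (Dir n) :=
  (volume : Measure (Space n)).toSphere

theorem sphereMeasure_apply {k : ℕ} {A : Set (Dir (k + 1))} (hA : MeasurableSet A) :
    sphereMeasure (k + 1) A
      = (k + 1 : ℝ≥0∞) * volume (Ioo (0 : ℝ) 1 • (Subtype.val '' A : Set (Space (k + 1)))) := by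
  rw [Measure.toSphere_apply' _ hA]; simp

theorem euclideanHausdorffMeasure_image_le {k : ℕ} {E : Type*} [NormedAddCommGroup E]
    [MeasurableSpace E] [BorelSpace E] {f : Space k → E} {Q : Set (Space k)}
    (hf : LipschitzOnWith 1 f Q) : μHE[k] (f '' Q) ≤ volume Q := by
  rw [← EuclideanSpace.euclideanHausdorffMeasure_eq_volume k,
    Measure.euclideanHausdorffMeasure_def, Measure.euclideanHausdorffMeasure_def]
  have := hf.hausdorffMeasure_image_le (d := k) (by positivity)
  simp only [Measure.smul_apply]
  gcongr
  simpa using this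

/-- Follows from |x - y|² = (|x| - |y|)² + |x||y| |x/|x| - y/|y||². It serves both for the gnomonic
projection and for the Lipschitz bound on the tangential field. -/
theorem norm_normalize_sub_normalize_le {E : Type*} [NormedAddCommGroup E] [InnerProductSpace ℝ E]
    {ρ : ℝ} (hρ : 0 < ρ) {x y : E} (hx : ρ ≤ ‖x‖) (hy : ρ ≤ ‖y‖) :
    ‖‖x‖⁻¹ • x - ‖y‖⁻¹ • y‖ ≤ ρ⁻¹ * ‖x - y‖ := by
  have hx0 : 0 < ‖x‖ := hρ.trans_le hx
  have hy0 : 0 < ‖y‖ := hρ.trans_le hy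
  have h1 : ‖‖x‖⁻¹ • x - ‖y‖⁻¹ • y‖ ^ 2 = 2 - 2 * (inner ℝ x y / (‖x‖ * ‖y‖)) := by
    rw [norm_sub_sq_real, norm_smul, norm_smul, inner_smul_left, inner_smul_right]
    simp only [norm_inv, norm_norm, inv_mul_cancel₀ hx0.ne', inv_mul_cancel₀ hy0.ne', conj_trivial]
    field_simp; ring
  have h2 := norm_sub_sq_real x y
  have hxy : ρ * ρ ≤ ‖x‖ * ‖y‖ := mul_le_mul hx hy hρ.le hx0.le
  refine le_of_sq_le_sq ?_ (by positivity)
  rw [h1, mul_pow, h2, inv_pow, ← div_eq_inv_mul, le_div_iff₀ (by positivity)]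
  have h3 : inner ℝ x y ≤ ‖x‖ * ‖y‖ := real_inner_le_norm x y
  have h4 : 0 ≤ 1 - inner ℝ x y / (‖x‖ * ‖y‖) := by
    rw [sub_nonneg, div_le_one (by positivity)]; exact h3
  have h5 : inner ℝ x y = (inner ℝ x y / (‖x‖ * ‖y‖)) * (‖x‖ * ‖y‖) := by
    field_simp
  set q := inner ℝ x y / (‖x‖ * ‖y‖)
  rw [h5]
  nlinarith [sq_nonneg (‖x‖ - ‖y‖), mul_le_mul_of_nonneg_left hxy h4]

/-- An open cap of the unit sphere centred at `e`, described by the gnomonic projection. -/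
def gnomonicCap {n : ℕ} (e : Dir n) (r : ℝ) : Set (Dir n) :=
  {x | 0 < inner ℝ (e : Space n) x ∧
    ‖(x : Space n) - inner ℝ (e : Space n) x • (e : Space n)‖ < r * inner ℝ (e : Space n) x}

theorem isOpen_gnomonicCap {n : ℕ} (e : Dir n) (r : ℝ) : IsOpen (gnomonicCap e r) := by
  exact (isOpen_lt (by fun_prop) (by fun_prop)).and (isOpen_lt (by fun_prop) (by fun_prop))

theorem mem_gnomonicCap_self {n : ℕ} (e : Dir n) {r : ℝ} (hr : 0 < r) : e ∈ gnomonicCap e r := by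
  have : inner ℝ (e : Space n) (e : Space n) = 1 := by
    rw [real_inner_self_eq_norm_sq, norm_eq_of_mem_sphere]; simp
  refine ⟨by rw [this]; exact one_pos, by rw [this]; simpa using hr⟩

theorem measurableSet_image_val {n : ℕ} {A : Set (Dir n)} (hA : MeasurableSet A) :
    MeasurableSet (Subtype.val '' A : Set (Space n)) :=
  (MeasurableEmbedding.subtype_coe
    (Metric.isClosed_sphere (x := (0 : Space n)) (ε := 1)).measurableSet).measurableSet_image.2 hA

/-- Central projection from the tangent plane at `e` to the sphere is 1-Lipschitz, so the Hausdorff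
measure of `A` is at most the area of its gnomonic image `Q`. The flat cone over `Q` of height
1/√(1+r²) fits into the solid cone over `A`, whose volume defines the sphere measure. -/
theorem hausdorff_le_of_subset_gnomonicCap {k : ℕ} {e : Dir (k + 1)} {r : ℝ} {A : Set (Dir (k + 1))}
    (hA : MeasurableSet A) (hAr : A ⊆ gnomonicCap e r) :
    ENNReal.ofReal ((√(1 + r ^ 2))⁻¹ ^ (k + 1)) * μHE[k] (Subtype.val '' A : Set (Space (k + 1)))
      ≤ sphereMeasure (k + 1) A := by
  have he : ‖(e : Space (k + 1))‖ = 1 := norm_eq_of_mem_sphere e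
  obtain ⟨Ψ, L, hΨ, hL, hΨL⟩ := exists_splitting (e : Space (k + 1)) he
  have hsq : ∀ y : Space k, ‖L y + (e : Space (k + 1))‖ ^ 2 = ‖y‖ ^ 2 + 1 := fun y => by
    simpa using norm_sq_split he hL y 1
  have hge : ∀ y : Space k, 1 ≤ ‖L y + (e : Space (k + 1))‖ := fun y => by
    nlinarith [hsq y, sq_nonneg ‖y‖, norm_nonneg (L y + (e : Space (k + 1)))]
  let N : Space k → Space (k + 1) := fun y =>
    ‖L y + (e : Space (k + 1))‖⁻¹ • (L y + (e : Space (k + 1)))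
  have hNc : Continuous N := by
    have hc : Continuous fun y : Space k => L y + (e : Space (k + 1)) :=
      L.continuous.add continuous_const
    exact (hc.norm.inv₀ fun y => (one_pos.trans_le (hge y)).ne').smul hc
  let Q : Set (Space k) := {y | ‖y‖ ≤ r ∧ N y ∈ (Subtype.val '' A : Set (Space (k + 1)))}
  have hQ : MeasurableSet Q :=
    (isClosed_le continuous_norm continuous_const).measurableSet.inter
      (hNc.measurable (measurableSet_image_val hA))
  have hAQ : (Subtype.val '' A : Set (Space (k + 1))) ⊆ N '' Q := by
    rintro _ ⟨x, hx, rfl⟩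
    obtain ⟨⟨z, t⟩, hz⟩ := Ψ.surjective (x : Space (k + 1))
    rw [hΨL] at hz
    simp only at hz
    have ht : inner ℝ (e : Space (k + 1)) (x : Space (k + 1)) = t := by
      rw [← hz]; exact inner_split he hL z t
    obtain ⟨h1, h2⟩ := hAr hx
    rw [ht] at h1 h2
    have hzn : ‖z‖ < r * t := by
      rw [← hz, add_sub_cancel_right, L.norm_map] at h2; exact h2
    have hLe : L (t⁻¹ • z) + (e : Space (k + 1)) = t⁻¹ • (x : Space (k + 1)) := by
      rw [← hz, smul_add, smul_smul, inv_mul_cancel₀ h1.ne', one_smul, map_smul]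
    have hN : N (t⁻¹ • z) = x := by
      simp only [N]
      rw [hLe, norm_smul, norm_eq_of_mem_sphere, smul_smul]
      simp [abs_of_pos h1, h1.ne']
    refine ⟨t⁻¹ • z, ⟨?_, ?_⟩, hN⟩
    · rw [norm_smul, norm_inv, Real.norm_of_nonneg h1.le, ← div_eq_inv_mul, div_le_iff₀ h1]
      exact hzn.le
    · rw [hN]; exact ⟨x, hx, rfl⟩
  have hlip : LipschitzOnWith 1 N Q := by
    refine LipschitzOnWith.of_dist_le_mul fun y _ z _ => ?_
    rw [dist_eq_norm, dist_eq_norm]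
    refine (norm_normalize_sub_normalize_le one_pos (hge y) (hge z)).trans ?_
    rw [add_sub_add_right_eq_sub, ← map_sub, L.norm_map]; simp
  have h1 : μHE[k] (Subtype.val '' A : Set (Space (k + 1))) ≤ volume Q :=
    (measure_mono hAQ).trans (euclideanHausdorffMeasure_image_le hlip)
  have hρ : 0 ≤ (√(1 + r ^ 2))⁻¹ := by positivity
  have hcone : Ψ '' (flatCone Q (√(1 + r ^ 2))⁻¹)
      ⊆ Ioo (0 : ℝ) 1 • (Subtype.val '' A : Set (Space (k + 1))) := by
    rintro _ ⟨⟨z, t⟩, ⟨⟨ht0, ht1⟩, hzr, hzA⟩, rfl⟩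
    simp only at ht0 ht1 hzr hzA
    have hpos : 0 < ‖L (t⁻¹ • z) + (e : Space (k + 1))‖ := one_pos.trans_le (hge _)
    refine mem_smul.2 ⟨t * ‖L (t⁻¹ • z) + (e : Space (k + 1))‖, ⟨by positivity, ?_⟩, _, hzA, ?_⟩
    · have hsr : ‖L (t⁻¹ • z) + (e : Space (k + 1))‖ ≤ √(1 + r ^ 2) := by
        apply Real.le_sqrt_of_sq_le
        rw [hsq]
        nlinarith [norm_nonneg (t⁻¹ • z)]
      have hs0 : 0 < √(1 + r ^ 2) := by positivity
      calc t * ‖L (t⁻¹ • z) + (e : Space (k + 1))‖ ≤ t * √(1 + r ^ 2) := by gcongr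
        _ < (√(1 + r ^ 2))⁻¹ * √(1 + r ^ 2) := by gcongr
        _ = 1 := inv_mul_cancel₀ hs0.ne'
    · simp only [N]
      rw [hΨL, smul_smul, mul_assoc, mul_inv_cancel₀ hpos.ne', mul_one, smul_add, map_smul,
        smul_smul, mul_inv_cancel₀ ht0.ne', one_smul]
  rw [sphereMeasure_apply hA]
  calc ENNReal.ofReal ((√(1 + r ^ 2))⁻¹ ^ (k + 1)) * μHE[k] (Subtype.val '' A : Set (Space (k + 1)))
      ≤ ENNReal.ofReal ((√(1 + r ^ 2))⁻¹ ^ (k + 1)) * volume Q := by gcongr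
    _ = (k + 1 : ℝ≥0∞) * (volume.prod volume) (flatCone Q (√(1 + r ^ 2))⁻¹) :=
        (volume_flatCone hQ hρ).symm
    _ = (k + 1 : ℝ≥0∞) * volume (Ψ '' (flatCone Q (√(1 + r ^ 2))⁻¹)) := by
        rw [← hΨ.measure_preimage_equiv, preimage_image_eq _ Ψ.injective]
    _ ≤ _ := by gcongr

/-- The sphere is cut into countably many pieces of caps of size `r`, on each of which the loss
factor tends to 1 as `r → 0`. Only this inequality is needed, because perimeters and spherical
averages are only bounded from above. -/
theorem hausdorff_image_val_le {k : ℕ} {A : Set (Dir (k + 1))} (hA : MeasurableSet A) :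
    μHE[k] (Subtype.val '' A : Set (Space (k + 1))) ≤ sphereMeasure (k + 1) A := by
  have key : ∀ r : ℝ, 0 < r →
      ENNReal.ofReal ((√(1 + r ^ 2))⁻¹ ^ (k + 1)) * μHE[k] (Subtype.val '' A : Set (Space (k + 1)))
        ≤ sphereMeasure (k + 1) A := by
    intro r hr
    have hne : Nonempty (Dir (k + 1)) := (NormedSpace.sphere_nonempty.2 zero_le_one).to_subtype
    let d : ℕ → Dir (k + 1) := TopologicalSpace.denseSeq _
    let U : ℕ → Set (Dir (k + 1)) := fun j => gnomonicCap (d j) r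
    have hU : ⋃ j, U j = univ := by
      refine eq_univ_of_forall fun x => ?_
      have hopen : IsOpen {e : Dir (k + 1) | x ∈ gnomonicCap e r} := by
        exact (isOpen_lt (by fun_prop) (by fun_prop)).and (isOpen_lt (by fun_prop) (by fun_prop))
      obtain ⟨j, hj⟩ := (TopologicalSpace.denseRange_denseSeq (Dir (k + 1))).exists_mem_open
        hopen ⟨x, mem_gnomonicCap_self x hr⟩
      exact mem_iUnion.2 ⟨j, hj⟩
    let B : ℕ → Set (Dir (k + 1)) := fun j => A ∩ disjointed U j
    have hB : ∀ j, MeasurableSet (B j) := fun j =>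
      hA.inter (MeasurableSet.disjointed (fun i => (isOpen_gnomonicCap _ _).measurableSet) j)
    have hAB : A = ⋃ j, B j := by
      rw [← inter_iUnion, iUnion_disjointed, hU, inter_univ]
    have hdis : Pairwise (Function.onFun Disjoint B) := fun i j hij =>
      (disjoint_disjointed U hij).mono inter_subset_right inter_subset_right
    calc _ ≤ ENNReal.ofReal ((√(1 + r ^ 2))⁻¹ ^ (k + 1))
            * ∑' j, μHE[k] (Subtype.val '' (B j) : Set (Space (k + 1))) := by
          gcongr
          conv_lhs => rw [hAB, image_iUnion]
          exact measure_iUnion_le _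
      _ = ∑' j, ENNReal.ofReal ((√(1 + r ^ 2))⁻¹ ^ (k + 1))
            * μHE[k] (Subtype.val '' (B j) : Set (Space (k + 1))) := ENNReal.tsum_mul_left.symm
      _ ≤ ∑' j, sphereMeasure (k + 1) (B j) := by
          refine ENNReal.tsum_le_tsum fun j => hausdorff_le_of_subset_gnomonicCap (hB j)
            (inter_subset_right.trans (disjointed_subset U j))
      _ = sphereMeasure (k + 1) A := by
          conv_rhs => rw [hAB]
          exact (measure_iUnion hdis hB).symm
  have hlim : Tendsto (fun r : ℝ => ENNReal.ofReal ((√(1 + r ^ 2))⁻¹ ^ (k + 1))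
      * μHE[k] (Subtype.val '' A : Set (Space (k + 1)))) (𝓝[>] 0)
      (𝓝 (1 * μHE[k] (Subtype.val '' A : Set (Space (k + 1))))) := by
    refine ENNReal.Tendsto.mul_const ?_ (Or.inl one_ne_zero)
    have hc : ContinuousAt (fun r : ℝ => ENNReal.ofReal ((√(1 + r ^ 2))⁻¹ ^ (k + 1))) 0 := by
      refine ENNReal.continuous_ofReal.continuousAt.comp (ContinuousAt.pow ?_ _)
      exact ContinuousAt.inv₀ (by fun_prop) (by simp)
    have := hc.tendsto
    simp only [ne_eq, OfNat.ofNat_ne_zero, not_false_eq_true, zero_pow, add_zero, Real.sqrt_one,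
      inv_one, one_pow, ENNReal.ofReal_one] at this
    exact this.mono_left nhdsWithin_le_nhds
  rw [one_mul] at hlim
  exact le_of_tendsto hlim (eventually_nhdsWithin_of_forall key)

theorem hausdorff_restrict_sphere_le {k : ℕ} (a : Space (k + 1)) {s : ℝ} (hs : 0 < s) :
    (μHE[k] : Measure (Space (k + 1))).restrict (Metric.sphere a s) ≤ ENNReal.ofReal (s ^ k) •
      (sphereMeasure (k + 1)).map (fun σ : Dir (k + 1) => a + s • (σ : Space (k + 1))) := by
  have hmeas : Measurable (fun σ : Dir (k + 1) => a + s • (σ : Space (k + 1))) := by fun_prop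
  refine Measure.le_iff.2 fun A hA => ?_
  rw [Measure.restrict_apply hA, Measure.smul_apply, Measure.map_apply hmeas hA]
  set B := (fun σ : Dir (k + 1) => a + s • (σ : Space (k + 1))) ⁻¹' A
  have hsub : A ∩ Metric.sphere a s
      ⊆ (fun x => a + x) '' (s • (Subtype.val '' B : Set (Space (k + 1)))) := by
    rintro x ⟨hxA, hx⟩
    have hσ : ‖s⁻¹ • (x - a)‖ = 1 := by
      rw [norm_smul, norm_inv, Real.norm_of_nonneg hs.le, mem_sphere_iff_norm.1 hx,
        inv_mul_cancel₀ hs.ne']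
    have hx' : a + s • s⁻¹ • (x - a) = x := by
      rw [smul_smul, mul_inv_cancel₀ hs.ne', one_smul]; abel
    refine ⟨s • s⁻¹ • (x - a), smul_mem_smul_set
      ⟨⟨s⁻¹ • (x - a), mem_sphere_zero_iff_norm.2 hσ⟩, ?_, rfl⟩, hx'⟩
    simp only [B, mem_preimage]
    rw [hx']; exact hxA
  calc μHE[k] (A ∩ Metric.sphere a s) ≤ _ := measure_mono hsub
    _ = μHE[k] (s • (Subtype.val '' B : Set (Space (k + 1)))) :=
        (isometry_add_left a).euclideanHausdorffMeasure_image _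
    _ = ENNReal.ofReal (s ^ k) * μHE[k] (Subtype.val '' B : Set (Space (k + 1))) := by
        rw [Measure.euclideanHausdorffMeasure_smul₀ k hs.ne', ENNReal.smul_def, smul_eq_mul,
          ENNReal.ofReal_pow hs.le, ENNReal.coe_pow]
        congr 2
        rw [← enorm_eq_nnnorm, Real.enorm_eq_ofReal hs.le]
    _ ≤ _ := by
        rw [smul_eq_mul]
        gcongr
        exact hausdorff_image_val_le (hmeas hA)

theorem lintegral_sphere_inter_le {k : ℕ} (a : Space (k + 1)) {s : ℝ} (hs : 0 < s)
    {φ : Space (k + 1) → ℝ≥0∞} (hφ : Measurable φ) {B : Set (Space (k + 1))} (hB : MeasurableSet B) :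
    ∫⁻ x in Metric.sphere a s ∩ B, φ x ∂μHE[k] ≤ ENNReal.ofReal (s ^ k) *
      ∫⁻ σ in {σ : Dir (k + 1) | a + s • (σ : Space (k + 1)) ∈ B},
        φ (a + s • (σ : Space (k + 1))) ∂sphereMeasure (k + 1) := by
  have hmeas : Measurable (fun σ : Dir (k + 1) => a + s • (σ : Space (k + 1))) := by fun_prop
  rw [inter_comm, ← Measure.restrict_restrict hB]
  calc _ ≤ ∫⁻ x in B, φ x ∂(ENNReal.ofReal (s ^ k) •
      (sphereMeasure (k + 1)).map (fun σ : Dir (k + 1) => a + s • (σ : Space (k + 1)))) :=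
        lintegral_mono' (Measure.restrict_mono le_rfl (hausdorff_restrict_sphere_le a hs)) le_rfl
    _ = _ := by
        rw [Measure.restrict_smul, lintegral_smul_measure, smul_eq_mul,
          setLIntegral_map hB hφ hmeas]
        rfl

/-- The Hausdorff measure `M` of the unit sphere need not be known to be positive: if it vanishes,
so does the average, and otherwise `M⁻¹` is a finite constant. -/
theorem exists_radialAverage_le (k : ℕ) : ∃ c : ℝ≥0∞, c ≠ ⊤ ∧
    ∀ g : Space (k + 1) → ℝ≥0∞, Measurable g → ∀ t : ℝ, 0 < t →
      radialAverage g t ≤ c * ∫⁻ σ, g (t • (σ : Space (k + 1))) ∂sphereMeasure (k + 1) := by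
  set M : ℝ≥0∞ := μHE[k] (Metric.sphere (0 : Space (k + 1)) 1)
  have hMt : ∀ t : ℝ, 0 < t →
      μHE[k] (Metric.sphere (0 : Space (k + 1)) t) = ENNReal.ofReal (t ^ k) * M := by
    intro t ht
    have : Metric.sphere (0 : Space (k + 1)) t = t • Metric.sphere (0 : Space (k + 1)) 1 := by
      rw [smul_sphere' ht.ne', smul_zero, Real.norm_of_nonneg ht.le, mul_one]
    rw [this, Measure.euclideanHausdorffMeasure_smul₀ k ht.ne', ENNReal.smul_def, smul_eq_mul,
      ENNReal.ofReal_pow ht.le, ENNReal.coe_pow]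
    congr 2
    rw [← enorm_eq_nnnorm, Real.enorm_eq_ofReal ht.le]
  refine ⟨if M = 0 then 0 else M⁻¹, by split_ifs with h <;> simp [h], fun g hg t ht => ?_⟩
  have hrad : radialAverage g t = (μHE[k] (Metric.sphere (0 : Space (k + 1)) t))⁻¹ *
      ∫⁻ x in Metric.sphere (0 : Space (k + 1)) t, g x ∂μHE[k] := by
    rw [radialAverage, abs_of_pos ht, setLAverage_eq, ENNReal.div_eq_inv_mul]
    rfl
  rw [hrad]
  split_ifs with hM
  · have : (μHE[k] : Measure (Space (k + 1))).restrict (Metric.sphere (0 : Space (k + 1)) t) = 0 := by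
      rw [Measure.restrict_eq_zero, hMt t ht, hM, mul_zero]
    simp [this]
  · have h := lintegral_sphere_inter_le (0 : Space (k + 1)) ht hg MeasurableSet.univ
    simp only [inter_univ, mem_univ, ofPred_true, Measure.restrict_univ, zero_add] at h
    have ht0 : ENNReal.ofReal (t ^ k) ≠ 0 := by simpa using pow_pos ht k
    calc _ ≤ (ENNReal.ofReal (t ^ k) * M)⁻¹ * (ENNReal.ofReal (t ^ k) *
          ∫⁻ σ, g (t • (σ : Space (k + 1))) ∂sphereMeasure (k + 1)) := by
          rw [hMt t ht]; gcongr
      _ = M⁻¹ * ∫⁻ σ, g (t • (σ : Space (k + 1))) ∂sphereMeasure (k + 1) := by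
          rw [ENNReal.mul_inv (Or.inl ht0) (Or.inl ENNReal.ofReal_ne_top), mul_comm _ M⁻¹, mul_assoc,
            ← mul_assoc (ENNReal.ofReal (t ^ k))⁻¹, ENNReal.inv_mul_cancel ht0 ENNReal.ofReal_ne_top,
            one_mul]
      _ ≤ _ := le_rfl

/-! ### Slabs of balls and belts of spheres -/

/-- The part of the centred ball of radius `s` at distance less than `τ` from `eᗮ`. -/
def slab {n : ℕ} (e : Space n) (s τ : ℝ) : Set (Space n) :=
  {x | ‖x‖ < s ∧ |inner ℝ e x| < τ}

theorem measure_slab_ne_top {n : ℕ} (e : Space n) (s τ : ℝ) : volume (slab e s τ) ≠ ⊤ :=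
  ((measure_mono fun _ hx => mem_ball_zero_iff.2 hx.1).trans_lt
    (measure_ball_lt_top (x := (0 : Space n)) (r := s))).ne

theorem two_mul_cylinder_le_slab {k : ℕ} {e : Space (k + 1)} (he : ‖e‖ = 1) {τ : ℝ}
    (hτ : 0 < τ) (hτ1 : τ < 1) :
    2 * ENNReal.ofReal τ * volume (Metric.ball (0 : Space k) (√(1 - τ ^ 2))) ≤ volume (slab e 1 τ) := by
  obtain ⟨Ψ, L, hΨ, hL, hΨL⟩ := exists_splitting e he
  have hsub : (Metric.ball (0 : Space k) (√(1 - τ ^ 2))) ×ˢ (Ioo (-τ) τ) ⊆ Ψ ⁻¹' slab e 1 τ := by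
    rintro ⟨y, t⟩ ⟨hy, ht⟩
    simp only [mem_ball_zero_iff] at hy
    simp only [mem_preimage, slab, mem_ofPred_eq, hΨL, inner_split he hL]
    have hta : |t| < τ := abs_lt.2 ht
    refine ⟨?_, hta⟩
    have h1 := norm_sq_split he hL y t
    have h2 : ‖y‖ ^ 2 < 1 - τ ^ 2 := by
      rw [← Real.sq_sqrt (show 0 ≤ 1 - τ ^ 2 by nlinarith)]
      gcongr
    have h3 : t ^ 2 < τ ^ 2 := sq_lt_sq' ht.1 ht.2
    nlinarith [norm_nonneg (L y + t • e)]
  rw [← hΨ.measure_preimage_equiv]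
  refine le_trans (le_of_eq ?_) (measure_mono hsub)
  rw [Measure.prod_prod, Real.volume_Ioo, sub_neg_eq_add, ← two_mul,
    ENNReal.ofReal_mul zero_le_two, ENNReal.ofReal_ofNat, mul_comm]

/-- The set consists of two flat cones with apex 0 and bases the discs of radius √(1-τ²) at heights
±τ. A cone has 1/(k+1) of the volume of the cylinder over its base. -/
theorem slab_sdiff_cone_le {k : ℕ} {e : Space (k + 1)} (he : ‖e‖ = 1) {τ : ℝ}
    (hτ : 0 < τ) (hτ1 : τ < 1) :
    (k + 1 : ℝ≥0∞) * volume {x | x ∈ slab e 1 τ ∧ τ * ‖x‖ ≤ |inner ℝ e x| ∧ x ≠ 0}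
      ≤ 2 * ENNReal.ofReal τ * volume (Metric.ball (0 : Space k) (√(1 - τ ^ 2))) := by
  obtain ⟨Ψ, L, hΨ, hL, hΨL⟩ := exists_splitting e he
  set q := τ⁻¹ * √(1 - τ ^ 2)
  have hnn : 0 ≤ 1 - τ ^ 2 := by nlinarith
  have hq0 : 0 ≤ q := by positivity
  set C := flatCone (Metric.closedBall (0 : Space k) q) τ
  let R : Space k × ℝ → Space k × ℝ := Prod.map id Neg.neg
  have hR : MeasurePreserving R (volume.prod volume) (volume.prod volume) :=
    (MeasurePreserving.id _).prod (Measure.measurePreserving_neg _)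
  have hCm : MeasurableSet C := measurableSet_flatCone Metric.isClosed_closedBall.measurableSet τ
  have hmem : ∀ (y : Space k) (t : ℝ), 0 < t → t < τ → τ * ‖L y + t • e‖ ≤ t → (y, t) ∈ C := by
    intro y t h0 h1 h2
    refine ⟨⟨h0, h1⟩, ?_⟩
    simp only [mem_closedBall_zero_iff]
    have h3 := norm_sq_split he hL y t
    have h4 : τ ^ 2 * (‖y‖ ^ 2 + t ^ 2) ≤ t ^ 2 := by
      rw [← h3, ← mul_pow]; gcongr
    rw [norm_smul, norm_inv, Real.norm_of_nonneg h0.le]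
    rw [inv_mul_le_iff₀ h0]
    refine le_of_sq_le_sq ?_ (by positivity)
    simp only [q]
    rw [mul_pow, mul_pow, Real.sq_sqrt hnn, inv_pow]
    field_simp
    nlinarith
  have hsub : {x | x ∈ slab e 1 τ ∧ τ * ‖x‖ ≤ |inner ℝ e x| ∧ x ≠ 0} ⊆ Ψ '' (C ∪ R ⁻¹' C) := by
    rintro x ⟨⟨-, hx1⟩, hx2, hx3⟩
    obtain ⟨⟨y, t⟩, rfl⟩ := Ψ.surjective x
    refine mem_image_of_mem _ ?_
    rw [hΨL] at hx1 hx2 hx3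
    simp only at hx1 hx2 hx3
    rw [inner_split he hL] at hx1 hx2
    have hpos : 0 < ‖L y + t • e‖ := norm_pos_iff.2 hx3
    rcases lt_trichotomy t 0 with ht | ht | ht
    · right
      rw [abs_of_neg ht] at hx1 hx2
      refine hmem y (-t) (by linarith) hx1 (le_trans (le_of_eq ?_) hx2)
      congr 1
      have h1 := norm_sq_split he hL y t
      have h2 := norm_sq_split he hL y (-t)
      rw [neg_sq, ← h1] at h2
      exact (sq_eq_sq₀ (norm_nonneg _) (norm_nonneg _)).1 h2
    · rw [ht, abs_zero] at hx2
      rw [ht] at hpos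
      exact absurd hx2 (not_le.2 (by positivity))
    · left
      rw [abs_of_pos ht] at hx1 hx2
      exact hmem y t ht hx1 hx2
  have hball : ENNReal.ofReal (τ ^ k) * volume (Metric.closedBall (0 : Space k) q)
      = volume (Metric.ball (0 : Space k) (√(1 - τ ^ 2))) := by
    have hpos : 0 < √(1 - τ ^ 2) := Real.sqrt_pos.2 (by nlinarith)
    rw [Measure.addHaar_closedBall volume _ hq0, Measure.addHaar_ball_of_pos volume _ hpos,
      ← mul_assoc, ← ENNReal.ofReal_mul (by positivity)]
    simp only [finrank_euclideanSpace, Fintype.card_fin]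
    rw [← mul_pow]
    simp only [q]
    rw [← mul_assoc, mul_inv_cancel₀ hτ.ne', one_mul]
  calc (k + 1 : ℝ≥0∞) * volume {x | x ∈ slab e 1 τ ∧ τ * ‖x‖ ≤ |inner ℝ e x| ∧ x ≠ 0}
      ≤ (k + 1 : ℝ≥0∞) * volume (Ψ '' (C ∪ R ⁻¹' C)) := by gcongr
    _ = (k + 1 : ℝ≥0∞) * (volume.prod volume) (C ∪ R ⁻¹' C) := by
        rw [← hΨ.measure_preimage_equiv, preimage_image_eq _ Ψ.injective]
    _ ≤ (k + 1 : ℝ≥0∞) * ((volume.prod volume) C + (volume.prod volume) C) := by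
        gcongr
        refine (measure_union_le _ _).trans ?_
        rw [hR.measure_preimage hCm.nullMeasurableSet]
    _ = 2 * (ENNReal.ofReal (τ ^ (k + 1)) * volume (Metric.closedBall (0 : Space k) q)) := by
        rw [← two_mul, ← volume_flatCone Metric.isClosed_closedBall.measurableSet hτ.le]
        ring
    _ = _ := by
        rw [pow_succ', ENNReal.ofReal_mul hτ.le, mul_assoc, hball, mul_assoc]

/-- The slab is the solid cone over the belt together with a part `W` outside it, up to the origin
and an overlap that does no harm. Since (k+1)|W| is at most the volume of a cylinder inside the
slab, (k+1)|slab| ≤ belt + |slab|. -/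
theorem mul_slab_le_belt {k : ℕ} {e : Space (k + 1)} (he : ‖e‖ = 1) {τ : ℝ} (hτ1 : τ < 1) :
    (k : ℝ≥0∞) * volume (slab e 1 τ)
      ≤ sphereMeasure (k + 1) {σ | |inner ℝ e (σ : Space (k + 1))| < τ} := by
  rcases le_or_gt τ 0 with hτ | hτ
  · have : slab e 1 τ = ∅ := by
      ext x
      simp only [slab, mem_ofPred_eq, mem_empty_iff_false, iff_false, not_and, not_lt]
      exact fun _ => hτ.trans (abs_nonneg _)
    simp [this]
  have hB : MeasurableSet {σ : Dir (k + 1) | |inner ℝ e (σ : Space (k + 1))| < τ} :=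
    (isOpen_lt (by fun_prop) (by fun_prop)).measurableSet
  rw [sphereMeasure_apply hB]
  set K := Ioo (0 : ℝ) 1 • (Subtype.val '' {σ : Dir (k + 1) | |inner ℝ e (σ : Space (k + 1))| < τ}
    : Set (Space (k + 1)))
  set W := {x | x ∈ slab e 1 τ ∧ τ * ‖x‖ ≤ |inner ℝ e x| ∧ x ≠ 0}
  have hsub : slab e 1 τ ⊆ K ∪ W ∪ {0} := by
    intro x hx
    by_cases hx0 : x = 0
    · exact Or.inr hx0
    · left
      by_cases h : τ * ‖x‖ ≤ |inner ℝ e x|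
      · exact Or.inr ⟨hx, h, hx0⟩
      · left
        have hpos : 0 < ‖x‖ := norm_pos_iff.2 hx0
        refine mem_smul.2 ⟨‖x‖, ⟨hpos, hx.1⟩, ‖x‖⁻¹ • x, ⟨⟨‖x‖⁻¹ • x, ?_⟩, ?_, rfl⟩, ?_⟩
        · rw [mem_sphere_zero_iff_norm, norm_smul, norm_inv, norm_norm, inv_mul_cancel₀ hpos.ne']
        · simp only [mem_ofPred_eq, inner_smul_right, abs_mul, abs_inv, abs_norm]
          rw [inv_mul_lt_iff₀ hpos, mul_comm]
          exact not_le.1 h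
        · rw [smul_smul, mul_inv_cancel₀ hpos.ne', one_smul]
  have h1 : volume (slab e 1 τ) ≤ volume K + volume W := by
    refine (measure_mono hsub).trans ((measure_union_le _ _).trans ?_)
    rw [measure_singleton, add_zero]
    exact measure_union_le _ _
  have h2 : (k + 1 : ℝ≥0∞) * volume W ≤ volume (slab e 1 τ) :=
    (slab_sdiff_cone_le he hτ hτ1).trans (two_mul_cylinder_le_slab he hτ hτ1)
  have h3 : (k : ℝ≥0∞) * volume (slab e 1 τ) + volume (slab e 1 τ)
      ≤ (k + 1 : ℝ≥0∞) * volume K + volume (slab e 1 τ) := by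
    calc _ = (k + 1 : ℝ≥0∞) * volume (slab e 1 τ) := by ring
      _ ≤ (k + 1 : ℝ≥0∞) * (volume K + volume W) := by gcongr
      _ = (k + 1 : ℝ≥0∞) * volume K + (k + 1 : ℝ≥0∞) * volume W := mul_add _ _ _
      _ ≤ _ := by gcongr
  exact (ENNReal.add_le_add_iff_right (measure_slab_ne_top e 1 τ)).1 h3

theorem volume_slab_scale {k : ℕ} (e : Space (k + 1)) {s : ℝ} (hs : 0 < s) (τ : ℝ) :
    volume (slab e s (s * τ)) = ENNReal.ofReal (s ^ (k + 1)) * volume (slab e 1 τ) := by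
  have : slab e s (s * τ) = s • slab e 1 τ := by
    ext x
    rw [mem_smul_set_iff_inv_smul_mem₀ hs.ne']
    simp only [slab, mem_ofPred_eq, norm_smul, inner_smul_right, abs_mul, norm_inv, abs_inv,
      Real.norm_eq_abs, abs_of_pos hs]
    rw [inv_mul_lt_iff₀ hs, inv_mul_lt_iff₀ hs, mul_one]
  rw [this, Measure.addHaar_smul_of_nonneg _ hs.le]; simp

/-! ### Lenses: intersections of two balls of equal radius -/

/-- The intersection of two balls of radius `s` whose centres have midpoint `c` and difference
`d • e`. -/
def lens {n : ℕ} (s : ℝ) (c e : Space n) (d : ℝ) : Set (Space n) :=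
  Metric.ball (c - (d / 2) • e) s ∩ Metric.ball (c + (d / 2) • e) s

theorem isOpen_lens {n : ℕ} (s : ℝ) (c e : Space n) (d : ℝ) : IsOpen (lens s c e d) :=
  Metric.isOpen_ball.inter Metric.isOpen_ball

/-- The volume of a lens. -/
noncomputable def lensVolume (k : ℕ) (s d : ℝ) : ℝ≥0∞ :=
  ∫⁻ y : Space k, ENNReal.ofReal (2 * √(s ^ 2 - ‖y‖ ^ 2) - d)

theorem abs_lt_sqrt_sub_iff {p s t δ : ℝ} (hδ : 0 ≤ δ) :
    |t| < √(s ^ 2 - p ^ 2) - δ ↔ p ^ 2 + (|t| + δ) ^ 2 < s ^ 2 := by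
  rw [lt_sub_iff_add_lt, Real.lt_sqrt (by positivity)]
  constructor <;> intro h <;> linarith

theorem volume_lens {k : ℕ} {s : ℝ} (hs : 0 < s) (c : Space (k + 1)) {e : Space (k + 1)}
    (he : ‖e‖ = 1) {d : ℝ} (hd : 0 ≤ d) : volume (lens s c e d) = lensVolume k s d := by
  obtain ⟨Ψ, L, hΨ, hL, hΨL⟩ := exists_splitting e he
  have h0 : volume (lens s c e d) = volume (lens s 0 e d) := by
    have : lens s c e d = (fun x => -c + x) ⁻¹' lens s 0 e d := by
      ext x
      simp only [lens, mem_inter_iff, mem_preimage, Metric.mem_ball, dist_eq_norm]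
      refine and_congr ?_ ?_ <;> (congr! 2; abel)
    rw [this, measure_preimage_add]
  have hX : Ψ ⁻¹' lens s 0 e d
      = {p : Space k × ℝ | |p.2| < √(s ^ 2 - ‖p.1‖ ^ 2) - d / 2} := by
    ext ⟨y, t⟩
    simp only [mem_preimage, lens, mem_inter_iff, mem_ball_iff_norm, hΨL, mem_ofPred_eq]
    rw [abs_lt_sqrt_sub_iff (by positivity)]
    have h1 := norm_sq_split he hL y (t + d / 2)
    have h2 := norm_sq_split he hL y (t - d / 2)
    rw [show L y + t • e - (0 - (d / 2) • e) = L y + (t + d / 2) • e by rw [add_smul]; abel,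
      show L y + t • e - (0 + (d / 2) • e) = L y + (t - d / 2) • e by rw [sub_smul]; abel,
      ← sq_lt_sq₀ (norm_nonneg _) hs.le, h1, ← sq_lt_sq₀ (norm_nonneg _) hs.le, h2]
    rcases le_or_gt 0 t with ht | ht
    · rw [abs_of_nonneg ht]
      exact ⟨fun h => h.1, fun h => ⟨h, by nlinarith⟩⟩
    · rw [abs_of_neg ht]
      exact ⟨fun h => by nlinarith [h.2], fun h => ⟨by nlinarith, by nlinarith⟩⟩
  have hXm : MeasurableSet {p : Space k × ℝ | |p.2| < √(s ^ 2 - ‖p.1‖ ^ 2) - d / 2} :=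
    (isOpen_lt (by fun_prop) (by fun_prop)).measurableSet
  rw [h0, ← hΨ.measure_preimage_equiv, hX, Measure.prod_apply hXm, lensVolume]
  refine lintegral_congr fun y => ?_
  have : Prod.mk y ⁻¹' {p : Space k × ℝ | |p.2| < √(s ^ 2 - ‖p.1‖ ^ 2) - d / 2}
      = Ioo (-(√(s ^ 2 - ‖y‖ ^ 2) - d / 2)) (√(s ^ 2 - ‖y‖ ^ 2) - d / 2) := by
    ext t; simp only [mem_preimage, mem_ofPred_eq, abs_lt, mem_Ioo]
  rw [this, Real.volume_Ioo]
  congr 1; ring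

theorem lens_zero {n : ℕ} (s : ℝ) (c e : Space n) : lens s c e 0 = Metric.ball c s := by
  simp [lens]

/-- On every line parallel to `e` the chord of the ball is at most the chord of the lens plus that
of the slab. -/
theorem volume_ball_le_lens_add_slab {k : ℕ} {s : ℝ} (hs : 0 < s) {e : Space (k + 1)}
    (he : ‖e‖ = 1) (d : ℝ) :
    volume (Metric.ball (0 : Space (k + 1)) s) ≤ lensVolume k s d + volume (slab e s (d / 2)) := by
  obtain ⟨Ψ, L, hΨ, hL, hΨL⟩ := exists_splitting e he
  have hX : Ψ ⁻¹' slab e s (d / 2)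
      = {p : Space k × ℝ | |p.2| < √(s ^ 2 - ‖p.1‖ ^ 2) ∧ |p.2| < d / 2} := by
    ext ⟨y, t⟩
    simp only [mem_preimage, slab, hΨL, mem_ofPred_eq, inner_split he hL]
    refine and_congr_left fun _ => ?_
    have := abs_lt_sqrt_sub_iff (p := ‖y‖) (s := s) (t := t) le_rfl
    rw [sub_zero, add_zero, sq_abs] at this
    rw [this, ← sq_lt_sq₀ (norm_nonneg _) hs.le, norm_sq_split he hL]
  have hXm : MeasurableSet {p : Space k × ℝ | |p.2| < √(s ^ 2 - ‖p.1‖ ^ 2) ∧ |p.2| < d / 2} :=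
    ((isOpen_lt (by fun_prop) (by fun_prop)).and
      (isOpen_lt (by fun_prop) (by fun_prop))).measurableSet
  have hslice : ∀ y : Space k, volume (Prod.mk y ⁻¹'
      {p : Space k × ℝ | |p.2| < √(s ^ 2 - ‖p.1‖ ^ 2) ∧ |p.2| < d / 2})
        = ENNReal.ofReal (2 * min (√(s ^ 2 - ‖y‖ ^ 2)) (d / 2)) := by
    intro y
    have : Prod.mk y ⁻¹' {p : Space k × ℝ | |p.2| < √(s ^ 2 - ‖p.1‖ ^ 2) ∧ |p.2| < d / 2}
      = Ioo (-(min (√(s ^ 2 - ‖y‖ ^ 2)) (d / 2))) (min (√(s ^ 2 - ‖y‖ ^ 2)) (d / 2)) := by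
      ext t
      rw [mem_Ioo, ← abs_lt, lt_min_iff]; rfl
    rw [this, Real.volume_Ioo]
    congr 1; ring
  rw [← lens_zero s 0 e, volume_lens hs 0 he le_rfl, ← hΨ.measure_preimage_equiv, hX,
    Measure.prod_apply hXm, lensVolume, lensVolume, ← lintegral_add_left (by fun_prop)]
  refine lintegral_mono fun y => ?_
  rw [hslice]
  rw [sub_zero]
  rcases le_total (√(s ^ 2 - ‖y‖ ^ 2)) (d / 2) with h | h
  · rw [min_eq_left h]
    exact le_add_self
  · rw [min_eq_right h]
    exact le_trans (ENNReal.ofReal_le_ofReal (by linarith)) ENNReal.ofReal_add_le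

/-- Over the disc of radius s/2 the chord of the ball is longer than `d'`, so no truncation at 0
occurs there and each chord shrinks by exactly d' - d. This is the quantitative strict monotonicity
of the volume in `d`. -/
theorem lensVolume_add_le {k : ℕ} {s d d' : ℝ} (hd0 : 0 ≤ d') (hd' : d' ≤ s) (hdd : d ≤ d') :
    lensVolume k s d' + ENNReal.ofReal (d' - d) * volume (Metric.ball (0 : Space k) (s / 2))
      ≤ lensVolume k s d := by
  rw [lensVolume, lensVolume, ← lintegral_indicator_const Metric.isOpen_ball.measurableSet,
    ← lintegral_add_left (by fun_prop)]
  refine lintegral_mono fun y => ?_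
  by_cases hy : y ∈ Metric.ball (0 : Space k) (s / 2)
  · rw [indicator_of_mem hy]
    have hy' : ‖y‖ < s / 2 := by simpa using hy
    have hq : d' / 2 ≤ √(s ^ 2 - ‖y‖ ^ 2) := by
      apply Real.le_sqrt_of_sq_le
      nlinarith [norm_nonneg y]
    rw [← ENNReal.ofReal_add (by linarith) (by linarith)]
    exact ENNReal.ofReal_le_ofReal (by linarith)
  · rw [indicator_of_notMem hy, add_zero]
    exact ENNReal.ofReal_le_ofReal (by linarith)

/-! ### Finite perimeter -/

theorem volumeReal_ball {k : ℕ} (a : Space (k + 1)) {s : ℝ} (hs : 0 ≤ s) :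
    volume.real (Metric.ball a s) = s ^ (k + 1) * volume.real (Metric.ball (0 : Space (k + 1)) 1) := by
  rw [measureReal_def, measureReal_def, Measure.addHaar_ball volume a hs, ENNReal.toReal_mul,
    ENNReal.toReal_ofReal (by positivity)]
  simp

theorem volumeReal_ball_sdiff_ball_le {k : ℕ} (a b : Space (k + 1)) {s : ℝ} (hs : 0 < s) :
    volume.real (Metric.ball a s \ Metric.ball b s)
      ≤ (k + 1) * volume.real (Metric.ball (0 : Space (k + 1)) 1) * s ^ k * dist a b := by
  set w := dist a b with hw
  set ω := volume.real (Metric.ball (0 : Space (k + 1)) 1)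
  have hω : 0 ≤ ω := measureReal_nonneg
  have hw0 : 0 ≤ w := dist_nonneg
  rcases le_or_gt s w with h | h
  · calc _ ≤ volume.real (Metric.ball a s) := measureReal_mono sdiff_subset measure_ball_lt_top.ne
      _ = s ^ (k + 1) * ω := volumeReal_ball a hs.le
      _ = 1 * ω * s ^ k * s := by ring
      _ ≤ (k + 1) * ω * s ^ k * w := by gcongr; simp
  · have hsub : Metric.ball a (s - w) ⊆ Metric.ball b s :=
      Metric.ball_subset_ball' (by rw [← hw]; linarith)
    calc _ ≤ volume.real (Metric.ball a s \ Metric.ball a (s - w)) :=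
          measureReal_mono (sdiff_subset_sdiff_right hsub)
            ((measure_mono sdiff_subset).trans_lt measure_ball_lt_top).ne
      _ = s ^ (k + 1) * ω - (s - w) ^ (k + 1) * ω := by
          rw [measureReal_sdiff (Metric.ball_subset_ball (by linarith))
            Metric.isOpen_ball.measurableSet measure_ball_lt_top.ne, volumeReal_ball a hs.le,
            volumeReal_ball a (by linarith)]
      _ ≤ (k + 1) * ω * s ^ k * w := by
          have hb := one_add_mul_le_pow (a := -(w / s))
            (by have := (div_lt_one hs).2 h; linarith) (k + 1)
          have h1 : s ^ (k + 1) * (1 + -(w / s)) ^ (k + 1) = (s - w) ^ (k + 1) := by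
            rw [← mul_pow]; congr 1; field_simp; ring
          have h2 : s ^ (k + 1) * (1 + (k + 1 : ℕ) * -(w / s)) = s ^ (k + 1) - (k + 1) * s ^ k * w := by
            push_cast; field_simp; ring
          have h3 := mul_le_mul_of_nonneg_left hb (pow_nonneg hs.le (k + 1))
          rw [h1, h2] at h3
          nlinarith [mul_le_mul_of_nonneg_right h3 hω]

theorem volumeReal_inter_sdiff_inter_le {k : ℕ} (a b a' b' : Space (k + 1)) {s : ℝ} (hs : 0 < s) :
    volume.real ((Metric.ball a s ∩ Metric.ball b s) \ (Metric.ball a' s ∩ Metric.ball b' s))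
      ≤ (k + 1) * volume.real (Metric.ball (0 : Space (k + 1)) 1) * s ^ k
        * (dist a a' + dist b b') := by
  have hsub : (Metric.ball a s ∩ Metric.ball b s) \ (Metric.ball a' s ∩ Metric.ball b' s)
      ⊆ (Metric.ball a s \ Metric.ball a' s) ∪ (Metric.ball b s \ Metric.ball b' s) := by
    rintro x ⟨⟨h1, h2⟩, h3⟩
    by_cases h : x ∈ Metric.ball a' s
    · exact Or.inr ⟨h2, fun h' => h3 ⟨h, h'⟩⟩
    · exact Or.inl ⟨h1, h⟩
  rw [mul_add]
  refine (measureReal_mono hsub ?_).trans ((measureReal_union_le _ _).trans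
    (add_le_add (volumeReal_ball_sdiff_ball_le a a' hs) (volumeReal_ball_sdiff_ball_le b b' hs)))
  exact ((measure_union_le _ _).trans_lt (ENNReal.add_lt_top.2
    ⟨(measure_mono sdiff_subset).trans_lt measure_ball_lt_top,
      (measure_mono sdiff_subset).trans_lt measure_ball_lt_top⟩)).ne

/-- The derivative is a limit of difference quotients, and moving the translation from `ψ` to `E`
leaves the integral of a function bounded by 1 over the symmetric difference of `E` and its
translate. -/
theorem setIntegral_fderiv_le {n : ℕ} {E : Set (Space n)} (hE : MeasurableSet E)
    (hfin : volume E ≠ ⊤) {C : ℝ}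
    (hC : ∀ w, volume.real (E \ (fun x => x + w) ⁻¹' E) ≤ C * ‖w‖)
    {ψ : Space n → ℝ} (hψ : ContDiff ℝ 1 ψ) (hψc : HasCompactSupport ψ) (hψ1 : ∀ x, ‖ψ x‖ ≤ 1)
    (v : Space n) : ∫ x in E, fderiv ℝ ψ x v ≤ 2 * C * ‖v‖ := by
  obtain ⟨K, hK⟩ := ContDiff.lipschitzWith_of_hasCompactSupport hψc hψ one_ne_zero
  have hint : Integrable ψ := hψ.continuous.integrable_of_hasCompactSupport hψc
  have hg : Integrable (E.indicator (fun _ => (1 : ℝ))) :=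
    (integrable_indicator_iff hE).2 (integrableOn_const hfin)
  have hlim := hK.integral_inv_smul_sub_mul_tendsto_integral_lineDeriv_mul hg v
  have hmul : ∀ u : Space n → ℝ, ∫ x, u x * E.indicator (fun _ => (1 : ℝ)) x = ∫ x in E, u x := by
    intro u
    rw [← integral_indicator hE]
    congr 1; ext x
    by_cases hx : x ∈ E <;> simp [hx]
  rw [hmul] at hlim
  simp_rw [hmul] at hlim
  have heq : ∫ x in E, lineDeriv ℝ ψ x v = ∫ x in E, fderiv ℝ ψ x v := by
    congr 1; ext x
    exact ((hψ.differentiable one_ne_zero) x).lineDeriv_eq_fderiv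
  rw [heq] at hlim
  refine le_of_tendsto hlim (eventually_nhdsWithin_of_forall fun t (ht : 0 < t) => ?_)
  set w := -(t • v)
  set E' := (fun x => x + w) ⁻¹' E
  have hE' : MeasurableSet E' := (measurable_add_const w) hE
  have h1 : ∫ x in E, ψ (x + t • v) = ∫ x in E', ψ x := by
    rw [← integral_indicator hE, ← integral_indicator hE',
      ← integral_add_right_eq_self (E'.indicator ψ) (t • v)]
    congr 1; ext x
    have hiff : x + t • v ∈ E' ↔ x ∈ E := by
      change x + t • v + -(t • v) ∈ E ↔ _
      rw [add_neg_cancel_right]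
    by_cases hx : x ∈ E
    · rw [indicator_of_mem hx, indicator_of_mem (hiff.2 hx)]
    · rw [indicator_of_notMem hx, indicator_of_notMem (mt hiff.1 hx)]
  have h2 : (∫ x in E', ψ x) - ∫ x in E, ψ x = (∫ x in E' \ E, ψ x) - ∫ x in E \ E', ψ x := by
    rw [← integral_inter_add_sdiff hE hint.integrableOn (s := E'),
      ← integral_inter_add_sdiff hE' hint.integrableOn (s := E), inter_comm]
    ring
  have hb : ∀ A : Set (Space n), volume A ≠ ⊤ → ‖∫ x in A, ψ x‖ ≤ volume.real A := fun A hA => by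
    simpa using norm_setIntegral_le_of_norm_le_const hA.lt_top (fun x _ => hψ1 x)
  have hE'f : volume E' ≠ ⊤ := by
    rw [show volume E' = volume E from measure_preimage_add_right _ _ _]; exact hfin
  have h3 : volume.real (E \ E') ≤ C * ‖w‖ := hC w
  have h4 : volume.real (E' \ E) ≤ C * ‖w‖ := by
    have : E' \ E = (fun x => x + w) ⁻¹' (E \ (fun x => x + -w) ⁻¹' E) := by
      ext x; simp [E']
    rw [this, measureReal_def, measure_preimage_add_right, ← norm_neg w]
    exact hC (-w)
  have h5 := hb (E \ E') (ne_top_of_le_ne_top hfin (measure_mono sdiff_subset))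
  have h6 := hb (E' \ E) (ne_top_of_le_ne_top hE'f (measure_mono sdiff_subset))
  have hw : ‖w‖ = t * ‖v‖ := by simp [w, norm_smul, abs_of_pos ht]
  rw [hw] at h3 h4
  have hi : Integrable (fun x => ψ (x + t • v)) := hint.comp_add_right _
  simp_rw [smul_eq_mul]
  rw [integral_const_mul, integral_sub hi.integrableOn hint.integrableOn, h1, h2,
    inv_mul_le_iff₀ ht]
  rw [Real.norm_eq_abs] at h5 h6
  nlinarith [le_abs_self (∫ x in E' \ E, ψ x), neg_abs_le (∫ x in E \ E', ψ x)]

theorem contDiff_coord {n : ℕ} {φ : Space n → Space n} (hφ : ContDiff ℝ 1 φ) (i : Fin n) :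
    ContDiff ℝ 1 fun x => φ x i :=
  (EuclideanSpace.proj (𝕜 := ℝ) i).contDiff.comp hφ

theorem fderiv_coord {n : ℕ} {φ : Space n → Space n} (hφ : ContDiff ℝ 1 φ) (i : Fin n)
    (x v : Space n) : fderiv ℝ (fun x => φ x i) x v = (fderiv ℝ φ x v) i := by
  have h := ((EuclideanSpace.proj (𝕜 := ℝ) i).hasFDerivAt (x := φ x)).comp x
    ((hφ.differentiable one_ne_zero) x).hasFDerivAt
  have h' : HasFDerivAt (fun x => φ x i) ((EuclideanSpace.proj (𝕜 := ℝ) i).comp (fderiv ℝ φ x)) x := h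
  rw [h'.fderiv]; rfl

theorem hasFinitePerimeter_of_volume_sdiff_le {n : ℕ} {E : Set (Space n)} (hE : MeasurableSet E)
    (hfin : volume E ≠ ⊤) {C : ℝ}
    (hC : ∀ w, volume.real (E \ (fun x => x + w) ⁻¹' E) ≤ C * ‖w‖) : HasFinitePerimeter E := by
  refine ⟨hE, n * (2 * C), fun φ hφ hφc hφ1 => ?_⟩
  have hcs : ∀ i, HasCompactSupport fun x => φ x i := fun i =>
    hφc.comp_left (g := fun y : Space n => y i) rfl
  have hi : ∀ i, Integrable fun x => (fderiv ℝ φ x (EuclideanSpace.single i 1)) i := by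
    intro i
    simp_rw [← fderiv_coord hφ i]
    refine Continuous.integrable_of_hasCompactSupport ?_ ?_
    · exact ((contDiff_coord hφ i).continuous_fderiv one_ne_zero).clm_apply continuous_const
    · exact (hcs i).fderiv_apply ℝ _
  simp only [divergence]
  rw [integral_finsetSum _ fun i _ => (hi i).integrableOn]
  calc _ ≤ ∑ _i : Fin n, 2 * C := by
        refine Finset.sum_le_sum fun i _ => ?_
        simp_rw [← fderiv_coord hφ i]
        refine (setIntegral_fderiv_le hE hfin hC (contDiff_coord hφ i) (hcs i)
          (fun x => (PiLp.norm_apply_le _ _).trans (hφ1 x)) _).trans (le_of_eq ?_)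
        simp
    _ = _ := by simp

theorem hasFinitePerimeter_inter_ball {k : ℕ} (a b : Space (k + 1)) {s : ℝ} (hs : 0 < s) :
    HasFinitePerimeter (Metric.ball a s ∩ Metric.ball b s) := by
  refine hasFinitePerimeter_of_volume_sdiff_le
    (Metric.isOpen_ball.inter Metric.isOpen_ball).measurableSet
    (ne_top_of_le_ne_top measure_ball_lt_top.ne (measure_mono inter_subset_left))
    (C := (k + 1) * volume.real (Metric.ball (0 : Space (k + 1)) 1) * s ^ k * 2) fun w => ?_
  have : (fun x => x + w) ⁻¹' (Metric.ball a s ∩ Metric.ball b s)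
      = Metric.ball (a - w) s ∩ Metric.ball (b - w) s := by
    ext x
    simp only [mem_preimage, mem_inter_iff, mem_ball_iff_norm]
    rw [sub_sub_eq_add_sub, sub_sub_eq_add_sub]
  rw [this]
  refine (volumeReal_inter_sdiff_inter_le a b _ _ hs).trans (le_of_eq ?_)
  rw [dist_eq_norm, dist_eq_norm, sub_sub_cancel, sub_sub_cancel]
  ring

/-! ### The reduced boundary lies in the topological boundary -/

theorem integral_fderiv_eq_zero_of_hasCompactSupport {n : ℕ} {ψ : Space n → ℝ} (hψ : ContDiff ℝ 1 ψ)
    (hψc : HasCompactSupport ψ) (v : Space n) : ∫ x, fderiv ℝ ψ x v = 0 := by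
  have hint : Integrable ψ := hψ.continuous.integrable_of_hasCompactSupport hψc
  have hint' : Integrable fun x => fderiv ℝ ψ x v :=
    ((hψ.continuous_fderiv one_ne_zero).clm_apply continuous_const).integrable_of_hasCompactSupport
      (hψc.fderiv_apply ℝ v)
  have h := integral_mul_fderiv_eq_neg_fderiv_mul_of_integrable (μ := (volume : Measure (Space n)))
    (f := fun _ => (1 : ℝ)) (g := ψ) (v := v) (by simp) (by simpa using hint')
    (by simpa using hint) (fun _ _ => differentiableAt_const _)
    (fun x _ => (hψ.differentiable one_ne_zero) x)
  simpa using h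

theorem setIntegral_fderiv_eq_zero {n : ℕ} {E U : Set (Space n)}
    (hU : U ⊆ E ∨ U ⊆ Eᶜ) {ψ : Space n → ℝ} (hψ : ContDiff ℝ 1 ψ) (hψc : HasCompactSupport ψ)
    (hψU : tsupport ψ ⊆ U) (v : Space n) : ∫ x in E, fderiv ℝ ψ x v = 0 := by
  have hz : ∀ x, x ∉ U → fderiv ℝ ψ x v = 0 := fun x hx => by
    have : x ∉ tsupport (fderiv ℝ ψ) := fun h => hx (hψU (tsupport_fderiv_subset ℝ h))
    rw [image_eq_zero_of_notMem_tsupport this]; rfl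
  rcases hU with h | h
  · rw [setIntegral_eq_integral_of_forall_compl_eq_zero fun x hx => hz x fun hx' => hx (h hx')]
    exact integral_fderiv_eq_zero_of_hasCompactSupport hψ hψc v
  · exact setIntegral_eq_zero_of_forall_eq_zero fun x hx => hz x fun hx' => h hx' hx

/-- Test fields supported in `U` do not see `E`, because the integral of a derivative with compact
support vanishes. Hence every component of `σ` is zero almost everywhere on `U`, which contradicts
|σ| = 1 unless `μ U = 0`. -/
theorem IsPolarDecomposition.measure_eq_zero {n : ℕ} {E U : Set (Space n)} {μ : Measure (Space n)}
    {σ : Space n → Space n} (hμ : IsPolarDecomposition E μ σ) (hUo : IsOpen U)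
    (hU : U ⊆ E ∨ U ⊆ Eᶜ) : μ U = 0 := by
  obtain ⟨hloc, hσm, hσ1, hpol⟩ := hμ
  have hi : ∀ i, ∀ᵐ x ∂μ, x ∈ U → σ x i = 0 := by
    intro i
    have hli : LocallyIntegrable (fun x => σ x i) μ := by
      refine (locallyIntegrable_const (1 : ℝ)).mono ?_ ?_
      · exact ((EuclideanSpace.proj (𝕜 := ℝ) i).measurable.comp hσm).aestronglyMeasurable
      · filter_upwards [hσ1] with x hx
        simpa [hx] using PiLp.norm_apply_le (σ x) i
    refine hUo.ae_eq_zero_of_integral_contDiff_smul_eq_zero (hli.locallyIntegrableOn _)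
      fun ψ hψ hψc hψU => ?_
    have hψ1 : ContDiff ℝ 1 ψ := hψ.of_le (by exact_mod_cast le_top)
    have hφ : ContDiff ℝ 1 fun x => ψ x • (EuclideanSpace.single i 1 : Space n) :=
      hψ1.smul contDiff_const
    have h := hpol (fun x => ψ x • (EuclideanSpace.single i 1 : Space n)) hφ
      (hψc.smul_right (f' := fun _ => (EuclideanSpace.single i 1 : Space n)))
    have hdiv : ∀ x, divergence (fun x => ψ x • (EuclideanSpace.single i 1 : Space n)) x
        = fderiv ℝ ψ x (EuclideanSpace.single i 1) := by
      intro x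
      simp only [divergence]
      simp_rw [← fderiv_coord hφ]
      rw [Finset.sum_eq_single i]
      · simp
      · intro j _ hj
        simp [hj]
      · simp
    simp_rw [hdiv] at h
    rw [setIntegral_fderiv_eq_zero hU hψ1 hψc hψU] at h
    rw [h]
    congr 1; ext x
    simp [inner_smul_left, EuclideanSpace.inner_single_left]
  have hall : ∀ᵐ x ∂μ, x ∉ U := by
    filter_upwards [hσ1, ae_all_iff.2 hi] with x hx1 hx2 hxU
    have : σ x = 0 := by ext i; exact hx2 i hxU
    rw [this] at hx1; simp at hx1
  simpa [ae_iff] using hall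

theorem reducedBoundary_subset_frontier {n : ℕ} (E : Set (Space n)) :
    reducedBoundary E ⊆ frontier E := by
  rintro x ⟨ν, μ, σ, hμ, hx, -⟩
  by_contra hxf
  rw [← mem_compl_iff, compl_frontier_eq_union_interior] at hxf
  refine Measure.notMem_support_iff_exists.2 ?_ hx
  rcases hxf with h | h
  · exact ⟨_, isOpen_interior.mem_nhds h, hμ.measure_eq_zero isOpen_interior
      (Or.inl interior_subset)⟩
  · exact ⟨_, isOpen_interior.mem_nhds h, hμ.measure_eq_zero isOpen_interior
      (Or.inr interior_subset)⟩

/-- An upper bound suffices throughout, so neither the reduced boundary nor the normal of a lens has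
to be computed. -/
theorem weightedPerimeter_le {n : ℕ} (h : Space n → Dir n → ℝ≥0) (E : Set (Space n)) :
    weightedPerimeter h E ≤ ∫⁻ x in frontier E, hPlus h x ∂μHE[n - 1] :=
  (lintegral_mono (g := fun x => hPlus h x)
    fun x => iSup_mono fun ν => iSup_le fun _ => le_refl (h x ν : ℝ≥0∞)).trans
    (lintegral_mono_set (reducedBoundary_subset_frontier E))

/-! ### The perimeter of a lens -/

/-- The integral of `φ` over the two spherical caps that bound the lens `lens s c e d`. -/
noncomputable def lensBoundaryIntegral {k : ℕ} (s : ℝ) (c e : Space (k + 1)) (d : ℝ)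
    (φ : Space (k + 1) → ℝ≥0∞) : ℝ≥0∞ :=
  ENNReal.ofReal (s ^ k) *
    (∫⁻ σ in {σ : Dir (k + 1) | d / 2 ≤ s * inner ℝ e (σ : Space (k + 1))},
        φ (c - (d / 2) • e + s • (σ : Space (k + 1))) ∂sphereMeasure (k + 1) +
      ∫⁻ σ in {σ : Dir (k + 1) | s * inner ℝ e (σ : Space (k + 1)) < -(d / 2)},
        φ (c + (d / 2) • e + s • (σ : Space (k + 1))) ∂sphereMeasure (k + 1))

theorem measurableSet_upperCap {k : ℕ} (s : ℝ) (e : Space (k + 1)) (d : ℝ) :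
    MeasurableSet {σ : Dir (k + 1) | d / 2 ≤ s * inner ℝ e (σ : Space (k + 1))} :=
  (isClosed_le (by fun_prop) (by fun_prop)).measurableSet

theorem measurableSet_lowerCap {k : ℕ} (s : ℝ) (e : Space (k + 1)) (d : ℝ) :
    MeasurableSet {σ : Dir (k + 1) | s * inner ℝ e (σ : Space (k + 1)) < -(d / 2)} :=
  (isOpen_lt (by fun_prop) (by fun_prop)).measurableSet

theorem norm_sq_sub_norm_sq {n : ℕ} (c x : Space n) {e : Space n} (d : ℝ) :
    ‖x - (c - (d / 2) • e)‖ ^ 2 - ‖x - (c + (d / 2) • e)‖ ^ 2 = 2 * d * inner ℝ e (x - c) := by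
  have h1 := norm_add_sq_real (x - c) ((d / 2) • e)
  have h2 := norm_sub_sq_real (x - c) ((d / 2) • e)
  rw [inner_smul_right, real_inner_comm] at h1 h2
  rw [show x - (c - (d / 2) • e) = (x - c) + (d / 2) • e by abel,
    show x - (c + (d / 2) • e) = (x - c) - (d / 2) • e by abel, h1, h2]
  ring

/-- The sign of ⟨e, x - c⟩ decides which centre is farther from x, and a boundary point lies on the
sphere about the farther one. The edge is assigned to the first cap only, so that the directions
used by the two caps are disjoint even for d = 0. -/
theorem frontier_lens_subset {n : ℕ} (s : ℝ) (c : Space n) {e : Space n} (he : ‖e‖ = 1)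
    {d : ℝ} (hd : 0 ≤ d) : frontier (lens s c e d) ⊆
      (Metric.sphere (c - (d / 2) • e) s ∩ {x | d / 2 ≤ inner ℝ e (x - (c - (d / 2) • e))}) ∪
      (Metric.sphere (c + (d / 2) • e) s ∩ {x | inner ℝ e (x - (c + (d / 2) • e)) < -(d / 2)}) := by
  intro x hx
  rw [(isOpen_lens s c e d).frontier_eq] at hx
  obtain ⟨hxc, hxn⟩ := hx
  have h1 : x ∈ Metric.closedBall (c - (d / 2) • e) s :=
    (Metric.closure_ball_subset_closedBall (closure_mono inter_subset_left hxc))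
  have h2 : x ∈ Metric.closedBall (c + (d / 2) • e) s :=
    (Metric.closure_ball_subset_closedBall (closure_mono inter_subset_right hxc))
  rw [mem_closedBall_iff_norm] at h1 h2
  have hee : inner ℝ e e = (1 : ℝ) := by rw [real_inner_self_eq_norm_sq, he]; simp
  have hdiff := norm_sq_sub_norm_sq c x (e := e) d
  have hn : s ≤ ‖x - (c - (d / 2) • e)‖ ∨ s ≤ ‖x - (c + (d / 2) • e)‖ := by
    by_contra hcon
    push Not at hcon
    exact hxn ⟨mem_ball_iff_norm.2 hcon.1, mem_ball_iff_norm.2 hcon.2⟩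
  rcases le_or_gt 0 (inner ℝ e (x - c)) with h | h
  · left
    have hle : ‖x - (c + (d / 2) • e)‖ ≤ ‖x - (c - (d / 2) • e)‖ := by
      refine le_of_sq_le_sq ?_ (norm_nonneg _)
      have : 0 ≤ 2 * d * inner ℝ e (x - c) := by positivity
      linarith
    refine ⟨mem_sphere_iff_norm.2 (le_antisymm h1 ?_), ?_⟩
    · rcases hn with h' | h'
      · exact h'
      · exact h'.trans hle
    · rw [mem_ofPred_eq, show x - (c - (d / 2) • e) = (x - c) + (d / 2) • e by abel, inner_add_right,
        inner_smul_right, hee]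
      linarith
  · right
    have hle : ‖x - (c - (d / 2) • e)‖ ≤ ‖x - (c + (d / 2) • e)‖ := by
      refine le_of_sq_le_sq ?_ (norm_nonneg _)
      have : 2 * d * inner ℝ e (x - c) ≤ 0 := by
        have := mul_nonneg hd (neg_nonneg.2 h.le)
        linarith
      linarith
    refine ⟨mem_sphere_iff_norm.2 (le_antisymm h2 ?_), ?_⟩
    · rcases hn with h' | h'
      · exact h'.trans hle
      · exact h'
    · rw [mem_ofPred_eq, show x - (c + (d / 2) • e) = (x - c) - (d / 2) • e by abel, inner_sub_right,
        inner_smul_right, hee]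
      linarith

theorem weightedPerimeter_lens_le {k : ℕ} (h : Space (k + 1) → Dir (k + 1) → ℝ≥0)
    (hh : Measurable (hPlus h)) {s : ℝ} (hs : 0 < s) (c : Space (k + 1)) {e : Space (k + 1)}
    (he : ‖e‖ = 1) {d : ℝ} (hd : 0 ≤ d) :
    weightedPerimeter h (lens s c e d) ≤ lensBoundaryIntegral s c e d (hPlus h) := by
  refine (weightedPerimeter_le h _).trans ((lintegral_mono_set
    (frontier_lens_subset s c he hd)).trans ((lintegral_union_le _ _ _).trans ?_))
  rw [lensBoundaryIntegral, mul_add]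
  simp only [Nat.add_sub_cancel]
  refine add_le_add ((lintegral_sphere_inter_le _ hs hh ?_).trans (le_of_eq ?_))
    ((lintegral_sphere_inter_le _ hs hh ?_).trans (le_of_eq ?_))
  · exact (isClosed_le (by fun_prop) (by fun_prop)).measurableSet
  · simp only [mem_ofPred_eq, add_sub_cancel_left, inner_smul_right]
  · exact (isOpen_lt (by fun_prop) (by fun_prop)).measurableSet
  · simp only [mem_ofPred_eq, add_sub_cancel_left, inner_smul_right]

theorem lensBoundaryIntegral_add {k : ℕ} (s : ℝ) (c e : Space (k + 1)) (d : ℝ)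
    {φ ψ : Space (k + 1) → ℝ≥0∞} (hφ : Measurable φ) :
    lensBoundaryIntegral s c e d (fun x => φ x + ψ x)
      = lensBoundaryIntegral s c e d φ + lensBoundaryIntegral s c e d ψ := by
  simp only [lensBoundaryIntegral]
  rw [lintegral_add_left (by fun_prop), lintegral_add_left (by fun_prop)]
  ring

theorem lensBoundaryIntegral_congr {k : ℕ} {s : ℝ} (hs : 0 ≤ s) (c : Space (k + 1))
    {e : Space (k + 1)} (he : ‖e‖ = 1) {d : ℝ} (hd : 0 ≤ d) {φ ψ : Space (k + 1) → ℝ≥0∞}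
    (h : ∀ x, ‖x - c‖ ≤ s + d / 2 → φ x = ψ x) :
    lensBoundaryIntegral s c e d φ = lensBoundaryIntegral s c e d ψ := by
  have hσ : ∀ σ : Dir (k + 1), ‖s • (σ : Space (k + 1))‖ = s := fun σ => by
    rw [norm_smul, norm_eq_of_mem_sphere, mul_one, Real.norm_of_nonneg hs]
  have he' : ‖(d / 2) • e‖ = d / 2 := by
    rw [norm_smul, he, mul_one, Real.norm_of_nonneg (by positivity)]
  simp only [lensBoundaryIntegral]
  congr 3
  · ext σ
    refine h _ ?_
    rw [show c - (d / 2) • e + s • (σ : Space (k + 1)) - c = s • (σ : Space (k + 1)) - (d / 2) • e by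
      abel]
    exact (norm_sub_le _ _).trans (by rw [hσ, he'])
  · ext σ
    refine h _ ?_
    rw [show c + (d / 2) • e + s • (σ : Space (k + 1)) - c = s • (σ : Space (k + 1)) + (d / 2) • e by
      abel]
    exact (norm_add_le _ _).trans (by rw [hσ, he'])

/-- The two caps and the belt of half-width d/2 fit disjointly into one sphere. The belt carries at
least k/s times the volume of the slab, and the slab accounts for the volume lost by the lens. Terms
are added instead of subtracted because the values lie in [0, ∞]. -/
theorem mul_lensBoundaryIntegral_one_add_le {k : ℕ} {s : ℝ} (hs : 0 < s) (c : Space (k + 1))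
    {e : Space (k + 1)} (he : ‖e‖ = 1) {d : ℝ} (hd : 0 ≤ d) (hds : d < 2 * s) :
    ENNReal.ofReal s * lensBoundaryIntegral s c e d (fun _ => 1)
      + k * volume (Metric.ball (0 : Space (k + 1)) s)
        ≤ (k + 1) * volume (Metric.ball (0 : Space (k + 1)) s) + k * lensVolume k s d := by
  set τ := d / 2 / s with hτ
  have hsτ : s * τ = d / 2 := by rw [hτ]; field_simp
  have hτ1 : τ < 1 := by rw [hτ, div_lt_one hs]; linarith
  set A := {σ : Dir (k + 1) | d / 2 ≤ s * inner ℝ e (σ : Space (k + 1))}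
  set A' := {σ : Dir (k + 1) | s * inner ℝ e (σ : Space (k + 1)) < -(d / 2)}
  set Z := {σ : Dir (k + 1) | |inner ℝ e (σ : Space (k + 1))| < τ}
  have hZ : MeasurableSet Z := (isOpen_lt (by fun_prop) (by fun_prop)).measurableSet
  have hA' : MeasurableSet A' := measurableSet_lowerCap s e d
  have hZmem : ∀ σ ∈ Z, -(d / 2) < s * inner ℝ e (σ : Space (k + 1)) ∧
      s * inner ℝ e (σ : Space (k + 1)) < d / 2 := by
    intro σ hσ
    have h1 := abs_lt.1 (show |inner ℝ e (σ : Space (k + 1))| < τ from hσ)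
    rw [← hsτ]
    exact ⟨by nlinarith [h1.1], by nlinarith [h1.2]⟩
  have hsum : sphereMeasure (k + 1) A + sphereMeasure (k + 1) A' + sphereMeasure (k + 1) Z
      ≤ (k + 1) * volume (Metric.ball (0 : Space (k + 1)) 1) := by
    have hd1 : Disjoint A A' := by
      rw [Set.disjoint_left]
      intro σ h1 h2
      have h1' : d / 2 ≤ s * inner ℝ e (σ : Space (k + 1)) := h1
      have h2' : s * inner ℝ e (σ : Space (k + 1)) < -(d / 2) := h2
      linarith
    have hd2 : Disjoint (A ∪ A') Z := by
      rw [Set.disjoint_left]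
      rintro σ (h1 | h1) h2
      · exact absurd (hZmem σ h2).2 (not_lt.2 h1)
      · exact absurd (hZmem σ h2).1 (not_lt.2 (le_of_lt h1))
    rw [← measure_union hd1 hA', ← measure_union hd2 hZ]
    refine (measure_mono (subset_univ _)).trans (le_of_eq ?_)
    rw [Measure.toSphere_apply_univ]
    simp
  have hbelt := mul_slab_le_belt he hτ1
  have hscale := volume_slab_scale e hs τ
  rw [hsτ] at hscale
  have hslab := volume_ball_le_lens_add_slab hs he d
  have hball : volume (Metric.ball (0 : Space (k + 1)) s)
      = ENNReal.ofReal (s ^ (k + 1)) * volume (Metric.ball (0 : Space (k + 1)) 1) := by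
    rw [Measure.addHaar_ball volume _ hs.le]; simp
  have hone : lensBoundaryIntegral s c e d (fun _ => 1)
      = ENNReal.ofReal (s ^ k) * (sphereMeasure (k + 1) A + sphereMeasure (k + 1) A') := by
    simp [lensBoundaryIntegral, A, A']
  have hpow : ENNReal.ofReal (s ^ (k + 1)) = ENNReal.ofReal s * ENNReal.ofReal (s ^ k) := by
    rw [pow_succ', ENNReal.ofReal_mul hs.le]
  calc ENNReal.ofReal s * lensBoundaryIntegral s c e d (fun _ => 1)
      + k * volume (Metric.ball (0 : Space (k + 1)) s)
      ≤ ENNReal.ofReal (s ^ (k + 1)) * (sphereMeasure (k + 1) A + sphereMeasure (k + 1) A')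
        + k * (lensVolume k s d + volume (slab e s (d / 2))) := by
        rw [hone, hpow, mul_assoc]; gcongr
    _ = ENNReal.ofReal (s ^ (k + 1)) * (sphereMeasure (k + 1) A + sphereMeasure (k + 1) A'
        + k * volume (slab e 1 τ)) + k * lensVolume k s d := by
        rw [hscale]; ring
    _ ≤ ENNReal.ofReal (s ^ (k + 1)) * ((k + 1) * volume (Metric.ball (0 : Space (k + 1)) 1))
        + k * lensVolume k s d := by
        gcongr
        exact le_trans (by gcongr) hsum
    _ = _ := by rw [hball]; ring

/-- The excess `g` of the perimeter density costs `s` times its boundary integral, while the excess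
of the volume density lowers the Euclidean volume of the lens by at least C ∫ g, which
`mul_lensBoundaryIntegral_one_add_le` rewards with the factor `k`. -/
theorem mul_weightedPerimeter_lens_lt {k : ℕ} {f : Space (k + 1) → ℝ≥0}
    {h : Space (k + 1) → Dir (k + 1) → ℝ≥0} (hh : Measurable (hPlus h))
    {g : Space (k + 1) → ℝ≥0∞} (hg : Measurable g)
    {C : ℝ≥0∞} {s : ℝ} (hs : 0 < s) (c : Space (k + 1)) {e : Space (k + 1)}
    (he : ‖e‖ = 1) {d : ℝ} (hd : 0 ≤ d) (hds : d < 2 * s)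
    (hhg : ∀ x, ‖x - c‖ ≤ s + d / 2 → hPlus h x = 1 + g x)
    (hfg : ∀ x ∈ lens s c e d, 1 + C * g x ≤ f x)
    (hvol : weightedVolume f (lens s c e d) = volume (Metric.ball (0 : Space (k + 1)) s))
    (hlt : ENNReal.ofReal s * lensBoundaryIntegral s c e d g < k * C * ∫⁻ x in lens s c e d, g x) :
    ENNReal.ofReal s * weightedPerimeter h (lens s c e d)
      < (k + 1) * volume (Metric.ball (0 : Space (k + 1)) s) := by
  set m := volume (Metric.ball (0 : Space (k + 1)) s)
  have hm : m ≠ ⊤ := measure_ball_lt_top.ne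
  have h1 : lensVolume k s d + C * ∫⁻ x in lens s c e d, g x ≤ m := by
    rw [← hvol, ← volume_lens hs c he hd, weightedVolume, ← lintegral_const_mul _ hg,
      ← setLIntegral_one, ← lintegral_add_left measurable_const]
    exact setLIntegral_mono' (isOpen_lens s c e d).measurableSet hfg
  have h2 := mul_lensBoundaryIntegral_one_add_le hs c he hd hds
  have hV : lensVolume k s d ≠ ⊤ := ne_top_of_le_ne_top hm (le_self_add.trans h1)
  have h3 : weightedPerimeter h (lens s c e d)
      ≤ lensBoundaryIntegral s c e d (fun _ => 1) + lensBoundaryIntegral s c e d g := by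
    refine (weightedPerimeter_lens_le h hh hs c he hd).trans (le_of_eq ?_)
    rw [← lensBoundaryIntegral_add s c e d measurable_const]
    exact lensBoundaryIntegral_congr hs.le c he hd hhg
  have hkm : (k : ℝ≥0∞) * m ≠ ⊤ := ENNReal.mul_ne_top (ENNReal.natCast_ne_top k) hm
  refine (ENNReal.add_lt_add_iff_right hkm).1 ?_
  calc ENNReal.ofReal s * weightedPerimeter h (lens s c e d) + k * m
      ≤ ENNReal.ofReal s * (lensBoundaryIntegral s c e d (fun _ => 1)
        + lensBoundaryIntegral s c e d g) + k * m := by gcongr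
    _ = (ENNReal.ofReal s * lensBoundaryIntegral s c e d (fun _ => 1) + k * m)
        + ENNReal.ofReal s * lensBoundaryIntegral s c e d g := by ring
    _ ≤ ((k + 1) * m + k * lensVolume k s d)
        + ENNReal.ofReal s * lensBoundaryIntegral s c e d g := by gcongr
    _ < ((k + 1) * m + k * lensVolume k s d) + k * C * ∫⁻ x in lens s c e d, g x := by
        refine ENNReal.add_lt_add_left ?_ hlt
        refine ENNReal.add_ne_top.2 ⟨ENNReal.mul_ne_top ?_ hm,
          ENNReal.mul_ne_top (ENNReal.natCast_ne_top k) hV⟩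
        exact ENNReal.add_ne_top.2 ⟨ENNReal.natCast_ne_top k, ENNReal.one_ne_top⟩
    _ = (k + 1) * m + k * (lensVolume k s d + C * ∫⁻ x in lens s c e d, g x) := by ring
    _ ≤ (k + 1) * m + k * m := by gcongr

/-! ### Mean density -/

theorem exists_isMeanDensity_lt_one {k : ℕ} {f : Space (k + 1) → ℝ≥0}
    {h : Space (k + 1) → Dir (k + 1) → ℝ≥0} {F : Set (Space (k + 1))} (hF : HasFinitePerimeter F)
    {s : ℝ} (hs : 0 < s) (hvol : weightedVolume f F = volume (Metric.ball (0 : Space (k + 1)) s))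
    (hlt : ENNReal.ofReal s * weightedPerimeter h F
      < (k + 1) * volume (Metric.ball (0 : Space (k + 1)) s)) :
    ∃ ρ : ℝ≥0, IsMeanDensity f h F ρ ∧ ρ < 1 := by
  set ω := volume (Metric.ball (0 : Space (k + 1)) 1) with hω
  have hω0 : ω ≠ 0 := (Metric.measure_ball_pos _ _ one_pos).ne'
  have hωt : ω ≠ ⊤ := measure_ball_lt_top.ne
  set S := ENNReal.ofReal s
  have hS0 : S ≠ 0 := by simpa [S] using hs
  have hSt : S ≠ ⊤ := ENNReal.ofReal_ne_top
  have hball : volume (Metric.ball (0 : Space (k + 1)) s) = S ^ (k + 1) * ω := by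
    rw [Measure.addHaar_ball volume _ hs.le, finrank_euclideanSpace_fin, ENNReal.ofReal_pow hs.le]
  set P := weightedPerimeter h F
  have hn : ((k + 1 : ℕ) : ℝ) ≠ 0 := by positivity
  have hnE : (k + 1 : ℝ≥0∞) ≠ 0 := by positivity
  have hnt : (k + 1 : ℝ≥0∞) ≠ ⊤ := ENNReal.add_ne_top.2 ⟨ENNReal.natCast_ne_top k, ENNReal.one_ne_top⟩
  set D := (k + 1 : ℝ≥0∞) * (S ^ k * ω)
  have hD0 : D ≠ 0 := mul_ne_zero hnE (mul_ne_zero (pow_ne_zero _ hS0) hω0)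
  have hDt : D ≠ ⊤ := ENNReal.mul_ne_top hnt (ENNReal.mul_ne_top (ENNReal.pow_ne_top hSt) hωt)
  have hPD : P < D := by
    rw [hball] at hlt
    have : S * P < S * D := by
      refine hlt.trans_le (le_of_eq ?_)
      simp only [D]; ring
    exact (ENNReal.mul_lt_mul_iff_right hS0 hSt).1 this
  set q := P / D
  have hq1 : q < 1 := (ENNReal.div_lt_iff (Or.inl hD0) (Or.inl hDt)).2 (by simpa using hPD)
  have hqt : q ≠ ⊤ := (hq1.trans ENNReal.one_lt_top).ne
  have hPq : P = D * q := (ENNReal.mul_div_cancel hD0 hDt).symm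
  -- `D` is the Euclidean perimeter of the ball of radius `s`. The density enters the definition
  -- through its n-th root, so it is the n-th power of the perimeter ratio.
  refine ⟨(q ^ (k + 1)).toNNReal, ⟨hF, ?_⟩, ?_⟩
  · rw [hvol, hball, ← hω, ENNReal.coe_toNNReal (ENNReal.pow_ne_top hqt)]
    rw [ENNReal.mul_rpow_of_nonneg _ _ (by positivity), ENNReal.mul_rpow_of_nonneg (S ^ (k + 1)) _ (by
      push_cast; rw [add_sub_cancel_right]; positivity)]
    rw [← ENNReal.rpow_natCast q, ← ENNReal.rpow_mul, mul_one_div_cancel hn, ENNReal.rpow_one,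
      ← ENNReal.rpow_natCast S (k + 1), ← ENNReal.rpow_mul, mul_div_cancel₀ _ hn]
    have h1 : S ^ (((k + 1 : ℕ) : ℝ) - 1) = S ^ k := by
      rw [← ENNReal.rpow_natCast]; congr 1; push_cast; ring
    have h2 : ω ^ (1 / ((k + 1 : ℕ) : ℝ)) * ω ^ ((((k + 1 : ℕ) : ℝ) - 1) / ((k + 1 : ℕ) : ℝ)) = ω := by
      rw [← ENNReal.rpow_add _ _ hω0 hωt]
      conv_rhs => rw [← ENNReal.rpow_one ω]
      congr 1; field_simp; ring
    rw [h1]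
    change P = _
    rw [hPq]
    simp only [D]
    calc _ = (k + 1 : ℝ≥0∞) * (S ^ k * (ω ^ (1 / ((k + 1 : ℕ) : ℝ))
          * ω ^ ((((k + 1 : ℕ) : ℝ) - 1) / ((k + 1 : ℕ) : ℝ)))) * q := by rw [h2]
      _ = _ := by push_cast; ring
  · have : q ^ (k + 1) < 1 := by
      calc q ^ (k + 1) < 1 ^ (k + 1) := ENNReal.pow_lt_pow_left (Nat.succ_ne_zero k) hq1
        _ = 1 := one_pow _
    rw [← ENNReal.coe_lt_coe, ENNReal.coe_toNNReal (ENNReal.pow_ne_top hqt)]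
    exact this

/-! ### Lenses of prescribed weighted volume -/

theorem norm_sub_lt_of_mem_lens {n : ℕ} {s : ℝ} {c e x : Space n} (he : ‖e‖ = 1) {d : ℝ}
    (hd : 0 ≤ d) (hx : x ∈ lens s c e d) : ‖x - c‖ < s + d / 2 := by
  have h := mem_ball_iff_norm.1 hx.1
  calc ‖x - c‖ = ‖(x - (c - (d / 2) • e)) - (d / 2) • e‖ := by congr 1; abel
    _ ≤ ‖x - (c - (d / 2) • e)‖ + ‖(d / 2) • e‖ := norm_sub_le _ _
    _ < s + d / 2 := by
      rw [norm_smul, he, mul_one, Real.norm_of_nonneg (by positivity)]; linarith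

theorem volume_lens_ne_top {n : ℕ} (s : ℝ) (c e : Space n) (d : ℝ) : volume (lens s c e d) ≠ ⊤ :=
  ne_top_of_le_ne_top measure_ball_lt_top.ne (measure_mono inter_subset_left)

theorem weightedVolume_le_of_le {n : ℕ} {f : Space n → ℝ≥0} {A : Set (Space n)}
    (hA : MeasurableSet A) {M : ℝ≥0} (h : ∀ x ∈ A, f x ≤ M) :
    weightedVolume f A ≤ M * volume A := by
  rw [weightedVolume, ← setLIntegral_const]
  exact setLIntegral_mono' hA fun x hx => ENNReal.coe_le_coe.2 (h x hx)

theorem volume_le_weightedVolume {n : ℕ} {f : Space n → ℝ≥0} {A : Set (Space n)}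
    (hA : MeasurableSet A) (h : ∀ x ∈ A, 1 ≤ f x) : volume A ≤ weightedVolume f A := by
  rw [weightedVolume, ← setLIntegral_one]
  exact setLIntegral_mono' hA fun x hx => by exact_mod_cast h x hx

theorem weightedVolume_le_add_sdiff {n : ℕ} (f : Space n → ℝ≥0) (A B : Set (Space n)) :
    weightedVolume f A ≤ weightedVolume f B + weightedVolume f (A \ B) := by
  refine (lintegral_mono_set ?_).trans (lintegral_union_le _ B (A \ B))
  rw [union_sdiff_self]
  exact subset_union_right

theorem dist_center_le {n : ℕ} (c c' e e' : Space n) (d d' : ℝ) :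
    dist (c - (d / 2) • e) (c' - (d' / 2) • e') ≤ ‖c - c'‖ + ‖(d / 2) • e - (d' / 2) • e'‖ ∧
      dist (c + (d / 2) • e) (c' + (d' / 2) • e') ≤ ‖c - c'‖ + ‖(d / 2) • e - (d' / 2) • e'‖ := by
  constructor
  · rw [dist_eq_norm]
    calc _ = ‖(c - c') - ((d / 2) • e - (d' / 2) • e')‖ := by congr 1; abel
      _ ≤ _ := norm_sub_le _ _
  · rw [dist_eq_norm]
    calc _ = ‖(c - c') + ((d / 2) • e - (d' / 2) • e')‖ := by congr 1; abel
      _ ≤ _ := norm_add_le _ _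

theorem norm_half_smul_sub_le {n : ℕ} {e e' : Space n} (he' : ‖e'‖ = 1) {d d' : ℝ} (hd : 0 ≤ d) :
    ‖(d / 2) • e - (d' / 2) • e'‖ ≤ |d - d'| / 2 + d / 2 * ‖e - e'‖ := by
  calc _ = ‖(d / 2) • (e - e') + ((d - d') / 2) • e'‖ := by
        congr 1; rw [smul_sub, sub_div, sub_smul]; abel
    _ ≤ ‖(d / 2) • (e - e')‖ + ‖((d - d') / 2) • e'‖ := norm_add_le _ _
    _ = _ := by
        rw [norm_smul, norm_smul, he', mul_one, Real.norm_of_nonneg (by positivity), Real.norm_eq_abs,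
          abs_div, abs_two]; ring

theorem volumeReal_lens_sdiff_lens_le {k : ℕ} {s : ℝ} (hs : 0 < s) (c c' e e' : Space (k + 1))
    (d d' : ℝ) : volume.real (lens s c e d \ lens s c' e' d')
      ≤ (k + 1) * volume.real (Metric.ball (0 : Space (k + 1)) 1) * s ^ k
        * (2 * (‖c - c'‖ + ‖(d / 2) • e - (d' / 2) • e'‖)) := by
  obtain ⟨h1, h2⟩ := dist_center_le c c' e e' d d'
  refine (volumeReal_inter_sdiff_inter_le _ _ _ _ hs).trans ?_
  gcongr
  linarith

theorem continuousOn_weightedVolume_lens {k : ℕ} {f : Space (k + 1) → ℝ≥0} {s : ℝ} (hs : 0 < s)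
    (c : Space (k + 1)) {e : Space (k + 1)} (he : ‖e‖ = 1) {δ : ℝ} {M : ℝ≥0}
    (hM : ∀ x, ‖x - c‖ < s + δ → f x ≤ M) :
    ContinuousOn (fun d => (weightedVolume f (lens s c e d)).toReal) (Icc 0 δ) := by
  set Kb := (k + 1) * volume.real (Metric.ball (0 : Space (k + 1)) 1) * s ^ k with hKb
  have hKb0 : 0 ≤ Kb := by positivity
  have hle : ∀ d ∈ Icc 0 δ, ∀ x ∈ lens s c e d, f x ≤ M := fun d hd x hx =>
    hM x ((norm_sub_lt_of_mem_lens he hd.1 hx).trans_le (by linarith [hd.1, hd.2]))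
  have hfin : ∀ d ∈ Icc 0 δ, weightedVolume f (lens s c e d) ≠ ⊤ := fun d hd =>
    ne_top_of_le_ne_top (ENNReal.mul_ne_top ENNReal.coe_ne_top (volume_lens_ne_top s c e d))
      (weightedVolume_le_of_le (isOpen_lens s c e d).measurableSet (hle d hd))
  have key : ∀ d ∈ Icc 0 δ, ∀ d' ∈ Icc 0 δ, (weightedVolume f (lens s c e d)).toReal
      ≤ (weightedVolume f (lens s c e d')).toReal + M * Kb * |d - d'| := by
    intro d hd d' hd'
    have h1 := weightedVolume_le_add_sdiff f (lens s c e d) (lens s c e d')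
    have h2 : weightedVolume f (lens s c e d \ lens s c e d')
        ≤ M * volume (lens s c e d \ lens s c e d') :=
      weightedVolume_le_of_le ((isOpen_lens s c e d).measurableSet.diff
        (isOpen_lens s c e d').measurableSet) fun x hx => hle d hd x hx.1
    have h3 : volume (lens s c e d \ lens s c e d') ≠ ⊤ :=
      ne_top_of_le_ne_top (volume_lens_ne_top s c e d) (measure_mono sdiff_subset)
    have h4 := ENNReal.toReal_mono (ENNReal.add_ne_top.2 ⟨hfin d' hd',
      ENNReal.mul_ne_top ENNReal.coe_ne_top h3⟩) (h1.trans (add_le_add_right h2 _))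
    rw [ENNReal.toReal_add (hfin d' hd') (ENNReal.mul_ne_top ENNReal.coe_ne_top h3),
      ENNReal.toReal_mul, ENNReal.coe_toReal] at h4
    have h5 := volumeReal_lens_sdiff_lens_le hs c c e e d d'
    rw [sub_self, norm_zero, zero_add, ← sub_smul, norm_smul, he, mul_one, ← sub_div,
      Real.norm_eq_abs, abs_div, abs_two] at h5
    have h6 := mul_le_mul_of_nonneg_left h5 M.2
    rw [measureReal_def] at h6
    refine h4.trans (add_le_add_right (h6.trans (le_of_eq ?_)) _)
    rw [← hKb]; simp only [NNReal.val_eq_coe]; ring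
  refine LipschitzOnWith.continuousOn (K := M * Kb.toNNReal) ?_
  refine LipschitzOnWith.of_dist_le_mul fun d hd d' hd' => ?_
  have h1 := key d hd d' hd'
  have h2 := key d' hd' d hd
  rw [abs_sub_comm] at h2
  rw [Real.dist_eq, Real.dist_eq, abs_le]
  rw [NNReal.coe_mul, Real.coe_toNNReal _ hKb0]
  constructor <;> linarith

theorem lensVolume_zero {k : ℕ} {s : ℝ} (hs : 0 < s) :
    lensVolume k s 0 = volume (Metric.ball (0 : Space (k + 1)) s) := by
  have he : ‖(EuclideanSpace.single 0 1 : Space (k + 1))‖ = 1 := by simp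
  rw [← volume_lens hs 0 he le_rfl, lens_zero]

/-- Intermediate values: at d = 0 the lens is a ball and f ≥ 1 gives at least the target volume; at
d = δ the loss of Euclidean volume outweighs the gain of at most ε|B|. -/
theorem exists_weightedVolume_lens_eq {k : ℕ} {f : Space (k + 1) → ℝ≥0} {s : ℝ} (hs : 0 < s)
    (c : Space (k + 1)) {e : Space (k + 1)} (he : ‖e‖ = 1) {δ : ℝ} (hδ : 0 ≤ δ) (hδs : δ ≤ s)
    {ε : ℝ≥0} (h1 : ∀ x, ‖x - c‖ < s + δ → 1 ≤ f x) (hε : ∀ x, ‖x - c‖ < s + δ → f x ≤ 1 + ε)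
    (hεδ : ε * volume (Metric.ball (0 : Space (k + 1)) s)
      ≤ ENNReal.ofReal δ * volume (Metric.ball (0 : Space k) (s / 2))) :
    ∃ d ∈ Icc 0 δ, weightedVolume f (lens s c e d) = volume (Metric.ball (0 : Space (k + 1)) s) := by
  set m := volume (Metric.ball (0 : Space (k + 1)) s)
  have hm : m ≠ ⊤ := measure_ball_lt_top.ne
  have hle : ∀ d ∈ Icc 0 δ, ∀ x ∈ lens s c e d, ‖x - c‖ < s + δ := fun d hd x hx =>
    (norm_sub_lt_of_mem_lens he hd.1 hx).trans_le (by linarith [hd.1, hd.2])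
  have hfin : ∀ d ∈ Icc 0 δ, weightedVolume f (lens s c e d) ≠ ⊤ := fun d hd =>
    ne_top_of_le_ne_top (ENNReal.mul_ne_top ENNReal.coe_ne_top (volume_lens_ne_top s c e d))
      (weightedVolume_le_of_le (isOpen_lens s c e d).measurableSet
        fun x hx => hε x (hle d hd x hx))
  have h0 : m ≤ weightedVolume f (lens s c e 0) := by
    rw [show m = volume (lens s c e 0) by rw [volume_lens hs c he le_rfl, lensVolume_zero hs]]
    exact volume_le_weightedVolume (isOpen_lens s c e 0).measurableSet
      fun x hx => h1 x (hle 0 ⟨le_rfl, hδ⟩ x hx)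
  have hV : lensVolume k s δ + ENNReal.ofReal δ * volume (Metric.ball (0 : Space k) (s / 2)) ≤ m := by
    have := lensVolume_add_le (k := k) (d := 0) hδ hδs hδ
    rwa [sub_zero, lensVolume_zero hs] at this
  have h2 : weightedVolume f (lens s c e δ) ≤ m := by
    refine (weightedVolume_le_of_le (isOpen_lens s c e δ).measurableSet
      fun x hx => hε x (hle δ ⟨hδ, le_rfl⟩ x hx)).trans ?_
    rw [volume_lens hs c he hδ]
    push_cast
    rw [add_mul, one_mul]
    refine le_trans (add_le_add_right ?_ _) hV
    refine le_trans ?_ hεδ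
    gcongr
    exact le_self_add.trans hV
  have hcont := continuousOn_weightedVolume_lens hs c he hε
  obtain ⟨d, hd, hdm⟩ := intermediate_value_Icc' hδ hcont (show m.toReal ∈ _ from
    ⟨ENNReal.toReal_mono hm h2, ENNReal.toReal_mono (hfin 0 ⟨le_rfl, hδ⟩) h0⟩)
  exact ⟨d, hd, (ENNReal.toReal_eq_toReal_iff' (hfin d hd) hm).1 hdm⟩

/-- With equal weighted volumes, the Euclidean volume lost by widening from `d` to `d'` must be
compensated by the integral of f - 1, which can only grow on the set difference, where it is at most
`ε`. This turns the smallness of f - 1 into a Lipschitz bound for `d` with no regularity of `f`. -/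
theorem mul_sub_le_of_weightedVolume_lens_eq {k : ℕ} {f : Space (k + 1) → ℝ≥0}
    {s : ℝ} (hs : 0 < s) {c c' e e' : Space (k + 1)} (he : ‖e‖ = 1) (he' : ‖e'‖ = 1)
    {d d' : ℝ} (hd : 0 ≤ d) (hdd : d ≤ d') (hd's : d' ≤ s) {ε : ℝ≥0}
    (h1 : ∀ x ∈ lens s c e d, 1 ≤ f x) (h1' : ∀ x ∈ lens s c' e' d', 1 ≤ f x)
    (hε : ∀ x ∈ lens s c' e' d', f x ≤ 1 + ε)
    (hvol : weightedVolume f (lens s c e d) = volume (Metric.ball (0 : Space (k + 1)) s))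
    (hvol' : weightedVolume f (lens s c' e' d') = volume (Metric.ball (0 : Space (k + 1)) s)) :
    (d' - d) * volume.real (Metric.ball (0 : Space k) (s / 2))
      ≤ ε * volume.real (lens s c' e' d' \ lens s c e d) := by
  set m := volume (Metric.ball (0 : Space (k + 1)) s)
  have hm : m ≠ ⊤ := measure_ball_lt_top.ne
  set F := lens s c e d
  set F' := lens s c' e' d'
  have hFm : MeasurableSet F := (isOpen_lens s c e d).measurableSet
  have hFm' : MeasurableSet F' := (isOpen_lens s c' e' d').measurableSet
  have hsplit : ∀ A : Set (Space (k + 1)), MeasurableSet A → (∀ x ∈ A, 1 ≤ f x) →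
      weightedVolume f A = volume A + weightedVolume (fun x => f x - 1) A := by
    intro A hA h
    rw [weightedVolume, weightedVolume, ← setLIntegral_one, ← lintegral_add_left measurable_const]
    refine setLIntegral_congr_fun hA fun x hx => ?_
    have := h x hx
    rw [← ENNReal.coe_one, ← ENNReal.coe_add, add_tsub_cancel_of_le this]
  set Φ := weightedVolume (fun x => f x - 1) F
  set Φ' := weightedVolume (fun x => f x - 1) F'
  have e1 : lensVolume k s d + Φ = m := by
    rw [← hvol, hsplit F hFm h1, volume_lens hs c he hd]
  have e2 : lensVolume k s d' + Φ' = m := by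
    rw [← hvol', hsplit F' hFm' h1', volume_lens hs c' he' (hd.trans hdd)]
  have e3 : Φ' ≤ Φ + ε * volume (F' \ F) := by
    refine (weightedVolume_le_add_sdiff _ F' F).trans (add_le_add_right ?_ _)
    refine weightedVolume_le_of_le (hFm'.diff hFm) fun x hx => ?_
    rw [tsub_le_iff_left]
    exact hε x hx.1
  have e4 := lensVolume_add_le (k := k) (hd.trans hdd) hd's hdd
  have hV' : lensVolume k s d' ≠ ⊤ := ne_top_of_le_ne_top hm (le_self_add.trans e2.le)
  have hΦ : Φ ≠ ⊤ := ne_top_of_le_ne_top hm (le_add_self.trans e1.le)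
  have e5 : ENNReal.ofReal (d' - d) * volume (Metric.ball (0 : Space k) (s / 2))
      ≤ ε * volume (F' \ F) := by
    have : (lensVolume k s d' + Φ) + ENNReal.ofReal (d' - d) * volume (Metric.ball (0 : Space k) (s / 2))
        ≤ (lensVolume k s d' + Φ) + ε * volume (F' \ F) := by
      calc _ = (lensVolume k s d' + ENNReal.ofReal (d' - d)
            * volume (Metric.ball (0 : Space k) (s / 2))) + Φ := by ring
        _ ≤ lensVolume k s d + Φ := by gcongr
        _ = lensVolume k s d' + Φ' := by rw [e1, e2]
        _ ≤ lensVolume k s d' + (Φ + ε * volume (F' \ F)) := by gcongr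
        _ = _ := by ring
    exact (ENNReal.add_le_add_iff_left (ENNReal.add_ne_top.2 ⟨hV', hΦ⟩)).1 this
  have hfin : volume (F' \ F) ≠ ⊤ :=
    ne_top_of_le_ne_top (volume_lens_ne_top s c' e' d') (measure_mono sdiff_subset)
  have := ENNReal.toReal_mono (ENNReal.mul_ne_top ENNReal.coe_ne_top hfin) e5
  rwa [ENNReal.toReal_mul, ENNReal.toReal_mul, ENNReal.toReal_ofReal (by linarith),
    ENNReal.coe_toReal] at this

/-- The closeness `ε` of `f` to 1 is fixed before `f`, the domain and the field. The last conclusion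
also controls how `d` varies with the centre, so that c ↦ c ± (d/2) u(c) is a small Lipschitz
perturbation of the identity. -/
theorem exists_lens_field (k : ℕ) {s η : ℝ} (hs : 0 < s) (hη : 0 < η) (hη1 : η ≤ 1 / 2)
    (hηs : η ≤ s) : ∃ ε : ℝ≥0, 0 < ε ∧
    ∀ (f : Space (k + 1) → ℝ≥0) (R : ℝ) (D : Set (Space (k + 1)))
      (u : Space (k + 1) → Space (k + 1)), Measurable f → (∀ x, R < ‖x‖ → 1 ≤ f x) →
      (∀ x, R < ‖x‖ → f x ≤ 1 + ε) → (∀ c ∈ D, R + s + 1 ≤ ‖c‖) → (∀ c ∈ D, ‖u c‖ = 1) →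
      (∀ c ∈ D, ∀ c' ∈ D, ‖u c - u c'‖ ≤ ‖c - c'‖) →
      ∃ d : Space (k + 1) → ℝ,
        (∀ c ∈ D, d c ∈ Icc 0 η ∧
          weightedVolume f (lens s c (u c) (d c)) = volume (Metric.ball (0 : Space (k + 1)) s)) ∧
        ∀ c ∈ D, ∀ c' ∈ D, ‖(d c / 2) • u c - (d c' / 2) • u c'‖ ≤ 2 * η * ‖c - c'‖ := by
  set κ := volume.real (Metric.ball (0 : Space k) (s / 2))
  have hκ : 0 < κ := ENNReal.toReal_pos (Metric.measure_ball_pos _ _ (by positivity)).ne'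
    measure_ball_lt_top.ne
  set Kb := (k + 1) * volume.real (Metric.ball (0 : Space (k + 1)) 1) * s ^ k with hKb
  have hω1 : 0 < volume.real (Metric.ball (0 : Space (k + 1)) 1) :=
    ENNReal.toReal_pos (Metric.measure_ball_pos _ _ one_pos).ne' measure_ball_lt_top.ne
  have hKb0 : 0 < Kb := by positivity
  set m := volume.real (Metric.ball (0 : Space (k + 1)) s)
  have hm : 0 < m := ENNReal.toReal_pos (Metric.measure_ball_pos _ _ hs).ne' measure_ball_lt_top.ne
  -- The first bound lets a distance in [0, η] reach the prescribed volume; the second makes that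
  -- distance vary slowly.
  obtain ⟨ε, hε0, hε1, hε2⟩ : ∃ ε : ℝ, 0 < ε ∧ ε * m ≤ η * κ ∧ 2 * (ε * Kb) ≤ η * κ := by
    refine ⟨min (η * κ / m) (η * κ / (2 * Kb)), by positivity, ?_, ?_⟩
    · rw [← le_div_iff₀ hm]; exact min_le_left _ _
    · have := (le_div_iff₀ (by positivity)).1 (min_le_right (η * κ / m) (η * κ / (2 * Kb)))
      linarith
  lift ε to ℝ≥0 using hε0.le
  refine ⟨ε, by exact_mod_cast hε0, fun f R D u hf h1 hfε hDR hu hul => ?_⟩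
  have hfar : ∀ c ∈ D, ∀ x, ‖x - c‖ < s + η → R < ‖x‖ := by
    intro c hc x hx
    have := norm_sub_norm_le c x
    rw [norm_sub_rev] at this
    linarith [hDR c hc]
  have hex : ∀ c, ∃ d, c ∈ D → d ∈ Icc 0 η ∧
      weightedVolume f (lens s c (u c) d) = volume (Metric.ball (0 : Space (k + 1)) s) := by
    intro c
    by_cases hc : c ∈ D
    · obtain ⟨d, hd, hd'⟩ := exists_weightedVolume_lens_eq (f := f) (ε := ε) hs c (hu c hc)
        hη.le hηs (fun x hx => h1 x (hfar c hc x hx)) (fun x hx => hfε x (hfar c hc x hx)) (by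
          rw [← ENNReal.toReal_le_toReal (ENNReal.mul_ne_top ENNReal.coe_ne_top
            measure_ball_lt_top.ne) (ENNReal.mul_ne_top ENNReal.ofReal_ne_top
            measure_ball_lt_top.ne), ENNReal.toReal_mul, ENNReal.toReal_mul,
            ENNReal.toReal_ofReal hη.le, ENNReal.coe_toReal]
          exact hε1)
      exact ⟨d, fun _ => ⟨hd, hd'⟩⟩
    · exact ⟨0, fun h => absurd h hc⟩
  choose d hd using hex
  refine ⟨d, hd, ?_⟩
  have key : ∀ c ∈ D, ∀ c' ∈ D, d c ≤ d c' →
      ‖(d c / 2) • u c - (d c' / 2) • u c'‖ ≤ 2 * η * ‖c - c'‖ := by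
    intro c hc c' hc' hcc
    obtain ⟨hdc, hvc⟩ := hd c hc
    obtain ⟨hdc', hvc'⟩ := hd c' hc'
    have hlens : ∀ c ∈ D, ∀ x ∈ lens s c (u c) (d c), R < ‖x‖ := fun c hc x hx =>
      hfar c hc x ((norm_sub_lt_of_mem_lens (hu c hc) (hd c hc).1.1 hx).trans_le
        (by linarith [(hd c hc).1.1, (hd c hc).1.2]))
    have h2 := mul_sub_le_of_weightedVolume_lens_eq (ε := ε) hs (hu c hc) (hu c' hc')
      hdc.1 hcc (hdc'.2.trans hηs) (fun x hx => h1 x (hlens c hc x hx))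
      (fun x hx => h1 x (hlens c' hc' x hx)) (fun x hx => hfε x (hlens c' hc' x hx)) hvc hvc'
    have h3 := volumeReal_lens_sdiff_lens_le hs c' c (u c') (u c) (d c') (d c)
    rw [← hKb, norm_sub_rev c' c, norm_sub_rev ((d c' / 2) • u c')] at h3
    have h4 := norm_half_smul_sub_le (e := u c) (hu c' hc') (d' := d c') hdc.1
    have h5 := hul c hc c' hc'
    set N := ‖c - c'‖
    set p := ‖(d c / 2) • u c - (d c' / 2) • u c'‖
    have hN : 0 ≤ N := norm_nonneg _
    rw [abs_sub_comm, abs_of_nonneg (by linarith : 0 ≤ d c' - d c)] at h4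
    set t := d c' - d c
    have ht : 0 ≤ t := by simp only [t]; linarith
    have h6 : d c / 2 * ‖u c - u c'‖ ≤ η / 2 * N :=
      mul_le_mul (by linarith [hdc.2]) h5 (norm_nonneg _) (by positivity)
    have h7 : p ≤ t / 2 + η / 2 * N := h4.trans (by linarith)
    have h8 : t * κ ≤ (η * (N + p)) * κ := by
      calc t * κ ≤ ε * volume.real (lens s c' (u c') (d c') \ lens s c (u c) (d c)) := h2
        _ ≤ ε * (Kb * (2 * (N + p))) := by gcongr
        _ = 2 * (ε * Kb) * (N + p) := by ring
        _ ≤ η * κ * (N + p) := by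
            have : 0 ≤ N + p := add_nonneg hN (norm_nonneg _)
            gcongr
        _ = _ := by ring
    have h9 : t ≤ η * (N + p) := le_of_mul_le_mul_right h8 hκ
    -- The bounds p ≤ (t + ηN)/2 and t ≤ η(N + p) are coupled; eliminating t leaves p(1 - η/2) ≤ ηN,
    -- and η ≤ 1/2.
    nlinarith [norm_nonneg ((d c / 2) • u c - (d c' / 2) • u c')]
  intro c hc c' hc'
  rcases le_total (d c) (d c') with h | h
  · exact key c hc c' hc' h
  · rw [norm_sub_rev, norm_sub_rev c c']
    exact key c' hc' c hc h

/-! ### Averaging over the positions of a lens -/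

/-- A change of variables without a Jacobian: an expanding bound for `T` controls the Hausdorff
measure of preimages, and Lebesgue measure is the n-dimensional Hausdorff measure. -/
theorem setLIntegral_comp_le_of_antilipschitz {n : ℕ} {D : Set (Space n)} {T : Space n → Space n}
    (hT : Measurable T) {q : ℝ≥0} (hq : ∀ c ∈ D, ∀ c' ∈ D, dist c c' ≤ q * dist (T c) (T c'))
    {φ : Space n → ℝ≥0∞} (hφ : Measurable φ) :
    ∫⁻ c in D, φ (T c) ≤ (q : ℝ≥0∞) ^ n * ∫⁻ x, φ x := by
  have hle : (volume.restrict D).map T ≤ ((q : ℝ≥0∞) ^ n) • (volume : Measure (Space n)) := by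
    refine Measure.le_iff.2 fun A hA => ?_
    rw [Measure.map_apply hT hA, Measure.restrict_apply (hT hA), Measure.smul_apply, smul_eq_mul]
    have hanti : AntilipschitzWith q (fun c : D => T c) :=
      AntilipschitzWith.of_le_mul_dist fun c c' => hq c c.2 c' c'.2
    have h1 := hanti.hausdorffMeasure_preimage_le (d := n) (by positivity) A
    have h2 : T ⁻¹' A ∩ D = Subtype.val '' ((fun c : D => T c) ⁻¹' A) := by
      ext c
      constructor
      · rintro ⟨h, h'⟩
        exact ⟨⟨c, h'⟩, h, rfl⟩
      · rintro ⟨c, h, rfl⟩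
        exact ⟨h, c.2⟩
    rw [← EuclideanSpace.euclideanHausdorffMeasure_eq_volume n, h2,
      isometry_subtype_coe.euclideanHausdorffMeasure_image, Measure.euclideanHausdorffMeasure_def,
      Measure.euclideanHausdorffMeasure_def, Measure.smul_apply, Measure.smul_apply,
      ENNReal.smul_def, ENNReal.smul_def, smul_eq_mul, smul_eq_mul, mul_left_comm]
    gcongr
    simpa using h1
  rw [← lintegral_map hφ hT]
  refine (lintegral_mono' hle le_rfl).trans (le_of_eq ?_)
  rw [lintegral_smul_measure, smul_eq_mul]

section Averaging

variable {k : ℕ} {J : Space (k + 1) →L[ℝ] Space (k + 1)} {K s θ : ℝ} {W g : Space (k + 1) → ℝ≥0∞}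
  {u : Space (k + 1) → Space (k + 1)} {d : Space (k + 1) → ℝ}

theorem isOpen_lt_norm_apply (J : Space (k + 1) →L[ℝ] Space (k + 1)) (K : ℝ) :
    IsOpen {c | K < ‖J c‖} :=
  isOpen_lt (by fun_prop) (by fun_prop)

theorem norm_apply_sub_le (hJ : ∀ x, ‖J x‖ ≤ ‖x‖) (x y : Space (k + 1)) :
    ‖J x‖ ≤ ‖J (x + y)‖ + ‖y‖ := by
  calc ‖J x‖ = ‖J (x + y) - J y‖ := by rw [map_add, add_sub_cancel_right]
    _ ≤ ‖J (x + y)‖ + ‖J y‖ := norm_sub_le _ _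
    _ ≤ _ := by gcongr; exact hJ y

theorem ball_subset_lens {n : ℕ} {s η : ℝ} (c : Space n) {e : Space n} (he : ‖e‖ = 1) {d : ℝ}
    (hd : d ∈ Icc 0 η) : Metric.ball c (s - η) ⊆ lens s c e d := by
  have hn : ‖(d / 2) • e‖ ≤ η := by
    rw [norm_smul, he, mul_one, Real.norm_of_nonneg (by linarith [hd.1])]
    linarith [hd.1, hd.2]
  refine subset_inter (Metric.ball_subset_ball' ?_) (Metric.ball_subset_ball' ?_)
  · rw [dist_eq_norm, sub_sub_cancel]; linarith
  · rw [dist_eq_norm, sub_add_cancel_left, norm_neg]; linarith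

/-- Each lens contains the ball of radius s - η about its midpoint, so Fubini and translation
invariance apply as for balls. Moving the weight from the midpoint to the point where `g` is
evaluated costs `θ`. -/
theorem mul_lintegral_le_lintegral_lens (hJ : ∀ x, ‖J x‖ ≤ ‖x‖) (hg : Measurable g)
    (hWm : Measurable W) {η : ℝ} (hη : 0 ≤ η)
    (hW : ∀ x y, K - 1 - s ≤ ‖y‖ → ‖x - y‖ ≤ 1 + s → W y ≤ ENNReal.ofReal θ * W x)
    (hs : 0 < s) (hu1 : ∀ c, K < ‖J c‖ → ‖u c‖ = 1) (hd : ∀ c, K < ‖J c‖ → d c ∈ Icc 0 η) :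
    volume (Metric.ball (0 : Space (k + 1)) (s - η)) * ∫⁻ z in {z | K + s < ‖J z‖}, W z * g z
      ≤ ENNReal.ofReal θ *
        ∫⁻ c in {c | K < ‖J c‖}, W c * ∫⁻ x in lens s c (u c) (d c), g x := by
  set B := Metric.ball (0 : Space (k + 1)) (s - η)
  set D := {c : Space (k + 1) | K < ‖J c‖}
  have hDm : MeasurableSet D := (isOpen_lt_norm_apply J K).measurableSet
  have hDm' : MeasurableSet {z : Space (k + 1) | K + s < ‖J z‖} :=
    (isOpen_lt_norm_apply J _).measurableSet
  have h1 : ∀ c ∈ D, ∫⁻ y in B, g (c + y) ≤ ∫⁻ x in lens s c (u c) (d c), g x := by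
    intro c hc
    have : ∫⁻ y in B, g (c + y) = ∫⁻ x in Metric.ball c (s - η), g x := by
      rw [← (measurePreserving_add_left volume c).setLIntegral_comp_preimage
        Metric.isOpen_ball.measurableSet hg]
      congr 2
      ext y
      simp [B]
    rw [this]
    exact lintegral_mono_set (ball_subset_lens c (hu1 c hc) (hd c hc))
  have h2 : ∀ y ∈ B, ∫⁻ z in {z | K + s < ‖J z‖}, W z * g z
      ≤ ENNReal.ofReal θ * ∫⁻ c in D, W c * g (c + y) := by
    intro y hy
    have hy' : ‖y‖ < s - η := mem_ball_zero_iff.1 hy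
    rw [← lintegral_const_mul _ (by fun_prop), ← lintegral_indicator hDm', ← lintegral_indicator hDm,
      ← lintegral_add_right_eq_self _ y]
    refine lintegral_mono fun c => ?_
    by_cases hc : K + s < ‖J (c + y)‖
    · have hcD : K < ‖J c‖ := by
        have := norm_apply_sub_le hJ (c + y) (-y)
        rw [add_neg_cancel_right, norm_neg] at this
        linarith
      rw [indicator_of_mem (show c + y ∈ {z : Space (k + 1) | K + s < ‖J z‖} from hc),
        indicator_of_mem (show c ∈ D from hcD), ← mul_assoc]
      gcongr
      refine hW _ _ ?_ ?_
      · linarith [hJ (c + y)]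
      · rw [sub_add_cancel_left, norm_neg]; linarith
    · rw [indicator_of_notMem (show c + y ∉ {z : Space (k + 1) | K + s < ‖J z‖} from hc)]
      exact zero_le
  calc _ = ∫⁻ _y in B, ∫⁻ z in {z | K + s < ‖J z‖}, W z * g z := by
        rw [setLIntegral_const, mul_comm]
    _ ≤ ∫⁻ y in B, ENNReal.ofReal θ * ∫⁻ c in D, W c * g (c + y) :=
        setLIntegral_mono' Metric.isOpen_ball.measurableSet h2
    _ = ENNReal.ofReal θ * ∫⁻ c in D, ∫⁻ y in B, W c * g (c + y) := by
        rw [lintegral_const_mul' _ _ ENNReal.ofReal_ne_top, lintegral_lintegral_swap]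
        exact Measurable.aemeasurable (by fun_prop)
    _ ≤ _ := by
        refine mul_le_mul_right (setLIntegral_mono' hDm fun c hc => ?_) _
        rw [lintegral_const_mul _ (by fun_prop)]
        exact mul_le_mul_right (h1 c hc) _

/-- For a fixed direction `σ` the boundary point is a translate of one of the two centres, and
midpoint ↦ centre nearly preserves volume. What prevents a factor 2 is that each direction, at each
position of a centre, is used by only one of the two caps. The weight is moved twice, from midpoint
to centre and from centre to boundary point. -/
theorem lintegral_lensBoundaryIntegral_le (hJ : ∀ x, ‖J x‖ ≤ ‖x‖) (hg : Measurable g)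
    (hWm : Measurable W) (hum : Measurable u) {η : ℝ} {q : ℝ≥0} (hη1 : η ≤ 1)
    (hq : 1 ≤ q * (1 - 2 * η))
    (hW : ∀ x y, K - 1 - s ≤ ‖y‖ → ‖x - y‖ ≤ 1 + s → W y ≤ ENNReal.ofReal θ * W x)
    (hs : 0 < s) (hu1 : ∀ c, K < ‖J c‖ → ‖u c‖ = 1) (hd : ∀ c, K < ‖J c‖ → d c ∈ Icc 0 η)
    (hul : ∀ x y, K - 1 < ‖J x‖ → K - 1 < ‖J y‖ → ‖u x - u y‖ ≤ s⁻¹ * ‖x - y‖)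
    (hp : ∀ c, K < ‖J c‖ → ∀ c', K < ‖J c'‖ →
      ‖(d c / 2) • u c - (d c' / 2) • u c'‖ ≤ 2 * η * ‖c - c'‖) :
    ∫⁻ c in {c | K < ‖J c‖}, W c * lensBoundaryIntegral s c (u c) (d c) g
      ≤ ENNReal.ofReal (s ^ k) * (ENNReal.ofReal θ * ((q : ℝ≥0∞) ^ (k + 1) *
        (sphereMeasure (k + 1) univ *
          (ENNReal.ofReal θ * ∫⁻ z in {z | K - 1 - s < ‖J z‖}, W z * g z)))) := by
  set D := {c : Space (k + 1) | K < ‖J c‖}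
  have hDo : IsOpen D := isOpen_lt_norm_apply J K
  have hDm : MeasurableSet D := hDo.measurableSet
  -- The function `d` comes from a choice; its product with `u` is measurable on `D` only because
  -- `hp` makes it Lipschitz there.
  set P : Space (k + 1) → Space (k + 1) := D.indicator fun c => (d c / 2) • u c
  have hPD : ∀ c ∈ D, P c = (d c / 2) • u c := fun c hc => indicator_of_mem hc _
  have hPm : Measurable P := by
    have hcont : ContinuousOn (fun c => (d c / 2) • u c) D := by
      refine LipschitzOnWith.continuousOn (K := (2 * η).toNNReal)
        (LipschitzOnWith.of_dist_le_mul fun c hc c' hc' => ?_)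
      rw [dist_eq_norm, dist_eq_norm]
      refine (hp c hc c' hc').trans ?_
      gcongr
      exact Real.le_coe_toNNReal _
    classical
    have := hcont.measurable_piecewise (continuousOn_const (c := (0 : Space (k + 1)))) hDm
    rwa [show (fun _ : Space (k + 1) => (0 : Space (k + 1))) = 0 from rfl, piecewise_eq_indicator]
      at this
  have hPn : ∀ c ∈ D, ‖P c‖ = d c / 2 := fun c hc => by
    rw [hPD c hc, norm_smul, hu1 c hc, mul_one, Real.norm_of_nonneg (by linarith [(hd c hc).1])]
  -- The half-spaces use the field at the centre of the sphere, not at the midpoint of the lens. The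
  -- caps fit into them because passing from midpoint to centre changes s⟨u, σ⟩ by at most d/2,
  -- exactly the height at which the caps begin.
  set A : Set (Space (k + 1) × Dir (k + 1)) :=
    {p | K - 1 < ‖J p.1‖ ∧ 0 ≤ inner ℝ (u p.1) (p.2 : Space (k + 1))}
  set A' : Set (Space (k + 1) × Dir (k + 1)) :=
    {p | K - 1 < ‖J p.1‖ ∧ inner ℝ (u p.1) (p.2 : Space (k + 1)) < 0}
  have hin : Measurable fun p : Space (k + 1) × Dir (k + 1) =>
      inner ℝ (u p.1) (p.2 : Space (k + 1)) :=
    (hum.comp measurable_fst).inner (by fun_prop)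
  have hbase : MeasurableSet {p : Space (k + 1) × Dir (k + 1) | K - 1 < ‖J p.1‖} :=
    (isOpen_lt (by fun_prop) (by fun_prop)).measurableSet
  have hA : MeasurableSet A := hbase.inter (measurableSet_le measurable_const hin)
  have hA' : MeasurableSet A' := hbase.inter (measurableSet_lt hin measurable_const)
  set G : Space (k + 1) × Dir (k + 1) → ℝ≥0∞ := fun p => W p.1 * g (p.1 + s • (p.2 : Space (k + 1)))
  have hG : Measurable G := by fun_prop
  have hσn : ∀ σ : Dir (k + 1), ‖(σ : Space (k + 1))‖ = 1 := fun σ => norm_eq_of_mem_sphere σ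
  have hJP : ∀ c ∈ D, K - 1 < ‖J (c - P c)‖ ∧ K - 1 < ‖J (c + P c)‖ := by
    intro c hc
    have hc' : K < ‖J c‖ := hc
    have h1 := norm_apply_sub_le hJ c (-P c)
    have h2 := norm_apply_sub_le hJ c (P c)
    rw [norm_neg, ← sub_eq_add_neg] at h1
    have h3 := hPn c hc
    have h4 := hd c hc
    constructor <;> linarith [h4.1, h4.2]
  have hinner : ∀ c ∈ D, ∀ x, K - 1 < ‖J x‖ → ‖x - c‖ = d c / 2 → ∀ σ : Dir (k + 1),
      |s * inner ℝ (u x) (σ : Space (k + 1)) - s * inner ℝ (u c) (σ : Space (k + 1))| ≤ d c / 2 := by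
    intro c hc x hx hxc σ
    have hc' : K < ‖J c‖ := hc
    rw [← mul_sub, ← inner_sub_left, abs_mul, abs_of_pos hs]
    have h1 : |inner ℝ (u x - u c) (σ : Space (k + 1))| ≤ s⁻¹ * (d c / 2) := by
      refine (abs_real_inner_le_norm _ _).trans ?_
      rw [hσn, mul_one, ← hxc]
      exact hul x c hx (by linarith)
    calc _ ≤ s * (s⁻¹ * (d c / 2)) := by gcongr
      _ = _ := by rw [mul_inv_cancel_left₀ hs.ne']
  have hpt : ∀ c ∈ D, W c * lensBoundaryIntegral s c (u c) (d c) g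
      ≤ ENNReal.ofReal (s ^ k) * (ENNReal.ofReal θ *
        (∫⁻ σ, A.indicator G (c - P c, σ) + A'.indicator G (c + P c, σ) ∂sphereMeasure (k + 1))) := by
    intro c hc
    have hc' : K < ‖J c‖ := hc
    have hWc : ∀ x, ‖x - c‖ = d c / 2 → W c ≤ ENNReal.ofReal θ * W x := fun x hx =>
      hW x c (by linarith [hJ c]) (by rw [hx]; linarith [(hd c hc).1, (hd c hc).2])
    have hm1 : Measurable fun σ : Dir (k + 1) => A.indicator G (c - P c, σ) :=
      (hG.indicator hA).comp measurable_prodMk_left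
    rw [lensBoundaryIntegral, mul_left_comm, lintegral_add_left hm1, ← hPD c hc]
    refine mul_le_mul_right ?_ _
    rw [mul_add, mul_add]
    refine add_le_add ?_ ?_
    · have hm3 : Measurable fun σ : Dir (k + 1) => g (c - P c + s • (σ : Space (k + 1))) := by fun_prop
      rw [← lintegral_indicator (measurableSet_upperCap s (u c) (d c)),
        ← lintegral_const_mul _ (hm3.indicator (measurableSet_upperCap _ _ _)),
        ← lintegral_const_mul _ hm1]
      refine lintegral_mono fun σ => ?_
      by_cases hσ : d c / 2 ≤ s * inner ℝ (u c) (σ : Space (k + 1))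
      · have hx : ‖c - P c - c‖ = d c / 2 := by rw [sub_sub_cancel_left, norm_neg, hPn c hc]
        have hmem : (c - P c, σ) ∈ A := by
          refine ⟨(hJP c hc).1, ?_⟩
          have := (abs_le.1 (hinner c hc _ (hJP c hc).1 hx σ)).1
          exact nonneg_of_mul_nonneg_right (by linarith :
            0 ≤ s * inner ℝ (u (c - P c)) (σ : Space (k + 1))) hs
        rw [indicator_of_mem (show σ ∈ {σ : Dir (k + 1) | d c / 2 ≤ s * inner ℝ (u c) (σ : Space _)}
          from hσ), indicator_of_mem hmem, ← mul_assoc]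
        exact mul_le_mul_left (hWc _ hx) _
      · rw [indicator_of_notMem (show σ ∉ {σ : Dir (k + 1) | d c / 2 ≤ s * inner ℝ (u c)
          (σ : Space _)} from hσ), mul_zero]
        exact zero_le
    · have hm2 : Measurable fun σ : Dir (k + 1) => A'.indicator G (c + P c, σ) :=
        (hG.indicator hA').comp measurable_prodMk_left
      have hm3 : Measurable fun σ : Dir (k + 1) => g (c + P c + s • (σ : Space (k + 1))) := by fun_prop
      rw [← lintegral_indicator (measurableSet_lowerCap s (u c) (d c)),
        ← lintegral_const_mul _ (hm3.indicator (measurableSet_lowerCap _ _ _)),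
        ← lintegral_const_mul _ hm2]
      refine lintegral_mono fun σ => ?_
      by_cases hσ : s * inner ℝ (u c) (σ : Space (k + 1)) < -(d c / 2)
      · have hx : ‖c + P c - c‖ = d c / 2 := by rw [add_sub_cancel_left, hPn c hc]
        have hmem : (c + P c, σ) ∈ A' := by
          refine ⟨(hJP c hc).2, ?_⟩
          have := (abs_le.1 (hinner c hc _ (hJP c hc).2 hx σ)).2
          have hneg : s * inner ℝ (u (c + P c)) (σ : Space (k + 1)) < 0 := by linarith
          by_contra hcon
          exact absurd hneg (not_lt.2 (mul_nonneg hs.le (not_lt.1 hcon)))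
        rw [indicator_of_mem (show σ ∈ {σ : Dir (k + 1) | s * inner ℝ (u c) (σ : Space _)
          < -(d c / 2)} from hσ), indicator_of_mem hmem, ← mul_assoc]
        exact mul_le_mul_left (hWc _ hx) _
      · rw [indicator_of_notMem (show σ ∉ {σ : Dir (k + 1) | s * inner ℝ (u c) (σ : Space _)
          < -(d c / 2)} from hσ), mul_zero]
        exact zero_le
  have hanti : ∀ T : Space (k + 1) → Space (k + 1),
      (∀ c ∈ D, ∀ c' ∈ D, dist c c' - dist (P c) (P c') ≤ dist (T c) (T c')) →
      ∀ c ∈ D, ∀ c' ∈ D, dist c c' ≤ q * dist (T c) (T c') := by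
    intro T hT c hc c' hc'
    have h1 := hT c hc c' hc'
    have h2 : dist (P c) (P c') ≤ 2 * η * dist c c' := by
      rw [dist_eq_norm, dist_eq_norm, hPD c hc, hPD c' hc']; exact hp c hc c' hc'
    calc dist c c' ≤ (q * (1 - 2 * η)) * dist c c' := le_mul_of_one_le_left dist_nonneg hq
      _ = q * (dist c c' - 2 * η * dist c c') := by ring
      _ ≤ _ := by gcongr; linarith
  have hanti1 := hanti (fun c => c - P c) fun c _ c' _ => by
    rw [dist_eq_norm, dist_eq_norm, dist_eq_norm]
    have : c - c' = (c - P c - (c' - P c')) + (P c - P c') := by abel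
    rw [sub_le_iff_le_add]
    conv_lhs => rw [this]
    exact norm_add_le _ _
  have hanti2 := hanti (fun c => c + P c) fun c _ c' _ => by
    rw [dist_eq_norm, dist_eq_norm, dist_eq_norm]
    have : c - c' = (c + P c - (c' + P c')) - (P c - P c') := by abel
    rw [sub_le_iff_le_add]
    conv_lhs => rw [this]
    exact norm_sub_le _ _
  have hσ : ∀ σ : Dir (k + 1),
      ∫⁻ c in D, (A.indicator G (c - P c, σ) + A'.indicator G (c + P c, σ))
        ≤ (q : ℝ≥0∞) ^ (k + 1) * (ENNReal.ofReal θ *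
          ∫⁻ z in {z | K - 1 - s < ‖J z‖}, W z * g z) := by
    intro σ
    have hm1 : Measurable fun x => A.indicator G (x, σ) :=
      (hG.indicator hA).comp measurable_prodMk_right
    have hm2 : Measurable fun x => A'.indicator G (x, σ) :=
      (hG.indicator hA').comp measurable_prodMk_right
    have hm1' : Measurable fun c => A.indicator G (c - P c, σ) :=
      hm1.comp (measurable_id.sub hPm)
    rw [lintegral_add_left hm1']
    have h1 := setLIntegral_comp_le_of_antilipschitz (measurable_id.sub hPm) hanti1 hm1
    have h2 := setLIntegral_comp_le_of_antilipschitz (measurable_id.add hPm) hanti2 hm2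
    refine (add_le_add h1 h2).trans ?_
    rw [← mul_add, ← lintegral_add_left hm1]
    gcongr
    have hDm' : MeasurableSet {z : Space (k + 1) | K - 1 - s < ‖J z‖} :=
      (isOpen_lt_norm_apply J _).measurableSet
    rw [← lintegral_const_mul _ (by fun_prop), ← lintegral_indicator hDm',
      ← lintegral_add_right_eq_self ({z : Space (k + 1) | K - 1 - s < ‖J z‖}.indicator
        fun z => ENNReal.ofReal θ * (W z * g z)) (s • (σ : Space (k + 1)))]
    refine lintegral_mono fun x => ?_
    have hsn : ‖s • (σ : Space (k + 1))‖ = s := by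
      rw [norm_smul, hσn, mul_one, Real.norm_of_nonneg hs.le]
    -- After the change of variables both families of centres are described by the same point x,
    -- where `A` and `A'` are complementary conditions on `σ`; hence the sphere is counted once.
    have hle : A.indicator G (x, σ) + A'.indicator G (x, σ)
        ≤ {x : Space (k + 1) | K - 1 < ‖J x‖}.indicator (fun x => G (x, σ)) x := by
      by_cases hx : K - 1 < ‖J x‖
      · rw [indicator_of_mem (show x ∈ {x : Space (k + 1) | K - 1 < ‖J x‖} from hx)]
        by_cases hi : 0 ≤ inner ℝ (u x) (σ : Space (k + 1))
        · rw [indicator_of_mem (show (x, σ) ∈ A from ⟨hx, hi⟩),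
            indicator_of_notMem (show (x, σ) ∉ A' from fun h => absurd h.2 (not_lt.2 hi)), add_zero]
        · rw [indicator_of_notMem (show (x, σ) ∉ A from fun h => hi h.2), zero_add]
          exact indicator_le_self _ _ _
      · rw [indicator_of_notMem (show (x, σ) ∉ A from fun h => hx h.1),
          indicator_of_notMem (show (x, σ) ∉ A' from fun h => hx h.1), zero_add]
        exact zero_le
    refine hle.trans ?_
    by_cases hx : K - 1 < ‖J x‖
    · have h3 := norm_apply_sub_le hJ x (s • (σ : Space (k + 1)))
      rw [hsn] at h3
      rw [indicator_of_mem (show x ∈ {x : Space (k + 1) | K - 1 < ‖J x‖} from hx),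
        indicator_of_mem (show x + s • (σ : Space (k + 1)) ∈ {z : Space (k + 1) | K - 1 - s < ‖J z‖}
          from by rw [mem_ofPred_eq]; linarith), ← mul_assoc]
      refine mul_le_mul_left (hW _ _ ?_ ?_) _
      · linarith [hJ x]
      · rw [add_sub_cancel_left, hsn]; linarith
    · rw [indicator_of_notMem (show x ∉ {x : Space (k + 1) | K - 1 < ‖J x‖} from hx)]
      exact zero_le
  have hjoint : Measurable (Function.uncurry fun (c : Space (k + 1)) (σ : Dir (k + 1)) =>
      A.indicator G (c - P c, σ) + A'.indicator G (c + P c, σ)) := by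
    refine Measurable.add ?_ ?_
    · exact (hG.indicator hA).comp
        (((measurable_id.sub hPm).comp measurable_fst).prodMk measurable_snd)
    · exact (hG.indicator hA').comp
        (((measurable_id.add hPm).comp measurable_fst).prodMk measurable_snd)
  calc _ ≤ ∫⁻ c in D, ENNReal.ofReal (s ^ k) * (ENNReal.ofReal θ *
        (∫⁻ σ, A.indicator G (c - P c, σ) + A'.indicator G (c + P c, σ)
          ∂sphereMeasure (k + 1))) := setLIntegral_mono' hDm hpt
    _ = ENNReal.ofReal (s ^ k) * (ENNReal.ofReal θ * ∫⁻ σ, (∫⁻ c in D,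
        (A.indicator G (c - P c, σ) + A'.indicator G (c + P c, σ))) ∂sphereMeasure (k + 1)) := by
        rw [lintegral_const_mul' _ _ ENNReal.ofReal_ne_top,
          lintegral_const_mul' _ _ ENNReal.ofReal_ne_top, lintegral_lintegral_swap]
        exact hjoint.aemeasurable
    _ ≤ ENNReal.ofReal (s ^ k) * (ENNReal.ofReal θ * ∫⁻ _σ : Dir (k + 1), (q : ℝ≥0∞) ^ (k + 1) *
        (ENNReal.ofReal θ * ∫⁻ z in {z | K - 1 - s < ‖J z‖}, W z * g z) ∂sphereMeasure (k + 1)) := by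
        exact mul_le_mul_right (mul_le_mul_right (lintegral_mono hσ) _) _
    _ = _ := by
        rw [lintegral_const]; ring

end Averaging

/-! ### Polar coordinates -/

theorem lintegral_polar {k : ℕ} {φ : Space (k + 1) → ℝ≥0∞} (hφ : Measurable φ) :
    ∫⁻ x, φ x = ∫⁻ t in Ioi (0 : ℝ), ENNReal.ofReal (t ^ k) *
      ∫⁻ σ, φ (t • (σ : Space (k + 1))) ∂sphereMeasure (k + 1) := by
  have hmp := (volume : Measure (Space (k + 1))).measurePreserving_homeomorphUnitSphereProd
  have hm0 : MeasurableSet ({0}ᶜ : Set (Space (k + 1))) := (measurableSet_singleton _).compl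
  have h1 : ∫⁻ x, φ x = ∫⁻ x : ({0}ᶜ : Set (Space (k + 1))), φ x
      ∂((volume : Measure (Space (k + 1))).comap Subtype.val) := by
    rw [lintegral_subtype_comap hm0, restrict_compl_singleton]
  have h2 : ∀ x : ({0}ᶜ : Set (Space (k + 1))), φ x
      = (fun p : Dir (k + 1) × Ioi (0 : ℝ) => φ ((p.2 : ℝ) • (p.1 : Space (k + 1))))
        (homeomorphUnitSphereProd (Space (k + 1)) x) := by
    intro x
    have hx : ‖(x : Space (k + 1))‖ ≠ 0 := norm_ne_zero_iff.2 x.2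
    simp [smul_smul, hx]
  have hmeas : Measurable fun p : Dir (k + 1) × Ioi (0 : ℝ) =>
      φ ((p.2 : ℝ) • (p.1 : Space (k + 1))) := by fun_prop
  rw [h1, lintegral_congr h2, hmp.lintegral_comp hmeas, lintegral_prod_symm _ hmeas.aemeasurable]
  simp only [finrank_euclideanSpace, Fintype.card_fin, Nat.add_sub_cancel]
  have hF : Measurable fun t : ℝ =>
      ∫⁻ σ, φ (t • (σ : Space (k + 1))) ∂sphereMeasure (k + 1) := by
    have : Measurable (Function.uncurry fun (t : ℝ) (σ : Dir (k + 1)) =>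
        φ (t • (σ : Space (k + 1)))) := by
      simp only [Function.uncurry_def]; fun_prop
    exact this.lintegral_prod_right
  have hpow : Measurable fun r : Ioi (0 : ℝ) => ENNReal.ofReal ((r : ℝ) ^ k) := by fun_prop
  rw [Measure.volumeIoiPow]
  refine (lintegral_withDensity_eq_lintegral_mul _ hpow (hF.comp measurable_subtype_coe)).trans ?_
  exact lintegral_subtype_comap measurableSet_Ioi (fun t : ℝ => ENNReal.ofReal (t ^ k) *
      ∫⁻ σ, φ (t • (σ : Space (k + 1))) ∂sphereMeasure (k + 1))

/-- In polar coordinates the Jacobian tᵏ cancels the weight up to the factor 2⁻ᵏ, since 1 + t ≤ 2t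
for t ≥ 1. -/
theorem lintegral_weight_eq_top {k : ℕ} {g : Space (k + 1) → ℝ≥0∞} (hg : Measurable g) {R : ℝ}
    (hR : 1 ≤ R) (h : ∫⁻ t in Ioi R, radialAverage g t = ⊤) :
    ∫⁻ x in {x : Space (k + 1) | R < ‖x‖}, ENNReal.ofReal ((1 + ‖x‖) ^ k)⁻¹ * g x = ⊤ := by
  obtain ⟨c, hc, hcle⟩ := exists_radialAverage_le k
  have hS : MeasurableSet {x : Space (k + 1) | R < ‖x‖} :=
    (isOpen_lt (by fun_prop) (by fun_prop)).measurableSet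
  have hweight : Measurable fun x : Space (k + 1) => ENNReal.ofReal ((1 + ‖x‖) ^ k)⁻¹ * g x := by
    fun_prop
  have h1 : ∫⁻ t in Ioi R, ∫⁻ σ, g (t • (σ : Space (k + 1))) ∂sphereMeasure (k + 1) = ⊤ := by
    by_contra hne
    refine (ENNReal.mul_lt_top hc.lt_top (lt_top_iff_ne_top.2 hne)).ne (top_unique ?_)
    rw [← h, ← lintegral_const_mul' _ _ hc]
    exact setLIntegral_mono' measurableSet_Ioi fun t ht =>
      hcle g hg t (one_pos.trans_le hR |>.trans ht)
  have h2 : ENNReal.ofReal ((2 ^ k)⁻¹) *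
      ∫⁻ t in Ioi R, ∫⁻ σ, g (t • (σ : Space (k + 1))) ∂sphereMeasure (k + 1) = ⊤ := by
    rw [h1, ENNReal.mul_top]
    simp
  refine top_unique ?_
  rw [← h2, ← lintegral_indicator hS, lintegral_polar (hweight.indicator hS),
    ← lintegral_const_mul' _ _ ENNReal.ofReal_ne_top, ← lintegral_indicator measurableSet_Ioi,
    ← lintegral_indicator measurableSet_Ioi]
  refine lintegral_mono fun t => ?_
  by_cases ht : t ∈ Ioi R
  · have ht' : R < t := ht
    have ht0 : 0 < t := by linarith
    rw [indicator_of_mem ht, indicator_of_mem (show t ∈ Ioi 0 from ht0)]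
    have hn : ∀ σ : Dir (k + 1), ‖t • (σ : Space (k + 1))‖ = t := fun σ => by
      rw [norm_smul, norm_eq_of_mem_sphere, mul_one, Real.norm_of_nonneg ht0.le]
    have heq : ∀ σ : Dir (k + 1), {x : Space (k + 1) | R < ‖x‖}.indicator
        (fun x => ENNReal.ofReal ((1 + ‖x‖) ^ k)⁻¹ * g x) (t • (σ : Space (k + 1)))
          = ENNReal.ofReal ((1 + t) ^ k)⁻¹ * g (t • (σ : Space (k + 1))) := by
      intro σ
      rw [indicator_of_mem (show t • (σ : Space (k + 1)) ∈ {x : Space (k + 1) | R < ‖x‖} by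
        rw [mem_ofPred_eq, hn]; exact ht'), hn]
    rw [lintegral_congr heq, lintegral_const_mul' _ _ ENNReal.ofReal_ne_top, ← mul_assoc,
      ← ENNReal.ofReal_mul (by positivity)]
    gcongr
    rw [← div_eq_mul_inv, le_div_iff₀ (by positivity), inv_mul_le_iff₀ (by positivity), ← mul_pow]
    gcongr
    linarith
  · rw [indicator_of_notMem ht]
    exact zero_le

/-! ### A tangential field -/

/-- The quarter turn in the plane of the first two coordinates (and zero in the other ones). -/
noncomputable def quarterTurn (j : ℕ) : Space (j + 2) →L[ℝ] Space (j + 2) :=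
  (EuclideanSpace.proj (𝕜 := ℝ) (0 : Fin (j + 2))).smulRight (EuclideanSpace.single 1 1) -
    (EuclideanSpace.proj (𝕜 := ℝ) (1 : Fin (j + 2))).smulRight (EuclideanSpace.single 0 1)

theorem quarterTurn_apply {j : ℕ} (x : Space (j + 2)) :
    quarterTurn j x = x 0 • EuclideanSpace.single 1 1 - x 1 • EuclideanSpace.single 0 1 := rfl

theorem inner_quarterTurn {j : ℕ} (x : Space (j + 2)) : inner ℝ x (quarterTurn j x) = 0 := by
  rw [quarterTurn_apply, inner_sub_right, inner_smul_right, inner_smul_right,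
    EuclideanSpace.inner_single_right, EuclideanSpace.inner_single_right]
  simp [mul_comm]

theorem norm_sq_quarterTurn {j : ℕ} (x : Space (j + 2)) :
    ‖quarterTurn j x‖ ^ 2 = x 0 ^ 2 + x 1 ^ 2 := by
  rw [quarterTurn_apply, norm_sub_sq_real, norm_smul, norm_smul, inner_smul_left, inner_smul_right,
    EuclideanSpace.inner_single_left]
  simp

theorem norm_quarterTurn_le {j : ℕ} (x : Space (j + 2)) : ‖quarterTurn j x‖ ≤ ‖x‖ := by
  refine le_of_sq_le_sq ?_ (norm_nonneg _)
  rw [norm_sq_quarterTurn, EuclideanSpace.real_norm_sq_eq, Fin.sum_univ_succ, Fin.sum_univ_succ,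
    ← add_assoc]
  exact le_add_of_nonneg_right (Finset.sum_nonneg fun i _ => sq_nonneg _)

/-- Two coordinates are bounded on the tube, so the weight of order -(j+1) only has to be summable
in the remaining `j` dimensions. It is dominated by a product of one-variable functions. -/
theorem lintegral_weight_tube_lt_top (j : ℕ) (K : ℝ) :
    ∫⁻ x in {x : Space (j + 2) | ‖quarterTurn j x‖ ≤ K},
      ENNReal.ofReal ((1 + ‖x‖) ^ (j + 1))⁻¹ < ⊤ := by
  -- Any exponent α > 1 with αj ≤ j + 1 serves: the first makes each factor summable, the second
  -- lets `j` factors be paid for by the weight.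
  set α : ℝ := 1 + 1 / (j + 1) with hα
  let φ : Fin (j + 2) → ℝ → ℝ := Fin.cons ((Icc (-K) K).indicator 1)
    (Fin.cons ((Icc (-K) K).indicator 1) fun _ t => (1 + ‖t‖) ^ (-α))
  have hα1 : 1 < α := by rw [hα]; have : (0 : ℝ) < 1 / (j + 1) := by positivity
                         linarith
  have hind : Integrable ((Icc (-K) K).indicator (1 : ℝ → ℝ)) :=
    (integrable_indicator_iff measurableSet_Icc).2 (integrableOn_const measure_Icc_lt_top.ne)
  have hφ : ∀ i, Integrable (φ i) := by
    intro i
    refine Fin.cases hind (fun i => Fin.cases hind (fun i => ?_) i) i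
    exact integrable_one_add_norm (by simpa using hα1)
  have hφ0 : ∀ i t, 0 ≤ φ i t := by
    intro i t
    have h0 : 0 ≤ (Icc (-K) K).indicator (1 : ℝ → ℝ) t := indicator_nonneg (fun _ _ => zero_le_one) t
    refine Fin.cases h0 (fun i => Fin.cases h0 (fun i => ?_) i) i
    change 0 ≤ (1 + ‖t‖) ^ (-α)
    positivity
  have hprod : Integrable fun x : Fin (j + 2) → ℝ => ∏ i, φ i (x i) :=
    Integrable.fintype_prod hφ
  have hprod' : Integrable fun x : Space (j + 2) => ∏ i, φ i (x i) :=
    (PiLp.volume_preserving_ofLp (Fin (j + 2))).integrable_comp_of_integrable hprod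
  have hle : ∀ x ∈ {x : Space (j + 2) | ‖quarterTurn j x‖ ≤ K},
      ((1 + ‖x‖) ^ (j + 1))⁻¹ ≤ ∏ i, φ i (x i) := by
    intro x hx
    have hx' : ‖quarterTurn j x‖ ≤ K := hx
    have hK : 0 ≤ K := (norm_nonneg _).trans hx'
    have hsq : x 0 ^ 2 + x 1 ^ 2 ≤ K ^ 2 := by rw [← norm_sq_quarterTurn]; gcongr
    have h0 : x 0 ∈ Icc (-K) K := abs_le.1 (abs_le_of_sq_le_sq (by nlinarith [sq_nonneg (x 1)]) hK)
    have h1 : x 1 ∈ Icc (-K) K := abs_le.1 (abs_le_of_sq_le_sq (by nlinarith [sq_nonneg (x 0)]) hK)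
    rw [Fin.prod_univ_succ, Fin.prod_univ_succ]
    have e0 : φ 0 (x 0) = 1 := indicator_of_mem h0 _
    have e1 : φ (Fin.succ 0) (x (Fin.succ 0)) = 1 := indicator_of_mem h1 _
    rw [e0, e1, one_mul, one_mul]
    have hb : (1 : ℝ) ≤ 1 + ‖x‖ := by linarith [norm_nonneg x]
    calc ((1 + ‖x‖) ^ (j + 1))⁻¹ = (1 + ‖x‖) ^ (-((j : ℝ) + 1)) := by
          rw [Real.rpow_neg (by positivity), ← Real.rpow_natCast]; push_cast; rfl
      _ ≤ (1 + ‖x‖) ^ ((-α) * j) := by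
          refine Real.rpow_le_rpow_of_exponent_le hb ?_
          have : α * j = j + j / (j + 1) := by rw [hα]; field_simp
          have h2 : (j : ℝ) / (j + 1) ≤ 1 := by rw [div_le_one (by positivity)]; linarith
          linarith
      _ = ∏ _i : Fin j, (1 + ‖x‖) ^ (-α) := by
          rw [Finset.prod_const, Finset.card_univ, Fintype.card_fin, Real.rpow_mul_natCast (by positivity)]
      _ ≤ ∏ i : Fin j, φ i.succ.succ (x i.succ.succ) := by
          refine Finset.prod_le_prod (fun i _ => by positivity) fun i _ => ?_
          change (1 + ‖x‖) ^ (-α) ≤ (1 + ‖x i.succ.succ‖) ^ (-α)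
          refine Real.rpow_le_rpow_of_nonpos (by positivity) ?_ (by linarith)
          gcongr
          exact PiLp.norm_apply_le x _
  have hm : MeasurableSet {x : Space (j + 2) | ‖quarterTurn j x‖ ≤ K} :=
    (isClosed_le (by fun_prop) (by fun_prop)).measurableSet
  calc _ ≤ ∫⁻ x in {x : Space (j + 2) | ‖quarterTurn j x‖ ≤ K}, ENNReal.ofReal (∏ i, φ i (x i)) :=
        setLIntegral_mono' hm fun x hx => ENNReal.ofReal_le_ofReal (hle x hx)
    _ ≤ ∫⁻ x : Space (j + 2), ENNReal.ofReal (∏ i, φ i (x i)) := setLIntegral_le_lintegral _ _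
    _ < ⊤ := hprod'.lintegral_lt_top

/-! ### Averaging over the centres of the lenses -/

/-- A summable truncation, at scale `N`, of the weight `(1 + |x|)⁻ᵏ`. -/
noncomputable def truncatedWeight (k : ℕ) (N : ℝ) (x : Space (k + 1)) : ℝ :=
  ((1 + ‖x‖) ^ k)⁻¹ * (N / (N + ‖x‖)) ^ 2

variable {k : ℕ} {N : ℝ}

@[fun_prop]
theorem measurable_truncatedWeight : Measurable (truncatedWeight k N) := by
  unfold truncatedWeight; fun_prop

theorem truncatedWeight_le (hN : 0 < N) (x : Space (k + 1)) :
    truncatedWeight k N x ≤ ((1 + ‖x‖) ^ k)⁻¹ := by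
  refine mul_le_of_le_one_right (by positivity) (pow_le_one₀ (by positivity) ?_)
  rw [div_le_one (by positivity)]
  linarith [norm_nonneg x]

theorem tendsto_truncatedWeight (x : Space (k + 1)) :
    Tendsto (fun N : ℕ => truncatedWeight k ((N : ℝ) + 1) x) atTop (𝓝 ((1 + ‖x‖) ^ k)⁻¹) := by
  have h1 : Tendsto (fun N : ℕ => (N : ℝ) + 1) atTop atTop :=
    tendsto_atTop_add_const_right _ _ tendsto_natCast_atTop_atTop
  have h2 : Tendsto (fun t : ℝ => t / (t + ‖x‖)) atTop (𝓝 1) := by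
    have h3 : Tendsto (fun t : ℝ => 1 - ‖x‖ / (t + ‖x‖)) atTop (𝓝 (1 - 0)) :=
      tendsto_const_nhds.sub
        ((tendsto_atTop_add_const_right _ _ tendsto_id).const_div_atTop _)
    rw [sub_zero] at h3
    refine h3.congr' ?_
    filter_upwards [eventually_gt_atTop 0] with t ht
    have : t + ‖x‖ ≠ 0 := by positivity
    rw [eq_div_iff this, sub_mul, div_mul_cancel₀ _ this]
    ring
  simpa [truncatedWeight] using ((h2.comp h1).pow 2).const_mul ((1 + ‖x‖) ^ k)⁻¹

/-- The constant does not depend on `N` and tends to 1 as K → ∞; the exponent counts the k + 2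
factors of the form (t + |x|)⁻¹. -/
theorem truncatedWeight_le_mul (hN : 0 < N) {K ℓ : ℝ} (hK : 0 < K) {x y : Space (k + 1)}
    (hy : K ≤ ‖y‖) (hxy : ‖x - y‖ ≤ ℓ) :
    truncatedWeight k N y ≤ (1 + ℓ / K) ^ (k + 2) * truncatedWeight k N x := by
  have hℓ : 0 ≤ ℓ := (norm_nonneg _).trans hxy
  set β := 1 + ℓ / K with hβ
  have hβ1 : 1 ≤ β := le_add_of_nonneg_right (by positivity)
  have hx : ‖x‖ ≤ β * ‖y‖ := by
    have h1 : ‖x‖ ≤ ‖y‖ + ℓ := by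
      linarith [norm_sub_norm_le x y]
    have h2 : ℓ ≤ ℓ / K * ‖y‖ := by
      rw [div_mul_eq_mul_div, le_div_iff₀ hK]
      gcongr
    rw [hβ, add_mul, one_mul]
    linarith
  have key : ∀ t : ℝ, 0 < t → (t + ‖y‖)⁻¹ ≤ β * (t + ‖x‖)⁻¹ := by
    intro t ht
    rw [← div_eq_mul_inv, le_div_iff₀ (by positivity), inv_mul_le_iff₀ (by positivity)]
    nlinarith
  calc truncatedWeight k N y = (1 + ‖y‖)⁻¹ ^ k * (N * (N + ‖y‖)⁻¹) ^ 2 := by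
        rw [truncatedWeight, inv_pow, div_eq_mul_inv]
    _ ≤ (β * (1 + ‖x‖)⁻¹) ^ k * (N * (β * (N + ‖x‖)⁻¹)) ^ 2 := by
        gcongr
        · exact key 1 one_pos
        · exact key N hN
    _ = β ^ (k + 2) * truncatedWeight k N x := by
        rw [truncatedWeight, div_eq_mul_inv, ← inv_pow, mul_pow β, pow_add]
        ring

theorem lintegral_truncatedWeight_lt_top (hN : 1 ≤ N) :
    ∫⁻ x, ENNReal.ofReal (truncatedWeight k N x) < ⊤ := by
  have hfin : ∫⁻ x : Space (k + 1), ENNReal.ofReal ((1 + ‖x‖) ^ (-((k + 2 : ℕ) : ℝ))) < ⊤ := by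
    refine finite_integral_one_add_norm ?_
    rw [finrank_euclideanSpace_fin]
    exact_mod_cast Nat.lt_succ_self _
  calc _ ≤ ∫⁻ x : Space (k + 1), ENNReal.ofReal (N ^ 2) *
        ENNReal.ofReal ((1 + ‖x‖) ^ (-((k + 2 : ℕ) : ℝ))) := by
        refine lintegral_mono fun x => ?_
        rw [← ENNReal.ofReal_mul (by positivity)]
        refine ENNReal.ofReal_le_ofReal ?_
        rw [Real.rpow_neg (by positivity), Real.rpow_natCast, truncatedWeight, div_pow, pow_add,
          mul_inv]
        calc ((1 + ‖x‖) ^ k)⁻¹ * (N ^ 2 / (N + ‖x‖) ^ 2)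
            ≤ ((1 + ‖x‖) ^ k)⁻¹ * (N ^ 2 / (1 + ‖x‖) ^ 2) := by gcongr
          _ = _ := by ring
    _ < ⊤ := by
        rw [lintegral_const_mul' _ _ ENNReal.ofReal_ne_top]
        exact ENNReal.mul_lt_top ENNReal.ofReal_lt_top hfin

/-! ### The averaged inequality and the existence of a good centre -/

variable {J : Space (k + 1) →L[ℝ] Space (k + 1)} {K s θ Λ : ℝ} {W g : Space (k + 1) → ℝ≥0∞}
  {u : Space (k + 1) → Space (k + 1)} {d : Space (k + 1) → ℝ}

/-- If no centre is good, integrating the opposite inequality against `W` gives a self-improving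
bound: the same integral of g stands on both sides, over slightly different domains. Of the factors
θ³, one comes from the lens and two from its boundary. -/
theorem mul_lintegral_le_mul_lintegral_of_forall_le (hJ : ∀ x, ‖J x‖ ≤ ‖x‖) (hg : Measurable g)
    (hWm : Measurable W) (hum : Measurable u) {η : ℝ} {q : ℝ≥0} (hη : 0 ≤ η) (hη1 : η ≤ 1)
    (hηs : η ≤ s) (hq : 1 ≤ q * (1 - 2 * η)) (hθ : 0 ≤ θ) (hΛ : 0 ≤ Λ)
    (hW : ∀ x y, K - 1 - s ≤ ‖y‖ → ‖x - y‖ ≤ 1 + s → W y ≤ ENNReal.ofReal θ * W x)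
    (hs : 0 < s) (hu1 : ∀ c, K < ‖J c‖ → ‖u c‖ = 1) (hd : ∀ c, K < ‖J c‖ → d c ∈ Icc 0 η)
    (hul : ∀ x y, K - 1 < ‖J x‖ → K - 1 < ‖J y‖ → ‖u x - u y‖ ≤ s⁻¹ * ‖x - y‖)
    (hp : ∀ c, K < ‖J c‖ → ∀ c', K < ‖J c'‖ →
      ‖(d c / 2) • u c - (d c' / 2) • u c'‖ ≤ 2 * η * ‖c - c'‖)
    (hle : ∀ c, K < ‖J c‖ → ENNReal.ofReal Λ * ∫⁻ x in lens s c (u c) (d c), g x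
      ≤ ENNReal.ofReal s * lensBoundaryIntegral s c (u c) (d c) g) :
    ENNReal.ofReal (Λ * (s - η) ^ (k + 1)) * ∫⁻ z in {z | K + s < ‖J z‖}, W z * g z
      ≤ ENNReal.ofReal ((k + 1) * θ ^ 3 * (q * s) ^ (k + 1)) *
        ∫⁻ z in {z | K - 1 - s < ‖J z‖}, W z * g z := by
  have hD : MeasurableSet {c | K < ‖J c‖} := (isOpen_lt_norm_apply J K).measurableSet
  have h1 := mul_lintegral_le_lintegral_lens hJ hg hWm hη hW hs hu1 hd
  have h2 := lintegral_lensBoundaryIntegral_le hJ hg hWm hum hη1 hq hW hs hu1 hd hul hp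
  have h3 : ENNReal.ofReal Λ * ∫⁻ c in {c | K < ‖J c‖}, W c * ∫⁻ x in lens s c (u c) (d c), g x
      ≤ ENNReal.ofReal s * ∫⁻ c in {c | K < ‖J c‖}, W c * lensBoundaryIntegral s c (u c) (d c) g := by
    rw [← lintegral_const_mul' _ _ ENNReal.ofReal_ne_top,
      ← lintegral_const_mul' _ _ ENNReal.ofReal_ne_top]
    refine setLIntegral_mono' hD fun c hc => ?_
    rw [mul_left_comm, mul_left_comm _ (W c)]
    exact mul_le_mul_right (hle c hc) _
  set I₁ := ∫⁻ z in {z | K + s < ‖J z‖}, W z * g z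
  set I₂ := ∫⁻ z in {z | K - 1 - s < ‖J z‖}, W z * g z
  set ω := volume (Metric.ball (0 : Space (k + 1)) 1) with hω
  have hω0 : ω ≠ 0 := (Metric.measure_ball_pos _ _ one_pos).ne'
  have hωt : ω ≠ ⊤ := measure_ball_lt_top.ne
  have hsph : sphereMeasure (k + 1) univ = (k + 1 : ℝ≥0∞) * ω := by
    rw [Measure.toSphere_apply_univ, finrank_euclideanSpace_fin]; push_cast; rfl
  have hball : volume (Metric.ball (0 : Space (k + 1)) (s - η))
      = ENNReal.ofReal ((s - η) ^ (k + 1)) * ω := by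
    rw [Measure.addHaar_ball volume _ (sub_nonneg.2 hηs), finrank_euclideanSpace_fin]
  rw [hball] at h1
  rw [hsph] at h2
  have h4 : ω * (ENNReal.ofReal (Λ * (s - η) ^ (k + 1)) * I₁)
      ≤ ω * (ENNReal.ofReal ((k + 1) * θ ^ 3 * (q * s) ^ (k + 1)) * I₂) := by
    have hk : ENNReal.ofReal ((k : ℝ) + 1) = (k : ℝ≥0∞) + 1 := by
      rw [ENNReal.ofReal_add (by positivity) zero_le_one, ENNReal.ofReal_natCast,
        ENNReal.ofReal_one]
    calc ω * (ENNReal.ofReal (Λ * (s - η) ^ (k + 1)) * I₁)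
        = ENNReal.ofReal Λ * (ENNReal.ofReal ((s - η) ^ (k + 1)) * ω * I₁) := by
          rw [ENNReal.ofReal_mul hΛ]; ring
      _ ≤ ENNReal.ofReal Λ * (ENNReal.ofReal θ *
          ∫⁻ c in {c | K < ‖J c‖}, W c * ∫⁻ x in lens s c (u c) (d c), g x) := by gcongr
      _ = ENNReal.ofReal θ * (ENNReal.ofReal Λ *
          ∫⁻ c in {c | K < ‖J c‖}, W c * ∫⁻ x in lens s c (u c) (d c), g x) := by ring
      _ ≤ ENNReal.ofReal θ * (ENNReal.ofReal s * (ENNReal.ofReal (s ^ k) * (ENNReal.ofReal θ *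
          ((q : ℝ≥0∞) ^ (k + 1) * ((k + 1 : ℝ≥0∞) * ω * (ENNReal.ofReal θ * I₂)))))) := by
          exact mul_le_mul_right (h3.trans (mul_le_mul_right h2 _)) _
      _ = ω * (ENNReal.ofReal ((k + 1) * θ ^ 3 * (q * s) ^ (k + 1)) * I₂) := by
          rw [ENNReal.ofReal_pow hs.le, ENNReal.ofReal_mul (p := (k + 1) * θ ^ 3) (by positivity),
            ENNReal.ofReal_mul (p := (k : ℝ) + 1) (by positivity), hk,
            ENNReal.ofReal_pow hθ, ENNReal.ofReal_pow (by positivity), ENNReal.ofReal_mul (by positivity),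
            ENNReal.ofReal_coe_nnreal]
          ring
  exact (ENNReal.mul_le_mul_iff_right hω0 hωt).1 h4

theorem le_div_of_mul_le_mul_add {A B : ℝ} (hB : 0 ≤ B) (hAB : B < A) {I T : ℝ≥0∞} (hI : I ≠ ⊤)
    (h : ENNReal.ofReal A * I ≤ ENNReal.ofReal B * (I + T)) :
    I ≤ ENNReal.ofReal B * T / ENNReal.ofReal (A - B) := by
  have h0 : ENNReal.ofReal (A - B) ≠ 0 := by simpa using hAB
  rw [ENNReal.le_div_iff_mul_le (Or.inl h0) (Or.inl ENNReal.ofReal_ne_top), mul_comm]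
  have hA : ENNReal.ofReal A = ENNReal.ofReal B + ENNReal.ofReal (A - B) := by
    rw [← ENNReal.ofReal_add hB (by linarith), add_sub_cancel]
  rw [hA, add_mul, mul_add] at h
  exact (ENNReal.add_le_add_iff_left (ENNReal.mul_ne_top ENNReal.ofReal_ne_top hI)).1 h

/-- Otherwise A·I ≤ B·(I + T) with B < A, where I is the truncated weighted integral of g off the
tube and T bounds the part in the tube. Then I ≤ B·T/(A - B) uniformly in the truncation, and
Fatou's lemma contradicts the divergence of the full integral. -/
theorem exists_lensBoundaryIntegral_lt_of_lt (hJ : ∀ x, ‖J x‖ ≤ ‖x‖) (hg : Measurable g)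
    (hum : Measurable u) {η : ℝ} {q : ℝ≥0} (hη : 0 ≤ η) (hη1 : η ≤ 1)
    (hηs : η ≤ s) (hq : 1 ≤ q * (1 - 2 * η)) (hΛ : 0 ≤ Λ) (hK : 0 < K - 1 - s)
    (hs : 0 < s) (hu1 : ∀ c, K < ‖J c‖ → ‖u c‖ = 1) (hd : ∀ c, K < ‖J c‖ → d c ∈ Icc 0 η)
    (hul : ∀ x y, K - 1 < ‖J x‖ → K - 1 < ‖J y‖ → ‖u x - u y‖ ≤ s⁻¹ * ‖x - y‖)
    (hp : ∀ c, K < ‖J c‖ → ∀ c', K < ‖J c'‖ →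
      ‖(d c / 2) • u c - (d c' / 2) • u c'‖ ≤ 2 * η * ‖c - c'‖)
    (hlt : (k + 1) * ((1 + (1 + s) / (K - 1 - s)) ^ (k + 2)) ^ 3 * (q * s) ^ (k + 1)
      < Λ * (s - η) ^ (k + 1))
    {R : ℝ} (hR : R ≤ K - 1 - s) (hg1 : ∀ x, R < ‖x‖ → g x ≤ 1)
    (hT : ∫⁻ x in {x | ‖J x‖ ≤ K + s}, ENNReal.ofReal ((1 + ‖x‖) ^ k)⁻¹ < ⊤)
    (hgt : ∫⁻ x in {x | R < ‖x‖}, ENNReal.ofReal ((1 + ‖x‖) ^ k)⁻¹ * g x = ⊤) :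
    ∃ c, K < ‖J c‖ ∧ ENNReal.ofReal s * lensBoundaryIntegral s c (u c) (d c) g
      < ENNReal.ofReal Λ * ∫⁻ x in lens s c (u c) (d c), g x := by
  by_contra! hle
  set θ := (1 + (1 + s) / (K - 1 - s)) ^ (k + 2) with hθ
  have hθ0 : 0 ≤ θ := by positivity
  set T := ∫⁻ x in {x | ‖J x‖ ≤ K + s}, ENNReal.ofReal ((1 + ‖x‖) ^ k)⁻¹
  set A := Λ * (s - η) ^ (k + 1)
  set B := (k + 1) * θ ^ 3 * (q * s) ^ (k + 1)
  have hB : 0 ≤ B := by positivity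
  set bound := ENNReal.ofReal B * T / ENNReal.ofReal (A - B)
  have hbound : bound < ⊤ :=
    ENNReal.div_lt_top (ENNReal.mul_ne_top ENNReal.ofReal_ne_top hT.ne) (by simpa using hlt)
  set S := {z : Space (k + 1) | K + s < ‖J z‖}
  have hS : MeasurableSet S := (isOpen_lt_norm_apply J _).measurableSet
  have hgS : ∀ z, K - 1 - s < ‖J z‖ → g z ≤ 1 := fun z hz =>
    hg1 z (hR.trans_lt (hz.trans_le (hJ z)))
  have key : ∀ N : ℕ, ∫⁻ z in S, ENNReal.ofReal (truncatedWeight k ((N : ℝ) + 1) z) * g z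
      ≤ bound := by
    intro N
    have hN0 : (0 : ℝ) < (N : ℝ) + 1 := by positivity
    have hN1 : (1 : ℝ) ≤ (N : ℝ) + 1 := by simp
    have hwm : Measurable fun z => ENNReal.ofReal (truncatedWeight k ((N : ℝ) + 1) z) := by
      fun_prop
    have hW : ∀ x y : Space (k + 1), K - 1 - s ≤ ‖y‖ → ‖x - y‖ ≤ 1 + s →
        ENNReal.ofReal (truncatedWeight k ((N : ℝ) + 1) y)
          ≤ ENNReal.ofReal θ * ENNReal.ofReal (truncatedWeight k ((N : ℝ) + 1) x) := by
      intro x y hy hxy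
      rw [← ENNReal.ofReal_mul hθ0]
      exact ENNReal.ofReal_le_ofReal (truncatedWeight_le_mul hN0 hK hy hxy)
    have h := mul_lintegral_le_mul_lintegral_of_forall_le hJ hg hwm hum hη hη1 hηs hq hθ0 hΛ hW hs
      hu1 hd hul hp hle
    -- The truncation is there for this finiteness alone, without which the term on the right could
    -- not be absorbed.
    have hfin : ∫⁻ z in S, ENNReal.ofReal (truncatedWeight k ((N : ℝ) + 1) z) * g z ≠ ⊤ := by
      refine ne_top_of_le_ne_top (lintegral_truncatedWeight_lt_top (k := k) hN1).ne ?_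
      refine (setLIntegral_mono' hS fun z hz => ?_).trans (setLIntegral_le_lintegral S _)
      exact mul_le_of_le_one_right' (hgS z (by have : K + s < ‖J z‖ := hz; linarith))
    refine le_div_of_mul_le_mul_add hB hlt hfin (h.trans ?_)
    gcongr
    have hsub : {z : Space (k + 1) | K - 1 - s < ‖J z‖} ⊆
        S ∪ {z | K - 1 - s < ‖J z‖ ∧ ‖J z‖ ≤ K + s} := by
      intro z hz
      rcases lt_or_ge (K + s) ‖J z‖ with h | h
      · exact Or.inl h
      · exact Or.inr ⟨hz, h⟩
    refine (lintegral_mono_set hsub).trans ((lintegral_union_le _ _ _).trans ?_)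
    gcongr
    have hm : MeasurableSet {z : Space (k + 1) | K - 1 - s < ‖J z‖ ∧ ‖J z‖ ≤ K + s} := by
      measurability
    refine (setLIntegral_mono' hm fun z hz => ?_).trans
      (lintegral_mono_set fun z hz => hz.2)
    exact (mul_le_of_le_one_right' (hgS z hz.1)).trans
      (ENNReal.ofReal_le_ofReal (truncatedWeight_le hN0 z))
  have hlim : ∫⁻ z in S, ENNReal.ofReal ((1 + ‖z‖) ^ k)⁻¹ * g z ≤ bound := by
    have hten : ∀ z ∈ S, ENNReal.ofReal ((1 + ‖z‖) ^ k)⁻¹ * g z = liminf (fun N : ℕ =>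
        ENNReal.ofReal (truncatedWeight k ((N : ℝ) + 1) z) * g z) atTop := by
      intro z hz
      refine (Tendsto.liminf_eq ?_).symm
      refine ENNReal.Tendsto.mul_const (ENNReal.tendsto_ofReal (tendsto_truncatedWeight z))
        (Or.inr ?_)
      exact ne_top_of_le_ne_top ENNReal.one_ne_top
        (hgS z (by have : K + s < ‖J z‖ := hz; linarith))
    rw [setLIntegral_congr_fun hS hten]
    refine (lintegral_liminf_le fun N => by fun_prop).trans ?_
    exact liminf_le_of_le (by isBoundedDefault) fun b hb => by
      obtain ⟨N, hN⟩ := hb.exists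
      exact hN.trans (key N)
  have hsub : {x : Space (k + 1) | R < ‖x‖} ⊆ S ∪ {z | R < ‖z‖ ∧ ‖J z‖ ≤ K + s} := by
    intro z hz
    rcases lt_or_ge (K + s) ‖J z‖ with h | h
    · exact Or.inl h
    · exact Or.inr ⟨hz, h⟩
  have hm : MeasurableSet {z : Space (k + 1) | R < ‖z‖ ∧ ‖J z‖ ≤ K + s} := by
    measurability
  have htube : ∫⁻ z in {z : Space (k + 1) | R < ‖z‖ ∧ ‖J z‖ ≤ K + s},
      ENNReal.ofReal ((1 + ‖z‖) ^ k)⁻¹ * g z ≤ T :=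
    (setLIntegral_mono' hm fun z hz => mul_le_of_le_one_right' (hg1 z hz.1)).trans
      (lintegral_mono_set fun z hz => hz.2)
  have := (lintegral_mono_set hsub).trans ((lintegral_union_le _ _ _).trans (add_le_add hlim htube))
  rw [hgt] at this
  exact (ENNReal.add_lt_top.2 ⟨hbound, hT⟩).not_ge this

/-- As η → 0 and K → ∞ the constants become k + 1 and Λ, up to the common factor s^(k+1). The order
matters: `η` is fixed first, because it determines how close `f` must be to 1 and hence how large
`K` has to be. -/
theorem exists_lensBoundaryIntegral_lt (hs : 0 < s) (hΛ : k + 1 < Λ) {η₀ : ℝ} (hη₀ : 0 < η₀) :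
    ∃ η, 0 < η ∧ η < η₀ ∧ ∃ K₀ : ℝ, ∀ K, K₀ ≤ K →
      ∀ (J : Space (k + 1) →L[ℝ] Space (k + 1)) (g : Space (k + 1) → ℝ≥0∞)
        (u : Space (k + 1) → Space (k + 1)) (d : Space (k + 1) → ℝ) (R : ℝ),
      (∀ x, ‖J x‖ ≤ ‖x‖) → Measurable g → Measurable u → (∀ c, K < ‖J c‖ → ‖u c‖ = 1) →
      (∀ c, K < ‖J c‖ → d c ∈ Icc 0 η) →
      (∀ x y, K - 1 < ‖J x‖ → K - 1 < ‖J y‖ → ‖u x - u y‖ ≤ s⁻¹ * ‖x - y‖) →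
      (∀ c, K < ‖J c‖ → ∀ c', K < ‖J c'‖ →
        ‖(d c / 2) • u c - (d c' / 2) • u c'‖ ≤ 2 * η * ‖c - c'‖) →
      R ≤ K - 1 - s → (∀ x, R < ‖x‖ → g x ≤ 1) →
      ∫⁻ x in {x | ‖J x‖ ≤ K + s}, ENNReal.ofReal ((1 + ‖x‖) ^ k)⁻¹ < ⊤ →
      ∫⁻ x in {x | R < ‖x‖}, ENNReal.ofReal ((1 + ‖x‖) ^ k)⁻¹ * g x = ⊤ →
      ∃ c, K < ‖J c‖ ∧ ENNReal.ofReal s * lensBoundaryIntegral s c (u c) (d c) g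
        < ENNReal.ofReal Λ * ∫⁻ x in lens s c (u c) (d c), g x := by
  have h1 : ∀ᶠ η in 𝓝[>] (0 : ℝ),
      (k + 1) * ((1 - 2 * η)⁻¹ * s) ^ (k + 1) < Λ * (s - η) ^ (k + 1) := by
    refine Filter.Eventually.filter_mono nhdsWithin_le_nhds (ContinuousAt.eventually_lt ?_ ?_ ?_)
    · refine ContinuousAt.mul continuousAt_const (ContinuousAt.pow (ContinuousAt.mul ?_
        continuousAt_const) _)
      exact ContinuousAt.inv₀ (by fun_prop) (by norm_num)
    · fun_prop
    · simp only [mul_zero, sub_zero, inv_one, one_mul]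
      gcongr
  obtain ⟨η, ⟨hη1, hη⟩, hηpos⟩ := ((h1.and (eventually_nhdsWithin_of_eventually_nhds
    (eventually_lt_nhds (lt_min hη₀ (lt_min hs (show (0 : ℝ) < 1 / 4 by norm_num)))))).and
    self_mem_nhdsWithin).exists
  obtain ⟨hη0, hη⟩ := lt_min_iff.1 hη
  obtain ⟨hηs, hη4⟩ := lt_min_iff.1 hη
  have hηpos : 0 < η := hηpos
  have h2 : Tendsto (fun K : ℝ => (k + 1) * ((1 + (1 + s) / (K - 1 - s)) ^ (k + 2)) ^ 3 *
      ((1 - 2 * η)⁻¹ * s) ^ (k + 1)) atTop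
      (𝓝 ((k + 1) * ((1 + 0) ^ (k + 2)) ^ 3 * ((1 - 2 * η)⁻¹ * s) ^ (k + 1))) := by
    have h3 : Tendsto (fun K : ℝ => K - 1 - s) atTop atTop := by
      simp_rw [sub_sub, sub_eq_add_neg]
      exact tendsto_atTop_add_const_right _ _ tendsto_id
    exact ((((h3.const_div_atTop _).const_add _).pow _).pow _).const_mul _ |>.mul_const _
  have h4 := h2.eventually_lt_const (u := Λ * (s - η) ^ (k + 1))
    (by rw [add_zero, one_pow, one_pow, mul_one]; exact hη1)
  obtain ⟨K₀, hK₀⟩ := eventually_atTop.1 (h4.and (eventually_gt_atTop (1 + s)))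
  refine ⟨η, hηpos, hη0, K₀, fun K hK J g u d R hJ hg hum hu1 hd hul hp hR hg1 hT hgt => ?_⟩
  obtain ⟨hlt, hK1⟩ := hK₀ K hK
  have hq0 : 0 ≤ (1 - 2 * η)⁻¹ := inv_nonneg.2 (by linarith)
  lift (1 - 2 * η)⁻¹ to ℝ≥0 using hq0 with q hqe
  have hq : 1 ≤ (q : ℝ) * (1 - 2 * η) := by
    rw [hqe, inv_mul_cancel₀ (by linarith)]
  exact exists_lensBoundaryIntegral_lt_of_lt hJ hg hum hηpos.le (by linarith) hηs.le hq
    (by have : (0 : ℝ) ≤ k := k.cast_nonneg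
        linarith) (by linarith) hs hu1 hd hul hp hlt hR hg1 hT hgt

/-! ### Constants and radii from the hypotheses; the main theorem -/

theorem exists_volume_ball_eq (k : ℕ) {m : ℝ≥0} (hm : 0 < m) :
    ∃ s : ℝ, 0 < s ∧ volume (Metric.ball (0 : Space (k + 1)) s) = m := by
  set ω := volume (Metric.ball (0 : Space (k + 1)) 1) with hω
  have hω0 : ω ≠ 0 := (Metric.measure_ball_pos _ _ one_pos).ne'
  have hωt : ω ≠ ⊤ := measure_ball_lt_top.ne
  have hωr : 0 < ω.toReal := ENNReal.toReal_pos hω0 hωt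
  have hm' : (0 : ℝ) < m := hm
  refine ⟨(m / ω.toReal) ^ (((k + 1 : ℕ) : ℝ)⁻¹), by positivity, ?_⟩
  rw [Measure.addHaar_ball volume _ (by positivity), finrank_euclideanSpace_fin,
    Real.rpow_inv_natCast_pow (by positivity) k.succ_ne_zero,
    ENNReal.ofReal_div_of_pos hωr, ENNReal.ofReal_toReal hωt, ENNReal.ofReal_coe_nnreal]
  exact ENNReal.div_mul_cancel hω0 hωt

theorem one_add_absSubOne {a : ℝ≥0∞} (ha : 1 ≤ a) : 1 + absSubOne a = a := by
  rw [absSubOne, tsub_eq_zero_of_le ha, add_zero, add_tsub_cancel_of_le ha]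

theorem exists_forall_lt_norm {n : ℕ} {p : Space n → Prop}
    (hp : ∀ᶠ x in Bornology.cobounded (Space n), p x) : ∃ M : ℝ, ∀ x, M < ‖x‖ → p x := by
  obtain ⟨M, -, hM⟩ := hasBasis_cobounded_norm.eventually_iff.1 hp
  exact ⟨M, fun x hx => hM hx.le⟩

theorem exists_coe_lt_optimalRatio {n : ℕ} {f : Space n → ℝ≥0} {h : Space n → Dir n → ℝ≥0}
    {a : ℝ≥0∞} (ha : a < optimalRatio f h) : ∃ C : ℝ≥0, a < C ∧
      ∃ M : ℝ, ∀ x : Space n, M < ‖x‖ → (C : ℝ≥0∞) * hTilde h x ≤ fTilde f x := by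
  obtain ⟨_, ⟨C, hC, rfl⟩, haC⟩ := lt_sSup_iff.1 ha
  exact ⟨C, haC, hC⟩

theorem measurable_absSubOne : Measurable absSubOne := by
  unfold absSubOne; fun_prop

end DoubleDensity

open DoubleDensity

theorem mainTheorem4 (n : ℕ) (hn : 2 ≤ n)
    (f : DoubleDensity.Space n → ℝ≥0)
    (h : DoubleDensity.Space n → DoubleDensity.Dir n → ℝ≥0)
    (hfh : DoubleDensity.IsDoubleDensity f h)
    (hh : ∀ ν : DoubleDensity.Dir n,
      Tendsto (fun x => h x ν) (Bornology.cobounded (DoubleDensity.Space n)) (𝓝 1))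
    (hf_above : DoubleDensity.ConvergesFromAbove (fun x => (f x : ℝ≥0∞)) 1)
    (hh_above : DoubleDensity.ConvergesFromAbove (DoubleDensity.hPlus h) 1)
    (hratio : ENNReal.ofReal ((n : ℝ) / ((n : ℝ) - 1)) < DoubleDensity.optimalRatio f h)
    (hdiv : ∃ R₀ : ℝ, ∀ R : ℝ, R₀ ≤ R →
      ∫⁻ t in Ioi R, DoubleDensity.radialAverage (DoubleDensity.hTilde h) t = ⊤)
    (m : ℝ≥0) (hm : 0 < m) (r ε : ℝ) (hε : 0 < ε) :
    ∃ F : Set (DoubleDensity.Space n),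
      (∀ x ∈ F, r < ‖x‖) ∧
      DoubleDensity.weightedVolume f F = m ∧
      (∃ ρ : ℝ≥0, DoubleDensity.IsMeanDensity f h F ρ ∧ ρ < 1) ∧
      ∃ (s : ℝ) (a b : DoubleDensity.Space n),
        volume (Metric.ball (0 : DoubleDensity.Space n) s) = m ∧
        ‖a‖ = ‖b‖ ∧ dist a b < ε ∧ F = Metric.ball a s ∩ Metric.ball b s := by
  obtain ⟨j, rfl⟩ := Nat.exists_eq_add_of_le' hn
  obtain ⟨s, hs, hsm⟩ := exists_volume_ball_eq (j + 1) hm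
  obtain ⟨C, hC, M, hM⟩ := exists_coe_lt_optimalRatio hratio
  -- This is C > n/(n-1) in the form (n-1) C > n; the averaging argument is applied with Λ = (n-1)
  -- C.
  have hΛ : ((j + 1 : ℕ) : ℝ) + 1 < ((j + 1 : ℕ) : ℝ) * C := by
    have h1 : ((j + 2 : ℕ) : ℝ) / ((j + 2 : ℕ) - 1) < C := by
      rwa [← ENNReal.ofReal_coe_nnreal, ENNReal.ofReal_lt_ofReal_iff_of_nonneg] at hC
      have : (1 : ℝ) ≤ (j + 2 : ℕ) := by push_cast; linarith [j.cast_nonneg (α := ℝ)]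
      exact div_nonneg (by positivity) (by linarith)
    have h2 : ((j + 2 : ℕ) : ℝ) - 1 = (j + 1 : ℕ) := by push_cast; ring
    rw [h2, div_lt_iff₀ (by positivity)] at h1
    push_cast at h1 ⊢
    linarith
  obtain ⟨η, hη, hηlt, K₀, hK₀⟩ := exists_lensBoundaryIntegral_lt hs hΛ
    (lt_min hε (lt_min hs (show (0 : ℝ) < 1 / 2 by norm_num)))
  obtain ⟨hηε, hηlt⟩ := lt_min_iff.1 hηlt
  obtain ⟨hηs, hη2⟩ := lt_min_iff.1 hηlt
  obtain ⟨δ, hδ, hfield⟩ := exists_lens_field (j + 1) hs hη hη2.le hηs.le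
  obtain ⟨-, hf_lim, Mf, hMf⟩ := hf_above
  obtain ⟨hh_lsc, hh_lim, Mh, hMh⟩ := hh_above
  obtain ⟨Mf', hMf'⟩ := exists_forall_lt_norm (hf_lim.eventually_le_const
    (show (1 : ℝ≥0∞) < ((1 + δ : ℝ≥0) : ℝ≥0∞) by exact_mod_cast lt_add_of_pos_right 1 hδ))
  obtain ⟨Mh', hMh'⟩ := exists_forall_lt_norm (hh_lim.eventually_le_const
    (show (1 : ℝ≥0∞) < 2 by norm_num))
  obtain ⟨R₀, hR₀⟩ := hdiv
  obtain ⟨R, hR⟩ : ∃ R : ℝ, 1 ≤ R ∧ r ≤ R ∧ M ≤ R ∧ Mf ≤ R ∧ Mh ≤ R ∧ Mf' ≤ R ∧ Mh' ≤ R ∧ R₀ ≤ R :=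
    ((eventually_ge_atTop 1).and ((eventually_ge_atTop r).and ((eventually_ge_atTop M).and
      ((eventually_ge_atTop Mf).and ((eventually_ge_atTop Mh).and ((eventually_ge_atTop Mf').and
        ((eventually_ge_atTop Mh').and (eventually_ge_atTop R₀)))))))).exists
  obtain ⟨hR1, hRr, hRM, hRf, hRh, hRf', hRh', hRR⟩ := hR
  have hhg : ∀ x, R < ‖x‖ → hPlus h x = 1 + hTilde h x := fun x hx =>
    (one_add_absSubOne (hMh x (hRh.trans_lt hx))).symm
  have hfg : ∀ x, R < ‖x‖ → 1 + C * hTilde h x ≤ f x := fun x hx =>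
    (add_le_add_right (hM x (hRM.trans_lt hx)) 1).trans
      (one_add_absSubOne (hMf x (hRf.trans_lt hx))).le
  have hg1 : ∀ x, R < ‖x‖ → hTilde h x ≤ 1 := by
    intro x hx
    have h2 : 1 + hTilde h x ≤ 1 + 1 := by
      rw [← hhg x hx, one_add_one_eq_two]
      exact hMh' x (hRh'.trans_lt hx)
    exact (ENNReal.add_le_add_iff_left ENNReal.one_ne_top).1 h2
  have hgm : Measurable (hTilde h) := measurable_absSubOne.comp hh_lsc.measurable
  -- The second bound keeps every lens in |x| > R. It also gives K - 1 ≥ s and K ≥ 1, which make `u`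
  -- both s⁻¹-Lipschitz and 1-Lipschitz where this is needed.
  set K := max K₀ (R + s + 1)
  have hKR : R + s + 1 ≤ K := le_max_right _ _
  let J : Space (j + 1 + 1) →L[ℝ] Space (j + 1 + 1) := quarterTurn j
  have hJ : ∀ x, ‖J x‖ ≤ ‖x‖ := norm_quarterTurn_le
  let u : Space (j + 1 + 1) → Space (j + 1 + 1) := fun c => ‖J c‖⁻¹ • J c
  have hum : Measurable u := by unfold u; fun_prop
  have hu1 : ∀ c, K < ‖J c‖ → ‖u c‖ = 1 := fun c hc => by
    have h0 : ‖J c‖ ≠ 0 := by linarith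
    rw [norm_smul, norm_inv, norm_norm, inv_mul_cancel₀ h0]
  have hul : ∀ ρ, 0 < ρ → ∀ x y, ρ ≤ ‖J x‖ → ρ ≤ ‖J y‖ → ‖u x - u y‖ ≤ ρ⁻¹ * ‖x - y‖ := by
    intro ρ hρ x y hx hy
    refine (norm_normalize_sub_normalize_le hρ hx hy).trans ?_
    rw [← map_sub]
    gcongr
    exact hJ _
  obtain ⟨d, hd, hp⟩ := hfield f R {c | K < ‖J c‖} u hfh.lsc_volume.measurable
    (fun x hx => ENNReal.coe_le_coe.1 (hMf x (hRf.trans_lt hx)))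
    (fun x hx => ENNReal.coe_le_coe.1 (hMf' x (hRf'.trans_lt hx)))
    (fun c (hc : K < ‖J c‖) => by linarith [hJ c]) hu1
    (fun c (hc : K < ‖J c‖) c' (hc' : K < ‖J c'‖) => by
      simpa using hul 1 one_pos c c' (by linarith) (by linarith))
  obtain ⟨c, hc, hlt⟩ := hK₀ K (le_max_left _ _) J (hTilde h) u d R hJ hgm hum hu1
    (fun c hc => (hd c hc).1) (fun x y hx hy => hul s hs x y (by linarith) (by linarith)) hp
    (by linarith) hg1 (lintegral_weight_tube_lt_top j (K + s))
    (lintegral_weight_eq_top hgm hR1 (hR₀ R hRR))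
  obtain ⟨⟨hd0, hdη⟩, hvol⟩ := hd c hc
  have hcK : K < ‖c‖ := hc.trans_le (hJ c)
  have hfar : ∀ x, ‖x - c‖ ≤ s + d c / 2 → R < ‖x‖ := fun x hx => by
    have := norm_sub_norm_le c x
    rw [norm_sub_rev] at this
    linarith
  have hfar' : ∀ x ∈ lens s c (u c) (d c), R < ‖x‖ := fun x hx =>
    hfar x (norm_sub_lt_of_mem_lens (hu1 c hc) hd0 hx).le
  have hP := mul_weightedPerimeter_lens_lt hh_lsc.measurable hgm (C := C) hs c (hu1 c hc) hd0
    (by linarith) (fun x hx => hhg x (hfar x hx)) (fun x hx => hfg x (hfar' x hx)) hvol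
    (by rwa [ENNReal.ofReal_mul (by positivity), ENNReal.ofReal_natCast,
      ENNReal.ofReal_coe_nnreal] at hlt)
  refine ⟨lens s c (u c) (d c), fun x hx => hRr.trans_lt (hfar' x hx), hvol.trans hsm,
    exists_isMeanDensity_lt_one (hasFinitePerimeter_inter_ball _ _ hs) hs hvol hP, s,
    c - (d c / 2) • u c, c + (d c / 2) • u c, hsm, ?_, ?_, rfl⟩
  -- The displacement is tangential, so Pythagoras gives both centres the same norm.
  · refine norm_sub_eq_norm_add (𝕜 := ℝ) ?_
    rw [real_inner_comm, inner_smul_right, inner_smul_right, inner_quarterTurn, mul_zero, mul_zero]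
  · have h1 : c - (d c / 2) • u c - (c + (d c / 2) • u c) = -(d c • u c) := by module
    rw [dist_eq_norm, h1, norm_neg, norm_smul, hu1 c hc, mul_one, Real.norm_of_nonneg hd0]
    linarith
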